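/- For $d\ge 1$ and $r>0$ let $\mathbb{B}^d_{r/2}(z)=\{x\in\mathbb{R}^d:\|x-z\|\le r/2\}$, and let \[ K_{d,r}(x,y)=\frac{1}{\mathrm{vol}(\mathbb{B}^d_{r/2}(0))}\int_{\mathbb{R}^d}\delta_x\big(\mathbb{B}^d_{r/2}(z)\big)\,\delta_y\big(\mathbb{B}^d_{r/2}(z)\big)\,\mathrm{d}z,\qquad x,y\in\mathbb{R}^d, \] where $\delta_x$ is the Dirac measure at $x$. This is a positive semidefinite kernel; let $\mathcal{H}$ denote the reproducing kernel Hilbert space of complex-valued functions on $\mathbb{R}^3$ with kernel $K_{3,r}$. Let $\mathbb{H}^2(\mathbb{R}^3)$ be the Sobolev space of all $u\in L_2(\mathbb{R}^3)$ with $\|u\|_{\mathbb{H}^2}:=\|(1+\|\xi\|^2)\,\hat u(\xi)\|_{L_2(\mathbb{R}^3)}<\infty$. For every $m\ge 0$ let $(Y^m_l)_l$ be an orthonormal basis, in $L_2(\mathbb{S}^2)$ with respect to the normalized surface measure, of the (finite-dimensional) space of spherical harmonics of degree $m$, that is, of the restrictions to $\mathbb{S}^2$ of the homogeneous harmonic polynomials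 of degree $m$. The Sobolev space $\mathbb{H}^{3/2}(\mathbb{S}^2)$ is the reproducing kernel Hilbert space with the kernel \[ (x,y)\mapsto\sum_{m=0}^\infty (1+m(m+1))^{-3/2}\sum_{l}Y^m_l(x)\overline{Y^m_l(y)},\qquad x,y\in\mathbb{S}^2 . \] Let $r\ge 1$. Then: 1. $\mathcal{H}$ is continuously embedded into $\mathbb{H}^2(\mathbb{R}^3)$: there is an injective bounded linear map $J:\mathcal{H}\to\mathbb{H}^2(\mathbb{R}^3)$ such that $Jf=f$ almost everywhere for all $f\in\mathcal{H}$. 2. The reverse embedding does not hold: there is $u\in\mathbb{H}^2(\mathbb{R}^3)$ that does not coincide almost everywhere with any element of $\mathcal{H}$. 3. The restriction of $K_{3,r}$ to $\mathbb{S}^2\times\mathbb{S}^2$ reproduces $\mathbb{H}^{3/2}(\mathbb{S}^2)$ with an equivalent norm: the series above converges for all $x,y\in\mathbb{S}^2$ and defines a positive semidefinite kernel, and the reproducing kernel Hilbert space of $K_{3,r}|_{\mathbb{S}^2\times\mathbb{S}^2}$ and $\mathbb{H}^{3/2}(\mathbb{S}^2)$ consist of the same functions $\mathbb{S}^2\to\mathbb{C}$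 and have equivalent norms. -/

import Mathlib

open MeasureTheory Metric

open scoped SchwartzMap ComplexConjugate

noncomputable section

namespace BallDiscrepancy

/-! ### Scalar kernels and their reproducing kernel Hilbert spaces -/

/-- A scalar kernel `k`, read as an operator-valued kernel `X × X → (ℂ →L[ℂ] ℂ)`; this is the
format in which `RKHS.OfKernel` takes its kernels. -/
def kernelMatrix {X : Type*} (k : X → X → ℂ) : Matrix X X (ℂ →L[ℂ] ℂ) :=
  Matrix.of fun x y => k x y • ContinuousLinearMap.id ℂ ℂ

/-! ### The ball-discrepancy kernel -/

/-- The ball-discrepancy kernel on `ℝ^d`: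
`K_{d,r}(x,y) = vol(B_{r/2})⁻¹ ∫ δ_x(B_{r/2}(z)) δ_y(B_{r/2}(z)) dz`. -/
def ballKernel (d : ℕ) (r : ℝ) (x y : EuclideanSpace ℝ (Fin d)) : ℝ :=
  (volume.real (closedBall (0 : EuclideanSpace ℝ (Fin d)) (r / 2)))⁻¹ *
    ∫ z : EuclideanSpace ℝ (Fin d),
      (Measure.dirac x).real (closedBall z (r / 2)) * (Measure.dirac y).real (closedBall z (r / 2))

/-- `K_{d,r}` as a kernel for complex-valued functions on `ℝ^d`. -/
def ballMatrix (d : ℕ) (r : ℝ) :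
    Matrix (EuclideanSpace ℝ (Fin d)) (EuclideanSpace ℝ (Fin d)) (ℂ →L[ℂ] ℂ) :=
  kernelMatrix fun x y => (ballKernel d r x y : ℂ)

/-- The restriction of `K_{d,r}` to `S^{d-1} × S^{d-1}`. -/
def ballMatrixSphere (d : ℕ) (r : ℝ) :
    Matrix (sphere (0 : EuclideanSpace ℝ (Fin d)) 1) (sphere (0 : EuclideanSpace ℝ (Fin d)) 1)
      (ℂ →L[ℂ] ℂ) :=
  kernelMatrix fun x y => (ballKernel d r x y : ℂ)

theorem integrable_dirac_mul_dirac (d : ℕ) (s : ℝ) (x y : EuclideanSpace ℝ (Fin d)) :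
    Integrable fun z : EuclideanSpace ℝ (Fin d) =>
      (Measure.dirac x).real (closedBall z s) * (Measure.dirac y).real (closedBall z s) := by
  have h : ∀ w z : EuclideanSpace ℝ (Fin d),
      (Measure.dirac w).real (closedBall z s) = (closedBall w s).indicator (fun _ => (1 : ℝ)) z := by
    intro w z
    rw [measureReal_def, Measure.dirac_apply' _ measurableSet_closedBall]
    by_cases hw : dist w z ≤ s
    · have hw' : dist z w ≤ s := by rwa [dist_comm]
      simp [Set.indicator, mem_closedBall, hw, hw']
    · have hw' : ¬ dist z w ≤ s := by rwa [dist_comm]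
      simp [Set.indicator, mem_closedBall, hw, hw']
  simp_rw [h]
  have h2 : (fun z => (closedBall x s).indicator (fun _ => (1 : ℝ)) z *
      (closedBall y s).indicator (fun _ => (1 : ℝ)) z) =
      (closedBall x s ∩ closedBall y s).indicator (fun _ => (1 : ℝ)) := by
    ext z
    by_cases h1 : z ∈ closedBall x s <;> by_cases h2 : z ∈ closedBall y s <;>
      simp [Set.indicator, h1, h2]
  rw [h2]
  refine IntegrableOn.integrable_indicator ?_
    (measurableSet_closedBall.inter measurableSet_closedBall)
  refine integrableOn_const ?_
  exact (lt_of_le_of_lt (measure_mono Set.inter_subset_left) measure_closedBall_lt_top).ne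

/-- The kernel `K_{d,r}` is positive semidefinite, so that it has a reproducing kernel Hilbert
space `RKHS.OfKernel (ballMatrix d r)`. -/
theorem posSemidef_ballMatrix (d : ℕ) (r : ℝ) : (ballMatrix d r).PosSemidef := by
  have tfae := (RKHS.posSemidef_tfae (K := ballMatrix d r)).out 0 2
  refine tfae.mpr ⟨?_, fun vv => ?_⟩
  · have hid : star (ContinuousLinearMap.id ℂ ℂ) = ContinuousLinearMap.id ℂ ℂ :=
      star_one (ℂ →L[ℂ] ℂ)
    ext x y
    simp [hid, ballMatrix, kernelMatrix, Matrix.conjTranspose_apply, ballKernel, mul_comm]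
  · set φ : EuclideanSpace ℝ (Fin d) → EuclideanSpace ℝ (Fin d) → ℝ :=
      fun x z => (Measure.dirac x).real (closedBall z (r / 2)) with hφ
    set c : ℝ := (volume.real (closedBall (0 : EuclideanSpace ℝ (Fin d)) (r / 2)))⁻¹ with hc
    have hint : ∀ x y, Integrable fun z => φ x z * φ y z :=
      fun x y => integrable_dirac_mul_dirac d (r / 2) x y
    have key : RCLike.re (vv.sum fun x w => vv.sum fun x' w' =>
        inner ℂ (ballMatrix d r x' x w) w') =
        c * ∫ z, ((∑ x ∈ vv.support, φ x z * (vv x).re) ^ 2 +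
          (∑ x ∈ vv.support, φ x z * (vv x).im) ^ 2) := by
      have e : ∀ z, ((∑ x ∈ vv.support, φ x z * (vv x).re) ^ 2 +
          (∑ x ∈ vv.support, φ x z * (vv x).im) ^ 2) =
          ∑ x ∈ vv.support, ∑ x' ∈ vv.support, (φ x' z * φ x z) *
            ((vv x).re * (vv x').re + (vv x).im * (vv x').im) := by
        intro z
        rw [sq, sq, Finset.sum_mul_sum, Finset.sum_mul_sum, ← Finset.sum_add_distrib]
        refine Finset.sum_congr rfl fun x _ => ?_
        rw [← Finset.sum_add_distrib]
        exact Finset.sum_congr rfl fun x' _ => by ring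
      simp_rw [e]
      rw [integral_finsetSum _ fun x _ => integrable_finsetSum _ fun x' _ =>
        (hint x' x).mul_const _, Finset.mul_sum]
      simp only [Finsupp.sum, map_sum]
      refine Finset.sum_congr rfl fun x _ => ?_
      rw [integral_finsetSum _ fun x' _ => (hint x' x).mul_const _, Finset.mul_sum]
      refine Finset.sum_congr rfl fun x' _ => ?_
      rw [integral_mul_const, ← mul_assoc]
      have : c * ∫ z, φ x' z * φ x z = ballKernel d r x' x := rfl
      rw [this]
      simp [ballMatrix, kernelMatrix]
      ring
    rw [key]
    refine mul_nonneg (inv_nonneg.mpr measureReal_nonneg) (integral_nonneg fun z => ?_)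
    positivity

instance (d : ℕ) (r : ℝ) : Fact (ballMatrix d r).PosSemidef := ⟨posSemidef_ballMatrix d r⟩

instance (d : ℕ) (r : ℝ) : Fact (ballMatrixSphere d r).PosSemidef :=
  ⟨(posSemidef_ballMatrix d r).submatrix Subtype.val⟩

/-! ### The Sobolev space `H^s(ℝ^d)` for `s ≥ 0`, as a normed space -/

/-- The square integrable functions on `ℝ^d` which lie in the Sobolev space `H^s`. -/
def sobolevSubmodule (d : ℕ) (s : ℝ) :
    Submodule ℂ (Lp ℂ 2 (volume : Measure (EuclideanSpace ℝ (Fin d)))) where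
  carrier := {u | TemperedDistribution.MemSobolev s 2 (u : 𝓢'(EuclideanSpace ℝ (Fin d), ℂ))}
  zero_mem' := by
    have h : ((0 : Lp ℂ 2 (volume : Measure (EuclideanSpace ℝ (Fin d)))) :
        𝓢'(EuclideanSpace ℝ (Fin d), ℂ)) = 0 := by
      rw [← Lp.toTemperedDistributionCLM_apply, map_zero]
    simp only [Set.mem_ofPred_eq, h]
    exact TemperedDistribution.memSobolev_fun_zero _ _ s 2
  add_mem' {u v} hu hv := by
    have h : ((u + v : Lp ℂ 2 (volume : Measure (EuclideanSpace ℝ (Fin d)))) :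
        𝓢'(EuclideanSpace ℝ (Fin d), ℂ)) = u + v := by
      simp only [← Lp.toTemperedDistributionCLM_apply, map_add]
    simp only [Set.mem_ofPred_eq, h]
    exact hu.add hv
  smul_mem' c u hu := by
    have h : ((c • u : Lp ℂ 2 (volume : Measure (EuclideanSpace ℝ (Fin d)))) :
        𝓢'(EuclideanSpace ℝ (Fin d), ℂ)) = c • (u : 𝓢'(EuclideanSpace ℝ (Fin d), ℂ)) := by
      simp only [← Lp.toTemperedDistributionCLM_apply, map_smul]
    simp only [Set.mem_ofPred_eq, h]
    exact hu.smul c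

/-- The Sobolev space `H^s(ℝ^d)`, `s ≥ 0`, of complex-valued functions. Its norm is
`‖u‖_{H^s} = ‖𝓕⁻ ((1 + |ξ|²)^{s/2} 𝓕 u)‖_{L²}`. -/
def SobolevSpace (d : ℕ) (s : ℝ) : Type := sobolevSubmodule d s

namespace SobolevSpace

variable {d : ℕ} {s : ℝ}

instance : AddCommGroup (SobolevSpace d s) := inferInstanceAs (AddCommGroup (sobolevSubmodule d s))

instance : Module ℂ (SobolevSpace d s) := inferInstanceAs (Module ℂ (sobolevSubmodule d s))

/-- The underlying square integrable function. -/
def toL2 : SobolevSpace d s →ₗ[ℂ] Lp ℂ 2 (volume : Measure (EuclideanSpace ℝ (Fin d))) :=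
  (sobolevSubmodule d s).subtype

theorem toTemperedDistribution_injective : Function.Injective
    (Lp.toTemperedDistributionCLM ℂ (volume : Measure (EuclideanSpace ℝ (Fin d))) 2) :=
  LinearMap.ker_eq_bot.mp Lp.ker_toTemperedDistributionCLM_eq_bot

theorem exists_bessel (u : SobolevSpace d s) :
    ∃ v : Lp ℂ 2 (volume : Measure (EuclideanSpace ℝ (Fin d))),
      TemperedDistribution.besselPotential _ ℂ s
        (toL2 u : 𝓢'(EuclideanSpace ℝ (Fin d), ℂ)) = v :=
  u.2

/-- The square integrable function `𝓕⁻ ((1 + |ξ|²)^{s/2} 𝓕 u)`, for `u` in `H^s(ℝ^d)`. -/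
def besselFun (u : SobolevSpace d s) : Lp ℂ 2 (volume : Measure (EuclideanSpace ℝ (Fin d))) :=
  (exists_bessel u).choose

theorem besselFun_spec (u : SobolevSpace d s) :
    Lp.toTemperedDistributionCLM ℂ volume 2 (besselFun u) =
      TemperedDistribution.besselPotential _ ℂ s
        (Lp.toTemperedDistributionCLM ℂ volume 2 (toL2 u)) :=
  (exists_bessel u).choose_spec.symm

/-- `besselFun` as a linear map. -/
def bessel : SobolevSpace d s →ₗ[ℂ] Lp ℂ 2 (volume : Measure (EuclideanSpace ℝ (Fin d))) where
  toFun := besselFun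
  map_add' u v := by
    apply toTemperedDistribution_injective
    rw [map_add, besselFun_spec, besselFun_spec, besselFun_spec, map_add, map_add, map_add]
  map_smul' c u := by
    apply toTemperedDistribution_injective
    rw [RingHom.id_apply, map_smul, besselFun_spec, besselFun_spec, map_smul, map_smul, map_smul]

theorem bessel_spec (u : SobolevSpace d s) :
    TemperedDistribution.besselPotential _ ℂ s (toL2 u : 𝓢'(EuclideanSpace ℝ (Fin d), ℂ)) =
      bessel u :=
  (exists_bessel u).choose_spec

theorem bessel_injective : Function.Injective (bessel : SobolevSpace d s →ₗ[ℂ] _) := by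
  intro u v h
  have h1 := bessel_spec u
  rw [h, ← bessel_spec v] at h1
  have h2 := congrArg (TemperedDistribution.besselPotential _ ℂ (-s)) h1
  simp only [TemperedDistribution.besselPotential_besselPotential_apply, add_neg_cancel,
    TemperedDistribution.besselPotential_zero, ContinuousLinearMap.id_apply] at h2
  exact Subtype.ext (toTemperedDistribution_injective h2)

instance : NormedAddCommGroup (SobolevSpace d s) :=
  NormedAddCommGroup.induced _ _ bessel bessel_injective

instance : NormedSpace ℂ (SobolevSpace d s) := NormedSpace.induced ℂ _ _ bessel

theorem norm_def (u : SobolevSpace d s) : ‖u‖ = ‖bessel u‖ := rfl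

end SobolevSpace

/-! ### Spherical harmonics and the Sobolev space `H^τ(S^{d-1})` -/

/-- The normalized surface measure on `S^{d-1}`. -/
def sphereMeasure (d : ℕ) : Measure (sphere (0 : EuclideanSpace ℝ (Fin d)) 1) :=
  (Measure.toSphere (volume : Measure (EuclideanSpace ℝ (Fin d))) Set.univ)⁻¹ •
    Measure.toSphere (volume : Measure (EuclideanSpace ℝ (Fin d)))

/-- The Laplacian on polynomials in `d` variables. -/
def polyLaplacian (d : ℕ) : MvPolynomial (Fin d) ℂ →ₗ[ℂ] MvPolynomial (Fin d) ℂ :=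
  ∑ i, (MvPolynomial.pderiv i).toLinearMap ∘ₗ (MvPolynomial.pderiv i).toLinearMap

/-- The restriction of a polynomial to the unit sphere. -/
def restrictSphere (d : ℕ) :
    MvPolynomial (Fin d) ℂ →ₗ[ℂ] (sphere (0 : EuclideanSpace ℝ (Fin d)) 1 → ℂ) where
  toFun p x := MvPolynomial.eval (fun i => ((x : EuclideanSpace ℝ (Fin d)) i : ℂ)) p
  map_add' p q := by ext x; simp
  map_smul' c p := by ext x; simp [MvPolynomial.smul_eval]

/-- The spherical harmonics of degree `m` on `S^{d-1}`: the restrictions to the sphere of the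
homogeneous harmonic polynomials of degree `m`. -/
def sphericalHarmonics (d m : ℕ) :
    Submodule ℂ (sphere (0 : EuclideanSpace ℝ (Fin d)) 1 → ℂ) :=
  (MvPolynomial.homogeneousSubmodule (Fin d) ℂ m ⊓ LinearMap.ker (polyLaplacian d)).map
    (restrictSphere d)

/-- `Y` is an orthonormal basis of the spherical harmonics of degree `m`, with respect to the inner
product of `L²(S^{d-1})` for the normalized surface measure. -/
structure IsSphericalHarmonicBasis (d m : ℕ) {ι : Type*}
    (Y : ι → sphere (0 : EuclideanSpace ℝ (Fin d)) 1 → ℂ) : Prop where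
  span_eq : Submodule.span ℂ (Set.range Y) = sphericalHarmonics d m
  integral_self : ∀ l, ∫ x, Y l x * conj (Y l x) ∂(sphereMeasure d) = 1
  integral_ne : ∀ l l', l ≠ l' → ∫ x, Y l x * conj (Y l' x) ∂(sphereMeasure d) = 0

/-- The `m`-th term `(1 + m(m+d-2))^{-τ} ∑_l Y^m_l(x) conj (Y^m_l(y))` of the kernel of
`H^τ(S^{d-1})`. -/
def sphereSobolevTerm (d : ℕ) (τ : ℝ) {ι : ℕ → Type*} [∀ m, Fintype (ι m)]
    (Y : ∀ m, ι m → sphere (0 : EuclideanSpace ℝ (Fin d)) 1 → ℂ)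
    (x y : sphere (0 : EuclideanSpace ℝ (Fin d)) 1) (m : ℕ) : ℂ :=
  (((1 + (m : ℝ) * ((m : ℝ) + (d : ℝ) - 2)) ^ (-τ) : ℝ) : ℂ) *
    ∑ l, Y m l x * conj (Y m l y)

/-- The kernel whose reproducing kernel Hilbert space is the Sobolev space `H^τ(S^{d-1})`,
for `τ > (d-1)/2`. -/
def sphereSobolevMatrix (d : ℕ) (τ : ℝ) {ι : ℕ → Type*} [∀ m, Fintype (ι m)]
    (Y : ∀ m, ι m → sphere (0 : EuclideanSpace ℝ (Fin d)) 1 → ℂ) :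
    Matrix (sphere (0 : EuclideanSpace ℝ (Fin d)) 1) (sphere (0 : EuclideanSpace ℝ (Fin d)) 1)
      (ℂ →L[ℂ] ℂ) :=
  kernelMatrix fun x y => ∑' m, sphereSobolevTerm d τ Y x y m

end BallDiscrepancy

end

namespace BallDiscrepancy

/-! With `R = r/2`, the kernel is the Gram kernel `vol(B_R)⁻¹ ⟪1_{B_R(x)}, 1_{B_R(y)}⟫` of
translated ball indicators in `L²(ℝ³)`. Hence each `f` in its RKHS has the form `f x = ⟪ballFeature
R x, g⟫` with `g ∈ L²` depending boundedly on `f` (`exists_feature_representation`). By Plancherel,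
`f` is the inverse Fourier integral of `vol(B_R)^{-1/2} conj(b) ĝ`, where `b` is the Fourier
transform of the indicator of the centred ball, an explicit trigonometric expression in `|ξ|`
(`ballTransform_eq`).

Embedding: `(1+|ξ|²)|b|` is bounded (`exists_ballTransform_bound`), so `(1+|ξ|²) f̂` is square
integrable with norm controlled by `g`. Injectivity holds because elements of the RKHS are
continuous and are therefore determined by their almost everywhere class.

No reverse embedding: `b` vanishes on a sphere `|ξ| = ρ₀`, at least to first order from outside
(`exists_ballTransform_zero`). Take `u` with `(1+|ξ|²) û` the indicator of the ball of radius `2ρ₀`.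
A representing `g` would satisfy `|ĝ| ≥ 1/(M(|ξ| - ρ₀))` on a shell outside that sphere, which
contradicts square integrability (`not_forall_one_le_mul_norm`).

Sphere: in polar coordinates for the ball centre `z = ρω`, the kernel becomes an integral over `ρ`
of areas of intersections of two congruent caps with axes `x` and `y`. The law of `⟨ω, x⟩` is
uniform on `[-1,1]` (`measurePreserving_inner`). Expanding the cap indicator in Legendre polynomials
therefore gives the overlap as `∑ (2m+1) c_m² P_m(⟨x,y⟩)`, with `c_m(s) = ½ ∫_s^1 P_m`
(`hasSum_capOverlap`). By the addition theorem (`harmonicKernel_eq`) both kernels are series in the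
same reproducing kernels of spherical harmonics, so it suffices to compare coefficients: domination
of kernels yields inclusion of the spaces (`exists_inclusion`).

The Sobolev coefficients are of order `(m+1)⁻³`. For `m ≥ 1`, Legendre's equation gives `c_m(s) =
(1-s²)P_m'(s)/(2m(m+1))`. Sonin's monotonicity argument gives `((1-s²)P_m')² ≤ m`, hence the upper
bound. No pointwise lower bound is available, since `P_m'` has zeros, but the integral over `ρ`
averages over cap heights, and equipartition of energy (`le_integral_derivative_legendre_sq`) bounds
the average below by a multiple of `m`. -/

open Polynomial in
/-- The Legendre polynomials, by Bonnet's recurrence. -/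
noncomputable def legendre : ℕ → ℝ[X]
  | 0 => 1
  | 1 => X
  | n + 2 => C ((n + 2 : ℝ)⁻¹) *
      ((2 * (n : ℝ[X]) + 3) * X * legendre (n + 1) - ((n : ℝ[X]) + 1) * legendre n)

/-! ### Legendre polynomials: recurrences, differential equation, orthogonality -/

section Legendre

open Polynomial

theorem legendre_zero : legendre 0 = 1 := by rw [legendre]

theorem legendre_one : legendre 1 = X := by rw [legendre]

theorem legendre_add_two (n : ℕ) : ((n : ℝ[X]) + 2) * legendre (n + 2) =
    (2 * (n : ℝ[X]) + 3) * X * legendre (n + 1) - ((n : ℝ[X]) + 1) * legendre n := by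
  rw [legendre, ← mul_assoc]
  have h : ((n : ℝ[X]) + 2) = C (n + 2 : ℝ) := by simp [C_ofNat]
  have h0 : (n + 2 : ℝ) ≠ 0 := by positivity
  rw [h, ← C_mul, mul_inv_cancel₀ h0, C_1, one_mul]

theorem natCast_add_ne_zero (n k : ℕ) : ((n : ℝ[X]) + (k + 1)) ≠ 0 := by
  have : ((n : ℝ[X]) + (k + 1)) = ((n + k + 1 : ℕ) : ℝ[X]) := by push_cast; ring
  rw [this]
  exact Nat.cast_ne_zero.mpr (by omega)

/-- The two identities are proved together: differentiating Bonnet's recurrence gives the next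
instance of the first only with the help of the second, and the second then follows from both. -/
theorem derivative_legendre_aux (n : ℕ) :
    derivative (legendre (n + 1)) = X * derivative (legendre n) + ((n : ℝ[X]) + 1) * legendre n ∧
    X * derivative (legendre (n + 1)) - derivative (legendre n) =
      ((n : ℝ[X]) + 1) * legendre (n + 1) := by
  induction n with
  | zero => simp [legendre_zero, legendre_one]
  | succ n ih =>
    obtain ⟨ha, hb⟩ := ih
    have hr := legendre_add_two n
    have hd := congrArg derivative hr
    simp only [derivative_mul, derivative_add, derivative_sub, derivative_natCast,
      derivative_ofNat, derivative_X, derivative_one] at hd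
    have h2 : ((n : ℝ[X]) + 2) ≠ 0 := by
      have := natCast_add_ne_zero n 1
      push_cast at this
      convert this using 2; norm_num
    have hA : derivative (legendre (n + 1 + 1)) =
        X * derivative (legendre (n + 1)) + (((n + 1 : ℕ) : ℝ[X]) + 1) * legendre (n + 1) := by
      apply mul_left_cancel₀ h2
      push_cast
      linear_combination hd + ((n : ℝ[X]) + 1) * hb
    refine ⟨hA, ?_⟩
    rw [hA]
    push_cast
    linear_combination X * hb - ha - hr

theorem derivative_legendre_succ (n : ℕ) :
    derivative (legendre (n + 1)) = X * derivative (legendre n) + ((n : ℝ[X]) + 1) * legendre n :=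
  (derivative_legendre_aux n).1

theorem X_mul_derivative_legendre_succ (n : ℕ) :
    X * derivative (legendre (n + 1)) - derivative (legendre n) = ((n : ℝ[X]) + 1) * legendre (n + 1) :=
  (derivative_legendre_aux n).2

/-- Legendre's differential equation. -/
theorem derivative_one_sub_sq_mul_derivative_legendre (n : ℕ) :
    derivative ((1 - X ^ 2) * derivative (legendre n)) = -((n : ℝ[X]) * ((n : ℝ[X]) + 1)) * legendre n := by
  cases n with
  | zero => simp [legendre_zero]
  | succ n =>
    have ha := derivative_legendre_succ n
    have hb := X_mul_derivative_legendre_succ n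
    have hc : (1 - X ^ 2) * derivative (legendre (n + 1)) =
        ((n : ℝ[X]) + 1) * (legendre n - X * legendre (n + 1)) := by
      linear_combination ha - X * hb
    rw [hc]
    simp only [derivative_mul, derivative_add, derivative_sub, derivative_natCast,
      derivative_X, derivative_one]
    push_cast
    linear_combination (-(n : ℝ[X]) - 1) * hb

theorem eval_one_legendre (n : ℕ) : (legendre n).eval 1 = 1 := by
  induction n using Nat.twoStepInduction with
  | zero => simp [legendre_zero]
  | one => simp [legendre_one]
  | more n h0 h1 =>
    have := congrArg (eval 1) (legendre_add_two n)
    simp [h0, h1] at this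
    have h2 : (n + 2 : ℝ) ≠ 0 := by positivity
    apply mul_left_cancel₀ h2
    linarith

theorem eval_neg_one_legendre (n : ℕ) : (legendre n).eval (-1) = (-1) ^ n := by
  induction n using Nat.twoStepInduction with
  | zero => simp [legendre_zero]
  | one => simp [legendre_one]
  | more n h0 h1 =>
    have := congrArg (eval (-1)) (legendre_add_two n)
    simp [h0, h1, pow_succ] at this
    have h2 : (n + 2 : ℝ) ≠ 0 := by positivity
    apply mul_left_cancel₀ h2
    rw [this, pow_add]
    ring

theorem natDegree_legendre_le (n : ℕ) : (legendre n).natDegree ≤ n := by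
  induction n using Nat.twoStepInduction with
  | zero => simp [legendre_zero]
  | one => simp [legendre_one]
  | more n h0 h1 =>
    rw [legendre]
    refine (natDegree_C_mul_le _ _).trans ((natDegree_sub_le _ _).trans (max_le ?_ ?_))
    · have e : (2 * (n : ℝ[X]) + 3) = C (2 * n + 3 : ℝ) := by simp [C_ofNat]
      rw [e, mul_assoc]
      refine (natDegree_C_mul_le _ _).trans (natDegree_mul_le.trans ?_)
      rw [natDegree_X]; omega
    · have e : ((n : ℝ[X]) + 1) = C (n + 1 : ℝ) := by simp
      rw [e]
      exact (natDegree_C_mul_le _ _).trans (by omega)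

theorem coeff_legendre_pos (n : ℕ) : 0 < (legendre n).coeff n := by
  induction n using Nat.twoStepInduction with
  | zero => simp [legendre_zero]
  | one => simp [legendre_one]
  | more n h0 h1 =>
    have e : (2 * (n : ℝ[X]) + 3) = C (2 * n + 3 : ℝ) := by simp [C_ofNat]
    have e' : ((n : ℝ[X]) + 1) = C (n + 1 : ℝ) := by simp
    rw [legendre, coeff_C_mul, coeff_sub, e, e', mul_assoc, coeff_C_mul, coeff_C_mul,
      coeff_X_mul, coeff_eq_zero_of_natDegree_lt ((natDegree_legendre_le n).trans_lt (by omega))]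
    rw [mul_zero, sub_zero]
    positivity

theorem integral_derivative_eval (G : ℝ[X]) (a b : ℝ) :
    ∫ s in a..b, (derivative G).eval s = G.eval b - G.eval a :=
  intervalIntegral.integral_eq_sub_of_hasDerivAt (fun x _ => G.hasDerivAt x)
    ((derivative G).continuous.intervalIntegrable _ _)

theorem intervalIntegrable_eval (G : ℝ[X]) (a b : ℝ) :
    IntervalIntegrable (fun s => G.eval s) MeasureTheory.volume a b :=
  G.continuous.intervalIntegrable _ _

/-- The Legendre operator is symmetric: `G` is the Wronskian of the two polynomials times `1 - X²`,
it vanishes at both endpoints, and its derivative is the product times the difference of the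
eigenvalues. -/
theorem integral_legendre_mul_legendre_of_ne {m n : ℕ} (h : m ≠ n) :
    ∫ s in (-1 : ℝ)..1, (legendre m).eval s * (legendre n).eval s = 0 := by
  set G : ℝ[X] := (1 - X ^ 2) * derivative (legendre n) * legendre m -
    (1 - X ^ 2) * derivative (legendre m) * legendre n with hG
  have hd : derivative G = C ((m * (m + 1) - n * (n + 1) : ℝ)) * (legendre m * legendre n) := by
    rw [hG, derivative_sub, derivative_mul, derivative_mul (g := legendre n),
      derivative_one_sub_sq_mul_derivative_legendre, derivative_one_sub_sq_mul_derivative_legendre]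
    simp only [C_sub, C_mul, C_add, C_1, map_natCast]
    ring
  have hi := integral_derivative_eval G (-1) 1
  rw [hd] at hi
  simp only [eval_mul, eval_C, intervalIntegral.integral_const_mul] at hi
  have hz : G.eval 1 - G.eval (-1) = 0 := by simp [hG]
  rw [hz] at hi
  refine (mul_eq_zero.mp hi).resolve_left ?_
  have hmn : (m : ℝ) ≠ n := by exact_mod_cast h
  have : (m * (m + 1) - n * (n + 1) : ℝ) = (m - n) * (m + n + 1) := by ring
  rw [this]
  exact mul_ne_zero (sub_ne_zero.mpr hmn) (by positivity)

/-- Pairing one instance of Bonnet's recurrence with `P_{n+2}` and the next with `P_{n+1}` evaluates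
`∫ s P_{n+1} P_{n+2}` in two ways, which links the norms of consecutive polynomials. -/
theorem integral_legendre_sq (n : ℕ) :
    ∫ s in (-1 : ℝ)..1, (legendre n).eval s * (legendre n).eval s = 2 / (2 * n + 1) := by
  cases n with
  | zero => norm_num [legendre_zero]
  | succ n =>
    induction n with
    | zero =>
      simp only [zero_add, legendre_one, eval_X, ← pow_two, integral_pow]
      norm_num
    | succ n ih =>
      have h1 : (n + 2 : ℝ) * ∫ s in (-1 : ℝ)..1,
          (legendre (n + 2)).eval s * (legendre (n + 2)).eval s =
          (2 * n + 3) * ∫ s in (-1 : ℝ)..1,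
            s * (legendre (n + 1)).eval s * (legendre (n + 2)).eval s := by
        have h0 := integral_legendre_mul_legendre_of_ne (m := n) (n := n + 2) (by omega)
        have : ∀ s : ℝ, (n + 2 : ℝ) * ((legendre (n + 2)).eval s * (legendre (n + 2)).eval s) =
            (2 * n + 3) * (s * (legendre (n + 1)).eval s * (legendre (n + 2)).eval s) -
            (n + 1) * ((legendre n).eval s * (legendre (n + 2)).eval s) := by
          intro s
          have := congrArg (eval s) (legendre_add_two n)
          simp at this
          linear_combination (legendre (n + 2)).eval s * this
        rw [← intervalIntegral.integral_const_mul]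
        simp_rw [this]
        rw [intervalIntegral.integral_sub, intervalIntegral.integral_const_mul,
          intervalIntegral.integral_const_mul, h0, mul_zero, sub_zero]
        all_goals exact Continuous.intervalIntegrable (by fun_prop) _ _
      have h2 : (2 * n + 5 : ℝ) * ∫ s in (-1 : ℝ)..1,
            s * (legendre (n + 1)).eval s * (legendre (n + 2)).eval s =
          (n + 2) * ∫ s in (-1 : ℝ)..1,
            (legendre (n + 1)).eval s * (legendre (n + 1)).eval s := by
        have h0 := integral_legendre_mul_legendre_of_ne (m := n + 1) (n := n + 3) (by omega)
        have : ∀ s : ℝ, (2 * n + 5 : ℝ) * (s * (legendre (n + 1)).eval s *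
            (legendre (n + 2)).eval s) =
            (n + 3) * ((legendre (n + 1)).eval s * (legendre (n + 3)).eval s) +
            (n + 2) * ((legendre (n + 1)).eval s * (legendre (n + 1)).eval s) := by
          intro s
          have := congrArg (eval s) (legendre_add_two (n + 1))
          simp [add_assoc] at this
          norm_num at this
          linear_combination -(legendre (n + 1)).eval s * this
        rw [← intervalIntegral.integral_const_mul]
        simp_rw [this]
        rw [intervalIntegral.integral_add, intervalIntegral.integral_const_mul,
          intervalIntegral.integral_const_mul, h0, mul_zero, zero_add]
        all_goals exact Continuous.intervalIntegrable (by fun_prop) _ _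
      rw [ih] at h2
      have h3 : ∫ s in (-1 : ℝ)..1, s * (legendre (n + 1)).eval s * (legendre (n + 2)).eval s =
          (n + 2) * (2 / (2 * ((n + 1 : ℕ) : ℝ) + 1)) / (2 * n + 5) := by
        rw [← h2]; field_simp
      rw [h3] at h1
      have h4 : (n + 2 : ℝ) ≠ 0 := by positivity
      apply mul_left_cancel₀ h4
      rw [show n + 1 + 1 = n + 2 from rfl, h1]
      push_cast
      have : (2 * (n + 1) + 1 : ℝ) = 2 * n + 3 := by ring
      have h5 : (2 * (n + 2) + 1 : ℝ) = 2 * n + 5 := by ring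
      rw [this, h5]
      field_simp

end Legendre

/-! ### Bounds for Legendre polynomials and their derivatives -/

section LegendreBounds

open Polynomial Set

/-- `P_n'(0)² + n(n+1) P_n(0)²`. -/
noncomputable def legendreEnergy (n : ℕ) : ℝ :=
  (derivative (legendre n)).eval 0 ^ 2 + n * (n + 1) * (legendre n).eval 0 ^ 2

theorem legendreEnergy_eq (n : ℕ) : legendreEnergy n =
    (n + 1) ^ 2 * (legendre (n + 1)).eval 0 ^ 2 + n * (n + 1) * (legendre n).eval 0 ^ 2 := by
  have := congrArg (eval 0) (X_mul_derivative_legendre_succ n)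
  simp at this
  rw [legendreEnergy]
  linear_combination (-(derivative (legendre n)).eval 0 + (n + 1) * (legendre (n + 1)).eval 0) *
    this

theorem legendreEnergy_succ (n : ℕ) : legendreEnergy (n + 1) =
    (n + 1) ^ 2 * (legendre n).eval 0 ^ 2 + (n + 1) * (n + 2) * (legendre (n + 1)).eval 0 ^ 2 := by
  have := congrArg (eval 0) (derivative_legendre_succ n)
  simp at this
  rw [legendreEnergy, this]
  push_cast
  ring

/-- Consecutive energies are positive combinations of the same two squares `P_n(0)²` and
`P_{n+1}(0)²`. Comparing coefficients puts the growth of the energy from `n` to `n+1` between the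
factors `(n+2)/(n+1)` and `(n+1)/n`, and both products telescope. -/
theorem legendreEnergy_bounds {n : ℕ} (hn : 1 ≤ n) :
    (n + 1) / 2 ≤ legendreEnergy n ∧ legendreEnergy n ≤ n := by
  induction n, hn using Nat.le_induction with
  | base => simp [legendreEnergy, legendre_one]
  | succ n hn ih =>
    have h1 := legendreEnergy_eq n
    have h2 := legendreEnergy_succ n
    have hn0 : (0 : ℝ) < n := by exact_mod_cast hn
    set a := (legendre n).eval 0 ^ 2 with ha
    set b := (legendre (n + 1)).eval 0 ^ 2 with hb
    have ha0 : 0 ≤ a := sq_nonneg _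
    have hb0 : 0 ≤ b := sq_nonneg _
    have hna : 0 ≤ n * a := by positivity
    have hnb : 0 ≤ n * b := by positivity
    push_cast
    constructor
    · have : (n + 1) * legendreEnergy (n + 1) ≥ (n + 2) * legendreEnergy n := by
        rw [h1, h2]; nlinarith
      nlinarith [ih.1]
    · have : n * legendreEnergy (n + 1) ≤ (n + 1) * legendreEnergy n := by
        rw [h1, h2]; nlinarith
      nlinarith [ih.2]

/-- `(1 - s²)² P_n'(s)² + n(n+1) (1 - s²) P_n(s)²`, as a polynomial. -/
noncomputable def legendreSonin (n : ℕ) : ℝ[X] :=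
  ((1 - X ^ 2) * derivative (legendre n)) ^ 2 +
    ((n : ℝ[X]) * ((n : ℝ[X]) + 1)) * ((1 - X ^ 2) * legendre n ^ 2)

theorem eval_legendreSonin (n : ℕ) (s : ℝ) : (legendreSonin n).eval s =
    ((1 - s ^ 2) * (derivative (legendre n)).eval s) ^ 2 +
    n * (n + 1) * ((1 - s ^ 2) * (legendre n).eval s ^ 2) := by
  simp [legendreSonin]

theorem eval_derivative_legendreSonin (n : ℕ) (s : ℝ) : (derivative (legendreSonin n)).eval s =
    -(2 * s * (n * (n + 1)) * (legendre n).eval s ^ 2) := by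
  have h : derivative (legendreSonin n) =
      -(2 * X * ((n : ℝ[X]) * ((n : ℝ[X]) + 1)) * legendre n ^ 2) := by
    rw [legendreSonin, derivative_add, derivative_sq,
      derivative_one_sub_sq_mul_derivative_legendre]
    simp [derivative_mul, derivative_pow, C_ofNat]
    ring
  rw [h]; simp

/-- `(1 - s²) P_n'(s)² + n(n+1) P_n(s)²`, as a polynomial. -/
noncomputable def legendreEnergyPoly (n : ℕ) : ℝ[X] :=
  (1 - X ^ 2) * derivative (legendre n) ^ 2 + ((n : ℝ[X]) * ((n : ℝ[X]) + 1)) * legendre n ^ 2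

theorem eval_legendreEnergyPoly (n : ℕ) (s : ℝ) : (legendreEnergyPoly n).eval s =
    (1 - s ^ 2) * (derivative (legendre n)).eval s ^ 2 + n * (n + 1) * (legendre n).eval s ^ 2 := by
  simp [legendreEnergyPoly]

theorem eval_derivative_legendreEnergyPoly (n : ℕ) (s : ℝ) :
    (derivative (legendreEnergyPoly n)).eval s =
      2 * s * (derivative (legendre n)).eval s ^ 2 := by
  have h0 := derivative_one_sub_sq_mul_derivative_legendre n
  have h : derivative (legendreEnergyPoly n) = 2 * X * derivative (legendre n) ^ 2 := by
    rw [legendreEnergyPoly]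
    simp [derivative_mul, derivative_pow, C_ofNat] at h0 ⊢
    linear_combination 2 * derivative (legendre n) * h0
  rw [h]; simp

/-- The sign condition says that `G` increases on `[-1,0]` and decreases on `[0,1]`. It serves the
Sonin function, maximal at `0`, and the negative of the energy, which is minimal there. -/
theorem eval_le_eval_zero_of_derivative (G : ℝ[X])
    (h : ∀ s ∈ Icc (-1 : ℝ) 1, s * (derivative G).eval s ≤ 0) {s : ℝ} (hs : s ∈ Icc (-1 : ℝ) 1) :
    G.eval s ≤ G.eval 0 := by
  rcases le_total 0 s with h0 | h0
  · have : AntitoneOn (fun t => G.eval t) (Icc 0 1) := by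
      refine antitoneOn_of_deriv_nonpos (convex_Icc _ _) G.continuous.continuousOn
        G.differentiable.differentiableOn fun t ht => ?_
      rw [interior_Icc] at ht
      rw [Polynomial.deriv]
      have := h t ⟨by linarith [ht.1], ht.2.le⟩
      by_contra hc
      push Not at hc
      nlinarith [mul_pos ht.1 hc]
    exact this ⟨le_rfl, zero_le_one⟩ ⟨h0, hs.2⟩ h0
  · have : MonotoneOn (fun t => G.eval t) (Icc (-1) 0) := by
      refine monotoneOn_of_deriv_nonneg (convex_Icc _ _) G.continuous.continuousOn
        G.differentiable.differentiableOn fun t ht => ?_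
      rw [interior_Icc] at ht
      rw [Polynomial.deriv]
      have := h t ⟨ht.1.le, by linarith [ht.2]⟩
      by_contra hc
      push Not at hc
      nlinarith [mul_pos_of_neg_of_neg ht.2 hc]
    exact this ⟨hs.1, h0⟩ ⟨by norm_num, le_rfl⟩ h0

/-- The left side is one of the two nonnegative terms of the Sonin function, whose maximum, attained
at `0`, is `legendreEnergy n ≤ n`. -/
theorem one_sub_sq_mul_derivative_legendre_sq_le {n : ℕ} (hn : 1 ≤ n) {s : ℝ}
    (hs : s ∈ Icc (-1 : ℝ) 1) : ((1 - s ^ 2) * (derivative (legendre n)).eval s) ^ 2 ≤ n := by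
  have h := eval_le_eval_zero_of_derivative (legendreSonin n) (fun t _ => by
    rw [eval_derivative_legendreSonin]
    have : 0 ≤ 2 * (t ^ 2 * (n * (n + 1)) * (legendre n).eval t ^ 2) := by positivity
    linarith) hs
  rw [eval_legendreSonin, eval_legendreSonin] at h
  have h1 := (legendreEnergy_bounds hn).2
  rw [legendreEnergy] at h1
  have hs' : 0 ≤ 1 - s ^ 2 := by nlinarith [hs.1, hs.2]
  have : 0 ≤ n * (n + 1) * ((1 - s ^ 2) * (legendre n).eval s ^ 2) := by positivity
  simp at h
  linarith

theorem legendreEnergy_le_eval {n : ℕ} {s : ℝ} (hs : s ∈ Icc (-1 : ℝ) 1) :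
    legendreEnergy n ≤ (legendreEnergyPoly n).eval s := by
  have h := eval_le_eval_zero_of_derivative (-legendreEnergyPoly n) (fun t _ => by
    rw [derivative_neg, eval_neg, eval_derivative_legendreEnergyPoly]
    have : 0 ≤ 2 * (t ^ 2 * (derivative (legendre n)).eval t ^ 2) := by positivity
    linarith) hs
  rw [eval_neg, eval_neg, eval_legendreEnergyPoly n 0] at h
  rw [legendreEnergy]
  simp at h
  linarith

/-- The energy polynomial has derivative `2s P_n'²`, so on `[-1,1]` it is largest at the endpoints,
where its value is `n(n+1)`; it dominates `n(n+1) P_n²`. -/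
theorem legendre_sq_le_one (n : ℕ) {s : ℝ} (hs : s ∈ Icc (-1 : ℝ) 1) :
    (legendre n).eval s ^ 2 ≤ 1 := by
  rcases Nat.eq_zero_or_pos n with rfl | hn
  · simp [legendre_zero]
  have key : (legendreEnergyPoly n).eval s ≤ n * (n + 1) := by
    rcases le_total 0 s with h0 | h0
    · have : MonotoneOn (fun t => (legendreEnergyPoly n).eval t) (Icc 0 1) := by
        refine monotoneOn_of_deriv_nonneg (convex_Icc _ _) (Polynomial.continuous _).continuousOn
          (Polynomial.differentiable _).differentiableOn fun t ht => ?_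
        rw [interior_Icc] at ht
        rw [Polynomial.deriv, eval_derivative_legendreEnergyPoly]
        have := ht.1
        positivity
      refine (this ⟨h0, hs.2⟩ ⟨zero_le_one, le_rfl⟩ hs.2).trans (le_of_eq ?_)
      simp [eval_legendreEnergyPoly, eval_one_legendre]
    · have : AntitoneOn (fun t => (legendreEnergyPoly n).eval t) (Icc (-1) 0) := by
        refine antitoneOn_of_deriv_nonpos (convex_Icc _ _) (Polynomial.continuous _).continuousOn
          (Polynomial.differentiable _).differentiableOn fun t ht => ?_
        rw [interior_Icc] at ht
        rw [Polynomial.deriv, eval_derivative_legendreEnergyPoly]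
        nlinarith [ht.2, sq_nonneg ((derivative (legendre n)).eval t)]
      refine (this ⟨le_rfl, by norm_num⟩ ⟨hs.1, h0⟩ hs.1).trans (le_of_eq ?_)
      simp [eval_legendreEnergyPoly, eval_neg_one_legendre, ← pow_mul, mul_comm n 2]
  rw [eval_legendreEnergyPoly] at key
  have hs' : 0 ≤ 1 - s ^ 2 := by nlinarith [hs.1, hs.2]
  have h1 : 0 ≤ (1 - s ^ 2) * (derivative (legendre n)).eval s ^ 2 := by positivity
  have hn0 : (0 : ℝ) < n * (n + 1) := by positivity
  exact le_of_mul_le_mul_left (by linarith) hn0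

theorem abs_legendre_le_one (n : ℕ) {s : ℝ} (hs : s ∈ Icc (-1 : ℝ) 1) :
    |(legendre n).eval s| ≤ 1 := by
  have := legendre_sq_le_one n hs
  exact (sq_le_one_iff_abs_le_one _).mp this

/-- This is Legendre's equation integrated from `s` to `1`; it turns bounds on `P_n'` into bounds on
the cap coefficients. -/
theorem integral_legendre_eq {n : ℕ} (hn : 1 ≤ n) (s : ℝ) :
    ∫ t in s..1, (legendre n).eval t =
      (1 - s ^ 2) * (derivative (legendre n)).eval s / (n * (n + 1)) := by
  have h := integral_derivative_eval ((1 - X ^ 2) * derivative (legendre n)) s 1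
  rw [derivative_one_sub_sq_mul_derivative_legendre] at h
  simp only [eval_mul, eval_neg, eval_natCast, eval_add, eval_one,
    intervalIntegral.integral_const_mul] at h
  have hn0 : (n * (n + 1) : ℝ) ≠ 0 := by positivity
  rw [eq_div_iff hn0]
  simp at h
  linarith

/-- Equipartition of energy gives a lower bound for the mass of `P_n'` near the pole. -/
theorem le_integral_derivative_legendre_sq {a : ℝ} (ha0 : 0 ≤ a) (ha1 : a < 1) (n : ℕ) :
    legendreEnergy n * ((1 - a) ^ 3 / 12) - 5 ≤
      ∫ s in a..1, ((1 - s ^ 2) * (derivative (legendre n)).eval s) ^ 2 := by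
  set p := legendre n with hp
  -- The weight `φ` vanishes at `a` and at `1`. Testing Legendre's equation with `φ P` shows that
  -- the `φ`-weighted integrals of `(1-s²)P'²` and `n(n+1)P²` differ only by a bounded amount, so
  -- the first carries about half of the energy.
  set φ : ℝ[X] := (X - C a) * (1 - X ^ 2) with hφ
  set ψ : ℝ[X] := derivative φ * (1 - X ^ 2) with hψ
  -- `φ (1 - s²) P'² - n(n+1) φ P² - ½ ψ' P²` is a derivative
  set G : ℝ[X] := φ * ((1 - X ^ 2) * derivative p) * p - C (1 / 2) * ψ * p ^ 2 with hG
  have hdG : derivative G = φ * ((1 - X ^ 2) * derivative p ^ 2) -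
      ((n : ℝ[X]) * ((n : ℝ[X]) + 1)) * (φ * p ^ 2) - C (1 / 2) * derivative ψ * p ^ 2 := by
    rw [hG, derivative_sub, derivative_mul, derivative_mul,
      derivative_one_sub_sq_mul_derivative_legendre, derivative_mul (g := p ^ 2),
      derivative_mul (f := C (1 / 2)), derivative_C, derivative_sq]
    have h2 : C (1 / 2 : ℝ) * C 2 = 1 := by rw [← C_mul]; norm_num
    linear_combination (-(ψ * p * derivative p)) * h2
  set E := legendreEnergy n with hE
  have hE0 : 0 ≤ E := by rw [hE, legendreEnergy]; positivity
  -- `Q` is a primitive of `E (s-a)(1-s) - 5`: the first term is a lower bound for `φ` times the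
  -- energy polynomial, and `5` absorbs the error `½ ψ' P²`, because `ψ' ≥ -10` and `P² ≤ 1`.
  set Q : ℝ[X] := C E * (-C (1 / 3) * X ^ 3 + C ((1 + a) / 2) * X ^ 2 - C a * X) - 5 * X with hQ
  have hdQ : ∀ s : ℝ, (derivative Q).eval s = E * ((s - a) * (1 - s)) - 5 := by
    intro s
    simp [hQ, derivative_mul, derivative_pow]
    left
    ring
  have hpt : ∀ s ∈ Icc a 1, (derivative (G + Q)).eval s ≤
      2 * ((1 - s ^ 2) * (derivative p).eval s) ^ 2 := by
    intro s hs
    have hs0 : 0 ≤ s := ha0.trans hs.1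
    have hsI : s ∈ Icc (-1 : ℝ) 1 := ⟨by linarith, hs.2⟩
    have h1 := legendreEnergy_le_eval (n := n) hsI
    rw [eval_legendreEnergyPoly] at h1
    have h2 := legendre_sq_le_one n hsI
    rw [derivative_add, eval_add, hdQ, hdG]
    have hψ' : (derivative ψ).eval s = (-6 * s + 2 * a) * (1 - s ^ 2) -
        2 * s * ((1 - s ^ 2) - 2 * s * (s - a)) := by
      simp [hψ, hφ, derivative_mul, derivative_pow]
      ring
    have hφs : φ.eval s = (s - a) * (1 - s ^ 2) := by simp [hφ]
    simp only [eval_sub, eval_mul, eval_pow, eval_C, eval_add, eval_natCast, eval_one, eval_X,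
      hψ', hφs]
    rw [← hp] at h1 h2
    set y := p.eval s
    set y' := (derivative p).eval s
    have hsa : 0 ≤ s - a := by linarith [hs.1]
    have h1s : 0 ≤ 1 - s := by linarith [hs.2]
    have h1s2 : 0 ≤ 1 - s ^ 2 := by nlinarith
    have hφ1 : 0 ≤ (s - a) * (1 - s ^ 2) := mul_nonneg hsa h1s2
    have b1 : E * ((s - a) * (1 - s)) ≤ (s - a) * (1 - s ^ 2) *
        ((1 - s ^ 2) * y' ^ 2 + n * (n + 1) * y ^ 2) := by
      have : (s - a) * (1 - s) ≤ (s - a) * (1 - s ^ 2) := by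
        apply mul_le_mul_of_nonneg_left _ hsa; nlinarith
      calc E * ((s - a) * (1 - s)) ≤ E * ((s - a) * (1 - s ^ 2)) :=
            mul_le_mul_of_nonneg_left this hE0
        _ ≤ _ := by rw [mul_comm]; exact mul_le_mul_of_nonneg_left h1 hφ1
    have b2 : -10 ≤ (-6 * s + 2 * a) * (1 - s ^ 2) - 2 * s * ((1 - s ^ 2) - 2 * s * (s - a)) := by
      have e1 : -6 ≤ (-6 * s + 2 * a) * (1 - s ^ 2) := by nlinarith [mul_nonneg ha0 h1s2]
      have e2 : 2 * s * ((1 - s ^ 2) - 2 * s * (s - a)) ≤ 4 := by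
        have : 0 ≤ 2 * s * (2 * s * (s - a)) := by positivity
        nlinarith [mul_nonneg hs0 (sq_nonneg s)]
      linarith
    have b3 : -5 ≤ 1 / 2 * ((-6 * s + 2 * a) * (1 - s ^ 2) -
        2 * s * ((1 - s ^ 2) - 2 * s * (s - a))) * y ^ 2 := by
      nlinarith [sq_nonneg y]
    have b4 : (s - a) * (1 - s ^ 2) * ((1 - s ^ 2) * y' ^ 2) ≤ ((1 - s ^ 2) * y') ^ 2 := by
      have : (s - a) ≤ 1 := by linarith [hs.2]
      have h := mul_le_mul_of_nonneg_right this (sq_nonneg ((1 - s ^ 2) * y'))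
      nlinarith
    linarith
  have hmono := intervalIntegral.integral_mono_on ha1.le
    ((derivative (G + Q)).continuous.intervalIntegrable (μ := MeasureTheory.volume) a 1)
    (Continuous.intervalIntegrable (by fun_prop) a 1) hpt
  rw [integral_derivative_eval, intervalIntegral.integral_const_mul] at hmono
  have hv : (G + Q).eval 1 - (G + Q).eval a =
      1 / 2 * (1 - a ^ 2) ^ 2 * p.eval a ^ 2 + E * ((1 - a) ^ 3 / 6) - 5 * (1 - a) := by
    simp [hG, hQ, hψ, hφ, derivative_mul, derivative_pow]
    ring
  rw [hv] at hmono
  have : 0 ≤ 1 / 2 * (1 - a ^ 2) ^ 2 * p.eval a ^ 2 := by positivity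
  linarith

theorem derivative_legendre_ne_zero {n : ℕ} (hn : 1 ≤ n) : derivative (legendre n) ≠ 0 := by
  intro h
  have h1 := coeff_legendre_pos n
  rw [Polynomial.eq_C_of_derivative_eq_zero h, coeff_C, if_neg (by omega)] at h1
  exact lt_irrefl _ h1

theorem integral_sq_pos_of_ne_zero {G : ℝ[X]} (hG : G ≠ 0) {a b : ℝ} (hab : a < b) :
    0 < ∫ s in a..b, G.eval s ^ 2 := by
  obtain ⟨c, hc, hc0⟩ : ∃ c ∈ Icc a b, G.eval c ≠ 0 := by
    by_contra hcon
    push Not at hcon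
    exact hG (G.eq_zero_of_infinite_isRoot ((Icc_infinite hab).mono fun x hx => hcon x hx))
  exact intervalIntegral.integral_pos hab (by fun_prop) (fun x _ => sq_nonneg _)
    ⟨c, hc, by positivity⟩

/-- For large `n` the energy, at least `(n+1)/2`, outweighs the constant error `5`. The finitely
many remaining integrals are positive because `P_n'` is a nonzero polynomial. -/
theorem exists_le_integral_derivative_legendre_sq {a : ℝ} (ha0 : 0 ≤ a) (ha1 : a < 1) :
    ∃ c : ℝ, 0 < c ∧ ∀ n : ℕ, 1 ≤ n →
      c * n ≤ ∫ s in a..1, ((1 - s ^ 2) * (derivative (legendre n)).eval s) ^ 2 := by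
  set I : ℕ → ℝ := fun n => ∫ s in a..1, ((1 - s ^ 2) * (derivative (legendre n)).eval s) ^ 2
    with hI
  have hpos : ∀ n, 1 ≤ n → 0 < I n := by
    intro n hn
    have h0 : (1 - X ^ 2 : ℝ[X]) ≠ 0 := by
      intro h
      have := congrArg (eval 0) h
      simp at this
    have := integral_sq_pos_of_ne_zero (mul_ne_zero h0 (derivative_legendre_ne_zero hn)) ha1
    simpa [hI] using this
  set δ := (1 - a) ^ 3 / 48 with hδ
  have hδ0 : 0 < δ := by have : 0 < 1 - a := by linarith
                         positivity
  obtain ⟨N, hN⟩ := exists_nat_gt (5 / δ)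
  have hlarge : ∀ n, 1 ≤ n → N ≤ n → δ * n ≤ I n := by
    intro n hn hNn
    have h1 := le_integral_derivative_legendre_sq ha0 ha1 n
    have h2 := (legendreEnergy_bounds hn).1
    have h3 : (N : ℝ) ≤ n := by exact_mod_cast hNn
    rw [div_lt_iff₀ hδ0] at hN
    have h4 : (1 - a) ^ 3 / 12 = 4 * δ := by rw [hδ]; ring
    rw [h4] at h1
    have h5 : 5 ≤ δ * n := by nlinarith
    refine le_trans ?_ h1
    nlinarith
  have hsmall : ∀ M : ℕ, ∃ c : ℝ, 0 < c ∧ ∀ n, 1 ≤ n → n < M → c * n ≤ I n := by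
    intro M
    induction M with
    | zero => exact ⟨1, one_pos, fun n _ h => by omega⟩
    | succ M ih =>
      obtain ⟨c, hc, h⟩ := ih
      rcases Nat.eq_zero_or_pos M with rfl | hM
      · exact ⟨1, one_pos, fun n _ h => by omega⟩
      have hM0 : (0 : ℝ) < M := by exact_mod_cast hM
      refine ⟨min c (I M / M), lt_min hc (div_pos (hpos M hM) hM0), fun n hn hnM => ?_⟩
      rcases Nat.lt_succ_iff_lt_or_eq.mp hnM with h' | rfl
      · exact (mul_le_mul_of_nonneg_right (min_le_left _ _) n.cast_nonneg).trans (h n hn h')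
      · refine (mul_le_mul_of_nonneg_right (min_le_right _ _) n.cast_nonneg).trans (le_of_eq ?_)
        field_simp
  obtain ⟨c, hc, h⟩ := hsmall N
  refine ⟨min c δ, lt_min hc hδ0, fun n hn => ?_⟩
  rcases lt_or_ge n N with h' | h'
  · exact (mul_le_mul_of_nonneg_right (min_le_left _ _) n.cast_nonneg).trans (h n hn h')
  · exact (mul_le_mul_of_nonneg_right (min_le_right _ _) n.cast_nonneg).trans (hlarge n hn h')

end LegendreBounds

/-! ### Zonal solid harmonics -/

section SolidHarmonics

open MvPolynomial

/-- The linear form `⟨x, y⟩` as a polynomial in `x`. -/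
noncomputable def innerPoly (y : Fin 3 → ℂ) : MvPolynomial (Fin 3) ℂ := ∑ i, C (y i) * X i

/-- The polynomial `|x|²`. -/
noncomputable def normSqPoly : MvPolynomial (Fin 3) ℂ := ∑ i, X i ^ 2

/-- The zonal solid harmonic of degree `n` with axis `y`. -/
noncomputable def solidZonal (y : Fin 3 → ℂ) : ℕ → MvPolynomial (Fin 3) ℂ
  | 0 => 1
  | 1 => innerPoly y
  | n + 2 => C ((n + 2 : ℂ)⁻¹) *
      ((2 * (n : MvPolynomial (Fin 3) ℂ) + 3) * (innerPoly y * solidZonal y (n + 1)) -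
        ((n : MvPolynomial (Fin 3) ℂ) + 1) * (normSqPoly * solidZonal y n))

variable (y : Fin 3 → ℂ)

theorem solidZonal_zero : solidZonal y 0 = 1 := by rw [solidZonal]

theorem solidZonal_one : solidZonal y 1 = innerPoly y := by rw [solidZonal]

theorem solidZonal_add_two (n : ℕ) :
    ((n : MvPolynomial (Fin 3) ℂ) + 2) * solidZonal y (n + 2) =
      (2 * (n : MvPolynomial (Fin 3) ℂ) + 3) * (innerPoly y * solidZonal y (n + 1)) -
        ((n : MvPolynomial (Fin 3) ℂ) + 1) * (normSqPoly * solidZonal y n) := by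
  rw [solidZonal, ← mul_assoc]
  have h : ((n : MvPolynomial (Fin 3) ℂ) + 2) = C (n + 2 : ℂ) := by simp [map_ofNat]
  have h0 : (n + 2 : ℂ) ≠ 0 := by exact_mod_cast (by omega : n + 2 ≠ 0)
  rw [h, ← C_mul, mul_inv_cancel₀ h0, C_1, one_mul]

theorem isHomogeneous_solidZonal (n : ℕ) : (solidZonal y n).IsHomogeneous n := by
  induction n using Nat.twoStepInduction with
  | zero => rw [solidZonal_zero]; exact isHomogeneous_one _ _
  | one =>
    rw [solidZonal_one]
    exact IsHomogeneous.sum _ _ _ fun i _ => by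
      simpa using (isHomogeneous_C _ _).mul (isHomogeneous_X _ i)
  | more n h0 h1 =>
    have hi : (innerPoly y).IsHomogeneous 1 := IsHomogeneous.sum _ _ _ fun i _ => by
      simpa using (isHomogeneous_C (Fin 3) (y i)).mul (isHomogeneous_X ℂ i)
    have hn : normSqPoly.IsHomogeneous 2 := IsHomogeneous.sum _ _ _ fun i _ => by
      simpa using (isHomogeneous_X ℂ i).pow 2
    have e1 : (2 * (n : MvPolynomial (Fin 3) ℂ) + 3) = C (2 * n + 3 : ℂ) := by simp [map_ofNat]
    have e2 : ((n : MvPolynomial (Fin 3) ℂ) + 1) = C (n + 1 : ℂ) := by simp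
    rw [solidZonal, e1, e2]
    have H1 := (isHomogeneous_C (Fin 3) (2 * n + 3 : ℂ)).mul (hi.mul h1)
    have H2 := (isHomogeneous_C (Fin 3) (n + 1 : ℂ)).mul (hn.mul h0)
    rw [show 0 + (1 + (n + 1)) = n + 2 by ring] at H1
    rw [show 0 + (2 + n) = n + 2 by ring] at H2
    have := (isHomogeneous_C (Fin 3) (n + 2 : ℂ)⁻¹).mul (H1.sub H2)
    rwa [zero_add] at this

/-- The derivative in direction `y`. -/
noncomputable def dirDeriv : Derivation ℂ (MvPolynomial (Fin 3) ℂ) (MvPolynomial (Fin 3) ℂ) :=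
  y 0 • pderiv 0 + y 1 • pderiv 1 + y 2 • pderiv 2

theorem dirDeriv_apply (p : MvPolynomial (Fin 3) ℂ) : dirDeriv y p = ∑ i, C (y i) * pderiv i p := by
  simp [dirDeriv, smul_eq_C_mul, Fin.sum_univ_three]

theorem pderiv_innerPoly (i : Fin 3) : pderiv i (innerPoly y) = C (y i) := by
  fin_cases i <;> simp [innerPoly, Fin.sum_univ_three, pderiv_X]

theorem pderiv_normSqPoly (i : Fin 3) : pderiv i normSqPoly = 2 * X i := by
  fin_cases i <;> simp [normSqPoly, Fin.sum_univ_three, pderiv_X]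

variable {y}

theorem dirDeriv_innerPoly (hy : ∑ i, y i ^ 2 = 1) : dirDeriv y (innerPoly y) = 1 := by
  rw [dirDeriv_apply]
  simp_rw [pderiv_innerPoly, ← C_mul, ← map_sum, ← pow_two, hy, C_1]

theorem dirDeriv_normSqPoly : dirDeriv y normSqPoly = 2 * innerPoly y := by
  rw [dirDeriv_apply, innerPoly, Finset.mul_sum]
  simp_rw [pderiv_normSqPoly]
  exact Finset.sum_congr rfl fun i _ => by ring

theorem derivation_two
    (D : Derivation ℂ (MvPolynomial (Fin 3) ℂ) (MvPolynomial (Fin 3) ℂ)) : D 2 = 0 := by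
  exact_mod_cast D.map_natCast 2

theorem derivation_three
    (D : Derivation ℂ (MvPolynomial (Fin 3) ℂ) (MvPolynomial (Fin 3) ℂ)) : D 3 = 0 := by
  exact_mod_cast D.map_natCast 3

theorem natCast_add_two_ne_zero (n : ℕ) : ((n : MvPolynomial (Fin 3) ℂ) + 2) ≠ 0 := by
  have : ((n : MvPolynomial (Fin 3) ℂ) + 2) = ((n + 2 : ℕ) : MvPolynomial (Fin 3) ℂ) := by simp
  rw [this]
  exact Nat.cast_ne_zero.mpr (by omega)

/-- This derivative is the cross term in the Laplacian of `⟨x,y⟩` times a zonal harmonic. The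
formula follows by differentiating the recurrence along the axis, using `|y|² = 1`. -/
theorem dirDeriv_solidZonal_succ (hy : ∑ i, y i ^ 2 = 1) (n : ℕ) :
    dirDeriv y (solidZonal y (n + 1)) = ((n : MvPolynomial (Fin 3) ℂ) + 1) * solidZonal y n := by
  induction n using Nat.twoStepInduction with
  | zero => simp [solidZonal_zero, solidZonal_one, dirDeriv_innerPoly hy]
  | one =>
    have h := congrArg (dirDeriv y) (solidZonal_add_two y 0)
    simp [Derivation.leibniz, solidZonal_zero, solidZonal_one, dirDeriv_innerPoly hy,
      dirDeriv_normSqPoly, derivation_two, derivation_three] at h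
    apply mul_left_cancel₀ (two_ne_zero (α := MvPolynomial (Fin 3) ℂ))
    rw [solidZonal_one]
    push_cast
    linear_combination h
  | more n h0 h1 =>
    have h := congrArg (dirDeriv y) (solidZonal_add_two y (n + 1))
    have hr := solidZonal_add_two y n
    simp only [Derivation.leibniz, map_sub, map_add, Derivation.map_natCast, smul_eq_mul,
      dirDeriv_innerPoly hy, dirDeriv_normSqPoly, h0, h1, derivation_two, derivation_three,
      Derivation.map_one_eq_zero] at h
    apply mul_left_cancel₀ (natCast_add_two_ne_zero (n + 1))
    rw [show n + 2 + 1 = n + 1 + 2 by ring]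
    push_cast at h ⊢
    linear_combination h - ((n : MvPolynomial (Fin 3) ℂ) + 2) * hr

theorem polyLaplacian_apply (p : MvPolynomial (Fin 3) ℂ) :
    polyLaplacian 3 p = ∑ i, pderiv i (pderiv i p) := by
  simp [polyLaplacian]

theorem polyLaplacian_innerPoly_mul (p : MvPolynomial (Fin 3) ℂ) :
    polyLaplacian 3 (innerPoly y * p) = innerPoly y * polyLaplacian 3 p + 2 * dirDeriv y p := by
  simp only [polyLaplacian_apply, dirDeriv_apply, pderiv_mul, map_add, pderiv_innerPoly, pderiv_C,
    Fin.sum_univ_three]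
  ring

theorem polyLaplacian_normSqPoly_mul {p : MvPolynomial (Fin 3) ℂ} {n : ℕ}
    (hp : p.IsHomogeneous n) :
    polyLaplacian 3 (normSqPoly * p) =
      normSqPoly * polyLaplacian 3 p + (4 * (n : MvPolynomial (Fin 3) ℂ) + 6) * p := by
  have he := hp.sum_X_mul_pderiv
  simp only [polyLaplacian_apply, pderiv_mul, map_add, pderiv_normSqPoly, derivation_two,
    pderiv_X_self, Fin.sum_univ_three, nsmul_eq_mul] at he ⊢
  linear_combination 4 * he

/-- In the recurrence, the cross term of `⟨x,y⟩` contributes `2(2n+3)(n+1)` and the product with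
`|x|²` contributes `(n+1)(4n+6)` times the same harmonic; the two cancel. -/
theorem polyLaplacian_solidZonal (hy : ∑ i, y i ^ 2 = 1) (n : ℕ) :
    polyLaplacian 3 (solidZonal y n) = 0 := by
  induction n using Nat.twoStepInduction with
  | zero => simp [solidZonal_zero, polyLaplacian_apply]
  | one => simp [solidZonal_one, polyLaplacian_apply, pderiv_innerPoly]
  | more n h0 h1 =>
    have e0 : ((n : MvPolynomial (Fin 3) ℂ) + 2) = C (n + 2 : ℂ) := by simp [map_ofNat]
    have e1 : (2 * (n : MvPolynomial (Fin 3) ℂ) + 3) = C (2 * n + 3 : ℂ) := by simp [map_ofNat]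
    have e2 : ((n : MvPolynomial (Fin 3) ℂ) + 1) = C (n + 1 : ℂ) := by simp
    have h := solidZonal_add_two y n
    rw [e0, e1, e2, ← smul_eq_C_mul, ← smul_eq_C_mul, ← smul_eq_C_mul] at h
    have h := congrArg (polyLaplacian 3) h
    rw [map_sub, map_smul, map_smul, map_smul, polyLaplacian_innerPoly_mul,
      polyLaplacian_normSqPoly_mul (isHomogeneous_solidZonal y n), h0, h1,
      dirDeriv_solidZonal_succ hy, smul_eq_C_mul, smul_eq_C_mul, smul_eq_C_mul, ← e0, ← e1,
      ← e2] at h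
    apply mul_left_cancel₀ (natCast_add_two_ne_zero n)
    linear_combination h

theorem eval_solidZonal (x : Fin 3 → ℂ) (t : ℝ) (hx : ∑ i, x i ^ 2 = 1)
    (ht : ∑ i, y i * x i = t) (n : ℕ) :
    eval x (solidZonal y n) = ((legendre n).eval t : ℝ) := by
  have hi : eval x (innerPoly y) = t := by simp [innerPoly, ht]
  have hN : eval x normSqPoly = 1 := by simp [normSqPoly, hx]
  induction n using Nat.twoStepInduction with
  | zero => simp [solidZonal_zero, legendre_zero]
  | one => simp [solidZonal_one, legendre_one, hi]
  | more n h0 h1 =>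
    have h := congrArg (eval x) (solidZonal_add_two y n)
    have h' := congrArg (fun p => ((Polynomial.eval t p : ℝ) : ℂ)) (legendre_add_two n)
    simp [h0, h1, hi, hN] at h h'
    have h2 : (n + 2 : ℂ) ≠ 0 := by exact_mod_cast (by omega : n + 2 ≠ 0)
    apply mul_left_cancel₀ h2
    linear_combination h - h'

theorem sphere_sum_sq (x : Metric.sphere (0 : EuclideanSpace ℝ (Fin 3)) 1) :
    ∑ i, (((x : EuclideanSpace ℝ (Fin 3)) i : ℝ) : ℂ) ^ 2 = 1 := by
  have h : ‖(x : EuclideanSpace ℝ (Fin 3))‖ ^ 2 = 1 := by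
    rw [mem_sphere_zero_iff_norm.mp x.2, one_pow]
  rw [EuclideanSpace.real_norm_sq_eq] at h
  exact_mod_cast h

theorem legendre_inner_mem_sphericalHarmonics
    (y : Metric.sphere (0 : EuclideanSpace ℝ (Fin 3)) 1) (n : ℕ) :
    (fun x : Metric.sphere (0 : EuclideanSpace ℝ (Fin 3)) 1 =>
      (((legendre n).eval (inner ℝ (x : EuclideanSpace ℝ (Fin 3)) y) : ℝ) : ℂ)) ∈
      sphericalHarmonics 3 n := by
  refine ⟨solidZonal (fun i => ((y : EuclideanSpace ℝ (Fin 3)) i : ℝ)) n,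
    ⟨isHomogeneous_solidZonal _ n, polyLaplacian_solidZonal (sphere_sum_sq y) n⟩, ?_⟩
  ext x
  refine eval_solidZonal _ _ (sphere_sum_sq x) ?_ n
  simp [PiLp.inner_apply]

end SolidHarmonics

/-! ### The dimension bound `2m + 1` for spherical harmonics -/

section Dimension

open MvPolynomial

theorem coeff_polyLaplacian (p : MvPolynomial (Fin 3) ℂ) (m : Fin 3 →₀ ℕ) :
    coeff m (polyLaplacian 3 p) =
      ∑ i, coeff (m + Finsupp.single i 2) p * ((m i + 2) * (m i + 1)) := by
  rw [polyLaplacian_apply, coeff_sum]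
  refine Finset.sum_congr rfl fun i _ => ?_
  rw [coeff_pderiv, coeff_pderiv, add_assoc, ← Finsupp.single_add]
  simp
  ring

/-- Harmonicity is a Cauchy problem in the last variable: it expresses a coefficient with exponent
`k ≥ 2` there through coefficients with exponent `k - 2`. -/
theorem eq_zero_of_polyLaplacian_eq_zero {p : MvPolynomial (Fin 3) ℂ}
    (hp : polyLaplacian 3 p = 0) (h : ∀ m : Fin 3 →₀ ℕ, m 2 ≤ 1 → coeff m p = 0) : p = 0 := by
  have key : ∀ k : ℕ, ∀ m : Fin 3 →₀ ℕ, m 2 = k → coeff m p = 0 := by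
    intro k
    induction k using Nat.strong_induction_on with
    | _ k ih =>
      intro m hm
      rcases Nat.lt_or_ge k 2 with hk | hk
      · exact h m (by omega)
      set m' : Fin 3 →₀ ℕ := m - Finsupp.single 2 2 with hm'
      have e : m = m' + Finsupp.single 2 2 := by
        rw [hm', tsub_add_cancel_of_le]
        rw [Finsupp.single_le_iff]; omega
      have h2 : m' 2 = k - 2 := by rw [hm']; simp [hm]
      have hc := coeff_polyLaplacian p m'
      rw [hp, coeff_zero, Fin.sum_univ_three, ← e,
        ih (k - 2) (by omega) (m' + Finsupp.single 0 2) (by simp [h2]),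
        ih (k - 2) (by omega) (m' + Finsupp.single 1 2) (by simp [h2])] at hc
      simp only [zero_mul, zero_add] at hc
      refine (mul_eq_zero.mp hc.symm).resolve_right ?_
      exact_mod_cast (by positivity : (m' 2 + 2) * (m' 2 + 1) ≠ 0)
  ext m
  rw [key _ m rfl, coeff_zero]

/-- The values which determine a homogeneous harmonic polynomial: the coefficients of the monomials
in which the last variable has exponent `0` or `1`. -/
noncomputable def cauchyData (m : ℕ) : MvPolynomial (Fin 3) ℂ →ₗ[ℂ] (Fin (m + 1) ⊕ Fin m → ℂ) :=
  LinearMap.pi (Sum.elim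
    (fun a => lcoeff ℂ (Finsupp.equivFunOnFinite.symm ![a.val, m - a.val, 0]))
    (fun a => lcoeff ℂ (Finsupp.equivFunOnFinite.symm ![a.val, m - 1 - a.val, 1])))

/-- In degree `m` there are `m + 1` monomials free of the last variable and `m` linear in it, and
these coefficients determine a harmonic polynomial. The addition theorem needs only this upper
bound. -/
theorem finrank_sphericalHarmonics_le (m : ℕ) :
    Module.Finite ℂ (sphericalHarmonics 3 m) ∧
    Module.finrank ℂ (sphericalHarmonics 3 m) ≤ 2 * m + 1 := by
  set W := homogeneousSubmodule (Fin 3) ℂ m ⊓ LinearMap.ker (polyLaplacian 3) with hW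
  have hinj : Function.Injective ((cauchyData m).domRestrict W) := by
    rw [← LinearMap.ker_eq_bot, LinearMap.ker_eq_bot']
    rintro ⟨p, hp1, hp2⟩ h0
    have h0 : cauchyData m p = 0 := h0
    ext1
    refine eq_zero_of_polyLaplacian_eq_zero hp2 fun k hk => ?_
    by_contra hne
    have hdeg : k.degree = m := by
      have := hp1 hne
      rwa [Finsupp.degree_eq_weight_one]
    have hd3 : k 0 + k 1 + k 2 = m := by
      rw [← hdeg, Finsupp.degree_eq_sum, Fin.sum_univ_three]
    rcases Nat.le_one_iff_eq_zero_or_eq_one.mp hk with hk | hk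
    · have := congrFun h0 (Sum.inl ⟨k 0, by omega⟩)
      simp only [cauchyData, LinearMap.pi_apply, Sum.elim_inl, lcoeff_apply, Pi.zero_apply] at this
      refine hne (Eq.trans ?_ this)
      congr 1
      ext i
      fin_cases i <;> simp <;> omega
    · have := congrFun h0 (Sum.inr ⟨k 0, by omega⟩)
      simp only [cauchyData, LinearMap.pi_apply, Sum.elim_inr, lcoeff_apply, Pi.zero_apply] at this
      refine hne (Eq.trans ?_ this)
      congr 1
      ext i
      fin_cases i <;> simp <;> omega
  have hfin : Module.Finite ℂ W := Module.Finite.of_injective _ hinj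
  have hle := LinearMap.finrank_le_finrank_of_injective hinj
  refine ⟨Module.Finite.map W (restrictSphere 3), ?_⟩
  refine (Submodule.finrank_map_le (restrictSphere 3) W).trans (hle.trans (le_of_eq ?_))
  simp
  ring

end Dimension

/-! ### Polar coordinates and the normalized surface measure -/

/-- Three-dimensional Euclidean space. -/
abbrev E3 : Type := EuclideanSpace ℝ (Fin 3)

/-- The unit sphere in three-dimensional Euclidean space. -/
abbrev S2 : Type := sphere (0 : E3) 1

/-- The area of the unit sphere. -/
noncomputable def sphereArea : ℝ := (Measure.toSphere (volume : Measure E3)).real Set.univ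

section Polar

open Set

theorem sphereArea_pos : 0 < sphereArea := by
  rw [sphereArea, Measure.toSphere_real_apply_univ]
  have : 0 < volume.real (ball (0 : E3) 1) :=
    ENNReal.toReal_pos (measure_ball_pos _ _ one_pos).ne' measure_ball_lt_top.ne
  have h3 : (0 : ℝ) < Module.finrank ℝ E3 := by simp
  positivity

theorem toSphere_univ_ne_zero : Measure.toSphere (volume : Measure E3) univ ≠ 0 :=
  fun h => sphereArea_pos.ne' (by simp [sphereArea, measureReal_def, h])

instance : IsProbabilityMeasure (sphereMeasure 3) := by
  refine ⟨?_⟩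
  rw [sphereMeasure, Measure.smul_apply, smul_eq_mul]
  exact ENNReal.inv_mul_cancel toSphere_univ_ne_zero (measure_ne_top _ _)

instance : (sphereMeasure 3).IsOpenPosMeasure := by
  refine ⟨fun U hU hne => ?_⟩
  rw [sphereMeasure, Measure.smul_apply, smul_eq_mul]
  exact mul_ne_zero (ENNReal.inv_ne_zero.mpr (measure_ne_top _ _)) (hU.measure_ne_zero _ hne)

theorem integral_toSphere {V : Type*} [NormedAddCommGroup V] [NormedSpace ℝ V] (f : S2 → V) :
    ∫ ω, f ω ∂(Measure.toSphere (volume : Measure E3)) =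
      sphereArea • ∫ ω, f ω ∂(sphereMeasure 3) := by
  rw [sphereMeasure, integral_smul_measure, smul_smul, ENNReal.toReal_inv, sphereArea,
    measureReal_def, mul_inv_cancel₀, one_smul]
  exact sphereArea_pos.ne'

theorem integral_volumeIoiPow {V : Type*} [NormedAddCommGroup V] [NormedSpace ℝ V]
    (n : ℕ) (f : ℝ → V) :
    ∫ x : Ioi (0 : ℝ), f x ∂(Measure.volumeIoiPow n) = ∫ x in Ioi (0 : ℝ), x ^ n • f x := by
  simp only [Measure.volumeIoiPow, ENNReal.ofReal]
  rw [integral_withDensity_eq_integral_smul,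
    integral_subtype_comap measurableSet_Ioi fun a ↦ Real.toNNReal (a ^ n) • f a,
    setIntegral_congr_fun measurableSet_Ioi fun x hx ↦ ?_]
  · rw [NNReal.smul_def, Real.coe_toNNReal _ (pow_nonneg (le_of_lt hx) _)]
  · exact (measurable_subtype_coe.pow_const _).real_toNNReal

/-- Integration in polar coordinates. -/
theorem integral_polar {V : Type*} [NormedAddCommGroup V] [NormedSpace ℝ V] {F : E3 → V}
    (hF : Integrable F) :
    ∫ x, F x = sphereArea • ∫ ρ in Ioi (0 : ℝ), ρ ^ 2 • ∫ ω : S2, F (ρ • (ω : E3)) ∂(sphereMeasure 3) := by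
  have hd : Module.finrank ℝ E3 - 1 = 2 := by simp
  set g : S2 × Ioi (0 : ℝ) → V := fun p => F (p.2.1 • p.1.1) with hg
  have hgF : ∀ x : ({0}ᶜ : Set E3), g (homeomorphUnitSphereProd E3 x) = F x := by
    intro x
    have hx : ‖(x : E3)‖ ≠ 0 := norm_ne_zero_iff.mpr x.2
    simp only [hg, homeomorphUnitSphereProd_apply_snd_coe, homeomorphUnitSphereProd_apply_fst_coe,
      smul_smul, mul_inv_cancel₀ hx, one_smul]
  have hmp := (volume : Measure E3).measurePreserving_homeomorphUnitSphereProd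
  rw [hd] at hmp
  have hgi : Integrable g ((volume : Measure E3).toSphere.prod (Measure.volumeIoiPow 2)) := by
    rw [← hmp.integrable_comp_emb (Homeomorph.measurableEmbedding _)]
    have : g ∘ (homeomorphUnitSphereProd E3) = F ∘ Subtype.val := funext hgF
    rw [this, ← integrableOn_iff_comap_subtypeVal (measurableSet_singleton _).compl]
    exact hF.integrableOn
  calc ∫ x, F x = ∫ x : ({0}ᶜ : Set E3), F x ∂(volume.comap Subtype.val) := by
        rw [integral_subtype_comap (measurableSet_singleton _).compl, restrict_compl_singleton]
    _ = ∫ x : ({0}ᶜ : Set E3), g (homeomorphUnitSphereProd E3 x) ∂(volume.comap Subtype.val) := by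
        simp_rw [hgF]
    _ = ∫ p, g p ∂((volume : Measure E3).toSphere.prod (Measure.volumeIoiPow 2)) :=
        hmp.integral_comp (Homeomorph.measurableEmbedding _) g
    _ = ∫ ρ, ∫ ω, g (ω, ρ) ∂((volume : Measure E3).toSphere) ∂(Measure.volumeIoiPow 2) :=
        integral_prod_symm g hgi
    _ = _ := by
        simp only [hg]
        rw [integral_volumeIoiPow 2
          (fun ρ => ∫ ω : S2, F (ρ • (ω : E3)) ∂((volume : Measure E3).toSphere)),
          ← integral_smul]
        simp_rw [integral_toSphere, smul_comm sphereArea]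

end Polar

/-! ### Archimedes' theorem, from Gaussian moments -/

section Archimedes

open Set

/-- `∫_0^∞ ρ^k e^{-ρ²} dρ`. -/
noncomputable def gaussMoment (k : ℕ) : ℝ := ∫ ρ in Ioi (0 : ℝ), ρ ^ k * Real.exp (-ρ ^ 2)

theorem gaussMoment_eq (k : ℕ) : gaussMoment k = 1 / 2 * Real.Gamma ((k + 1) / 2) := by
  rw [← integral_rpow_mul_exp_neg_rpow (p := 2) (q := k) two_pos
    (by linarith [(Nat.cast_nonneg k : (0 : ℝ) ≤ k)]), gaussMoment]
  simp

theorem gaussMoment_pos (k : ℕ) : 0 < gaussMoment k := by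
  rw [gaussMoment_eq]
  have := Real.Gamma_pos_of_pos (s := ((k : ℝ) + 1) / 2) (by positivity)
  positivity

theorem gaussMoment_add_two (k : ℕ) : gaussMoment (k + 2) = (k + 1) / 2 * gaussMoment k := by
  rw [gaussMoment_eq, gaussMoment_eq]
  have : ((k + 2 : ℕ) + 1 : ℝ) / 2 = (k + 1) / 2 + 1 := by push_cast; ring
  rw [this, Real.Gamma_add_one (by positivity)]
  ring

theorem integrable_pow_mul_exp (k : ℕ) : Integrable fun x : ℝ => x ^ k * Real.exp (-x ^ 2) := by
  have := integrable_rpow_mul_exp_neg_mul_sq one_pos (s := k)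
    (by linarith [(Nat.cast_nonneg k : (0 : ℝ) ≤ k)])
  simpa using this

theorem integral_pow_mul_exp_even {k : ℕ} (hk : Even k) :
    ∫ x : ℝ, x ^ k * Real.exp (-x ^ 2) = 2 * gaussMoment k := by
  rw [gaussMoment, ← integral_comp_abs (f := fun x => x ^ k * Real.exp (-x ^ 2))]
  simp [hk.pow_abs]

theorem integral_pow_mul_exp_odd {k : ℕ} (hk : Odd k) :
    ∫ x : ℝ, x ^ k * Real.exp (-x ^ 2) = 0 := by
  have h := integral_neg_eq_self (fun x : ℝ => x ^ k * Real.exp (-x ^ 2)) volume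
  simp only [hk.neg_pow, neg_mul, even_two.neg_pow, integral_neg] at h
  linarith

theorem gauss_prod (k : ℕ) (x : E3) : x 0 ^ k * Real.exp (-‖x‖ ^ 2) =
    ∏ i, (fun t : ℝ => t ^ (if i = 0 then k else 0) * Real.exp (-t ^ 2)) (x i) := by
  rw [EuclideanSpace.real_norm_sq_eq, Finset.prod_mul_distrib, ← Real.exp_sum]
  simp [Fin.sum_univ_three]

theorem integrable_gauss_coord (k : ℕ) :
    Integrable fun x : E3 => x 0 ^ k * Real.exp (-‖x‖ ^ 2) := by
  simp_rw [gauss_prod]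
  have h := Integrable.fintype_prod (μ := fun _ : Fin 3 => (volume : Measure ℝ))
    (f := fun i t => t ^ (if i = 0 then k else 0) * Real.exp (-t ^ 2))
    (fun i => integrable_pow_mul_exp _)
  exact (PiLp.volume_preserving_ofLp (Fin 3)).integrable_comp_of_integrable h

theorem integral_gauss_coord (k : ℕ) :
    ∫ x : E3, x 0 ^ k * Real.exp (-‖x‖ ^ 2) =
      (∫ t : ℝ, t ^ k * Real.exp (-t ^ 2)) * (∫ t : ℝ, Real.exp (-t ^ 2)) ^ 2 := by
  simp_rw [gauss_prod]
  have h := integral_fintype_prod_volume_eq_prod (𝕜 := ℝ) (E := fun _ : Fin 3 => ℝ)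
    (fun i t => t ^ (if i = 0 then k else 0) * Real.exp (-t ^ 2))
  rw [(PiLp.volume_preserving_ofLp (Fin 3)).integral_comp
    (MeasurableEquiv.toLp 2 (Fin 3 → ℝ)).symm.measurableEmbedding
    (fun z : Fin 3 → ℝ => ∏ i, (fun t : ℝ => t ^ (if i = 0 then k else 0) * Real.exp (-t ^ 2)) (z i)),
    h, Fin.prod_univ_three]
  simp
  ring

/-- Completing `y` to an orthonormal basis reduces Gaussian integrals of `⟨x,y⟩` to those of a
coordinate. -/
theorem exists_isometry_inner_eq_coord (y : S2) :
    ∃ L : E3 ≃ₗᵢ[ℝ] E3, ∀ x : E3, inner ℝ x (y : E3) = L x 0 := by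
  have hv : Orthonormal ℝ (({0} : Set (Fin 3)).domRestrict fun _ => (y : E3)) := by
    refine ⟨fun i => mem_sphere_zero_iff_norm.mp y.2, fun i j hij => ?_⟩
    exact absurd (Subsingleton.elim i j) hij
  obtain ⟨b, hb⟩ := hv.exists_orthonormalBasis_extension_of_card_eq (by simp)
  refine ⟨b.repr, fun x => ?_⟩
  rw [b.repr_apply_apply, hb 0 rfl, real_inner_comm]

theorem integrable_gauss_inner (y : S2) (k : ℕ) :
    Integrable fun x : E3 => inner ℝ x (y : E3) ^ k * Real.exp (-‖x‖ ^ 2) := by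
  obtain ⟨L, hL⟩ := exists_isometry_inner_eq_coord y
  have := L.measurePreserving.integrable_comp_of_integrable (integrable_gauss_coord k)
  refine this.congr (Filter.Eventually.of_forall fun x => ?_)
  simp [hL]

theorem integral_gauss_inner (y : S2) (k : ℕ) :
    ∫ x : E3, inner ℝ x (y : E3) ^ k * Real.exp (-‖x‖ ^ 2) =
      (∫ t : ℝ, t ^ k * Real.exp (-t ^ 2)) * (∫ t : ℝ, Real.exp (-t ^ 2)) ^ 2 := by
  obtain ⟨L, hL⟩ := exists_isometry_inner_eq_coord y
  rw [← integral_gauss_coord, ← L.measurePreserving.integral_comp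
    L.toHomeomorph.measurableEmbedding (fun x : E3 => x 0 ^ k * Real.exp (-‖x‖ ^ 2))]
  simp [hL]

/-- Both sides evaluate the Gaussian integral of `⟨x,y⟩^k`: by Fubini after a rotation, and in polar
coordinates. The spherical moments can then be solved for, with the case `k = 0` fixing the area. -/
theorem gauss_polar (y : S2) (k : ℕ) :
    (∫ t : ℝ, t ^ k * Real.exp (-t ^ 2)) * (∫ t : ℝ, Real.exp (-t ^ 2)) ^ 2 =
      sphereArea * (gaussMoment (k + 2) * ∫ ω : S2, inner ℝ (ω : E3) (y : E3) ^ k ∂(sphereMeasure 3)) := by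
  rw [← integral_gauss_inner y k, integral_polar (integrable_gauss_inner y k), gaussMoment,
    ← integral_mul_const, smul_eq_mul]
  congr 1
  refine setIntegral_congr_fun measurableSet_Ioi fun ρ hρ => ?_
  have hρ0 : 0 ≤ ρ := le_of_lt hρ
  have : ∀ ω : S2, inner ℝ (ρ • (ω : E3)) (y : E3) ^ k * Real.exp (-‖ρ • (ω : E3)‖ ^ 2) =
      (ρ ^ k * Real.exp (-ρ ^ 2)) * inner ℝ (ω : E3) (y : E3) ^ k := by
    intro ω
    rw [inner_smul_left, norm_smul, mem_sphere_zero_iff_norm.mp ω.2, mul_one,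
      Real.norm_of_nonneg hρ0, mul_pow]
    simp
    ring
  simp only [this, integral_const_mul, smul_eq_mul]
  ring

theorem integral_inner_pow (y : S2) (k : ℕ) :
    ∫ ω : S2, inner ℝ (ω : E3) (y : E3) ^ k ∂(sphereMeasure 3) =
      if Even k then 1 / (k + 1 : ℝ) else 0 := by
  have h0 := gauss_polar y 0
  have hk := gauss_polar y k
  have e0 : ∫ t : ℝ, Real.exp (-t ^ 2) = 2 * gaussMoment 0 := by
    rw [← integral_pow_mul_exp_even (k := 0) (by simp)]
    simp
  have hA := sphereArea_pos
  have g0 := gaussMoment_pos 0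
  have gk := gaussMoment_pos k
  rw [e0, gaussMoment_add_two] at h0 hk
  simp [e0] at h0
  split_ifs with h
  · rw [integral_pow_mul_exp_even h] at hk
    set M := ∫ ω : S2, inner ℝ (ω : E3) (y : E3) ^ k ∂(sphereMeasure 3)
    have hA' : sphereArea = 16 * gaussMoment 0 ^ 2 := by
      have : gaussMoment 0 * sphereArea = gaussMoment 0 * (16 * gaussMoment 0 ^ 2) := by linarith
      exact mul_left_cancel₀ g0.ne' this
    rw [hA'] at hk
    have : gaussMoment 0 ^ 2 * gaussMoment k * (8 * ((k + 1) * M)) =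
        gaussMoment 0 ^ 2 * gaussMoment k * 8 := by linarith
    have h1 := mul_left_cancel₀ (by positivity) this
    rw [eq_div_iff (by positivity)]
    linarith
  · rw [integral_pow_mul_exp_odd (Nat.not_even_iff_odd.mp h), zero_mul] at hk
    have h2 : sphereArea * ((k + 1) / 2 * gaussMoment k) ≠ 0 := by positivity
    rw [← mul_assoc] at hk
    exact (mul_eq_zero.mp hk.symm).resolve_left h2

/-- The uniform probability measure on `[-1, 1]`. -/
noncomputable def uniformMeasure : Measure ℝ :=
  (2⁻¹ : ENNReal) • (volume : Measure ℝ).restrict (Icc (-1) 1)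

theorem integral_uniformMeasure {V : Type*} [NormedAddCommGroup V] [NormedSpace ℝ V] (f : ℝ → V) :
    ∫ t, f t ∂uniformMeasure = (2⁻¹ : ℝ) • ∫ t in (-1 : ℝ)..1, f t := by
  rw [uniformMeasure, integral_smul_measure, intervalIntegral.integral_of_le (by norm_num),
    integral_Icc_eq_integral_Ioc]
  simp

instance : IsProbabilityMeasure uniformMeasure := by
  refine ⟨?_⟩
  simp only [uniformMeasure, Measure.smul_apply, Measure.restrict_apply_univ, Real.volume_Icc,
    smul_eq_mul]
  norm_num
  exact ENNReal.inv_mul_cancel two_ne_zero ENNReal.ofNat_ne_top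

theorem ae_uniformMeasure_mem : ∀ᵐ t ∂uniformMeasure, t ∈ Icc (-1 : ℝ) 1 :=
  Measure.ae_smul_measure (ae_restrict_mem measurableSet_Icc) _

theorem inner_mem_Icc (x y : S2) : inner ℝ (x : E3) (y : E3) ∈ Icc (-1 : ℝ) 1 := by
  have h := abs_real_inner_le_norm (x : E3) (y : E3)
  rw [mem_sphere_zero_iff_norm.mp x.2, mem_sphere_zero_iff_norm.mp y.2, mul_one] at h
  exact abs_le.mp h

theorem continuous_inner_sphere (y : S2) : Continuous fun ω : S2 => inner ℝ (ω : E3) (y : E3) := by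
  fun_prop

theorem integral_inner_poly (y : S2) (p : Polynomial ℝ) :
    ∫ ω : S2, p.eval (inner ℝ (ω : E3) (y : E3)) ∂(sphereMeasure 3) =
      ∫ t, p.eval t ∂uniformMeasure := by
  have hi : ∀ q : Polynomial ℝ, Integrable
      (fun ω : S2 => q.eval (inner ℝ (ω : E3) (y : E3))) (sphereMeasure 3) := fun q =>
    (q.continuous.comp (continuous_inner_sphere y)).integrable_of_hasCompactSupport
      (HasCompactSupport.of_compactSpace _)
  rw [integral_uniformMeasure]
  induction p using Polynomial.induction_on' with
  | add p q hp hq =>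
    simp only [Polynomial.eval_add]
    rw [integral_add (hi p) (hi q), hp, hq, intervalIntegral.integral_add, smul_add]
    · exact intervalIntegrable_eval _ _ _
    · exact intervalIntegrable_eval _ _ _
  | monomial k a =>
    simp only [Polynomial.eval_monomial, integral_const_mul, intervalIntegral.integral_const_mul,
      integral_inner_pow, integral_pow, smul_eq_mul]
    split_ifs with h
    · rw [(h.add_one).neg_one_pow]
      field_simp
      norm_num
    · rw [((Nat.not_even_iff_odd.mp h).add_one).neg_one_pow]
      simp

/-- Archimedes: the projection of the unit sphere to an axis is uniformly distributed. -/
theorem measurePreserving_inner (y : S2) :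
    MeasurePreserving (fun ω : S2 => inner ℝ (ω : E3) (y : E3)) (sphereMeasure 3)
      uniformMeasure := by
  have hc := continuous_inner_sphere y
  refine ⟨hc.measurable, ?_⟩
  have : IsProbabilityMeasure
      ((sphereMeasure 3).map fun ω : S2 => inner ℝ (ω : E3) (y : E3)) :=
    Measure.isProbabilityMeasure_map hc.aemeasurable
  refine ext_of_forall_integral_eq_of_IsFiniteMeasure fun f => ?_
  rw [integral_map hc.aemeasurable f.continuous.aestronglyMeasurable]
  -- Both laws are carried by `[-1,1]`, so Weierstrass approximation reduces continuous test
  -- functions to polynomials, where the moments agree.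
  refine eq_of_forall_dist_le fun ε hε => ?_
  obtain ⟨p, hp⟩ := exists_polynomial_near_of_continuousOn (-1) 1 f f.continuous.continuousOn
    (ε / 2) (by positivity)
  have hpi1 : Integrable
      (fun ω : S2 => p.eval (inner ℝ (ω : E3) (y : E3))) (sphereMeasure 3) :=
    (p.continuous.comp hc).integrable_of_hasCompactSupport (HasCompactSupport.of_compactSpace _)
  have hfi1 : Integrable (fun ω : S2 => f (inner ℝ (ω : E3) (y : E3))) (sphereMeasure 3) :=
    (f.continuous.comp hc).integrable_of_hasCompactSupport (HasCompactSupport.of_compactSpace _)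
  have hfi2 : Integrable f uniformMeasure := f.integrable _
  have hpi2 : Integrable (fun t => p.eval t) uniformMeasure :=
    (p.continuous.continuousOn.integrableOn_Icc).smul_measure (by simp)
  have h1 : dist (∫ ω : S2, f (inner ℝ (ω : E3) (y : E3)) ∂(sphereMeasure 3))
      (∫ ω : S2, p.eval (inner ℝ (ω : E3) (y : E3)) ∂(sphereMeasure 3)) ≤ ε / 2 := by
    rw [dist_eq_norm, ← integral_sub hfi1 hpi1]
    refine (norm_integral_le_of_norm_le_const (C := ε / 2)
      (Filter.Eventually.of_forall fun ω => ?_)).trans (by simp)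
    rw [Real.norm_eq_abs, abs_sub_comm]
    exact (hp _ (inner_mem_Icc ω y)).le
  have h2 : dist (∫ t, p.eval t ∂uniformMeasure) (∫ t, f t ∂uniformMeasure) ≤ ε / 2 := by
    rw [dist_eq_norm, ← integral_sub hpi2 hfi2]
    refine (norm_integral_le_of_norm_le_const (C := ε / 2) ?_).trans (by simp)
    filter_upwards [ae_uniformMeasure_mem] with t ht
    exact (hp _ ht).le
  rw [integral_inner_poly] at h1
  linarith [dist_triangle (∫ ω : S2, f (inner ℝ (ω : E3) (y : E3)) ∂(sphereMeasure 3))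
    (∫ t, p.eval t ∂uniformMeasure) (∫ t, f t ∂uniformMeasure)]

end Archimedes

/-! ### The addition theorem -/

section Addition

theorem continuous_of_mem_sphericalHarmonics {m : ℕ} {f : S2 → ℂ}
    (hf : f ∈ sphericalHarmonics 3 m) : Continuous f := by
  obtain ⟨p, -, rfl⟩ := hf
  refine (MvPolynomial.continuous_eval p).comp (continuous_pi fun i => ?_)
  fun_prop

theorem integrable_of_continuous_sphere {V : Type*} [NormedAddCommGroup V] {f : S2 → V}
    (hf : Continuous f) : Integrable f (sphereMeasure 3) :=
  hf.integrable_of_hasCompactSupport (HasCompactSupport.of_compactSpace _)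

theorem eq_zero_of_integral_nonpos {f : S2 → ℝ} (hf : Continuous f) (h0 : ∀ x, 0 ≤ f x)
    (h : ∫ x, f x ∂(sphereMeasure 3) ≤ 0) (x : S2) : f x = 0 := by
  have h1 : ∫ x, f x ∂(sphereMeasure 3) = 0 := le_antisymm h (integral_nonneg h0)
  rw [integral_eq_zero_iff_of_nonneg h0 (integrable_of_continuous_sphere hf)] at h1
  exact congrFun ((hf.ae_eq_iff_eq (sphereMeasure 3) continuous_const).mp h1) x

variable {m : ℕ} {ι : Type*} {Y : ι → S2 → ℂ}

theorem IsSphericalHarmonicBasis.mem (hY : IsSphericalHarmonicBasis 3 m Y) (l : ι) :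
    Y l ∈ sphericalHarmonics 3 m := by
  rw [← hY.span_eq]
  exact Submodule.subset_span ⟨l, rfl⟩

theorem IsSphericalHarmonicBasis.continuous (hY : IsSphericalHarmonicBasis 3 m Y) (l : ι) :
    Continuous (Y l) := continuous_of_mem_sphericalHarmonics (hY.mem l)

variable [Fintype ι]

theorem IsSphericalHarmonicBasis.integral_sum (hY : IsSphericalHarmonicBasis 3 m Y) (c : ι → ℂ)
    (l : ι) : ∫ x, (∑ k, c k • Y k) x * conj (Y l x) ∂(sphereMeasure 3) = c l := by
  classical
  have h : ∀ x, (∑ k, c k • Y k) x * conj (Y l x) = ∑ k, c k * (Y k x * conj (Y l x)) := by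
    intro x
    simp [Finset.sum_apply, Finset.sum_mul, mul_assoc]
  simp_rw [h]
  rw [integral_finsetSum]
  · simp_rw [integral_const_mul]
    rw [Finset.sum_eq_single l]
    · rw [hY.integral_self, mul_one]
    · intro k _ hk
      rw [hY.integral_ne k l hk, mul_zero]
    · simp
  · intro k _
    have := hY.continuous k
    have := hY.continuous l
    exact integrable_of_continuous_sphere (by fun_prop)

theorem IsSphericalHarmonicBasis.card_le (hY : IsSphericalHarmonicBasis 3 m Y) :
    Fintype.card ι ≤ 2 * m + 1 := by
  have hli : LinearIndependent ℂ (fun l => (⟨Y l, hY.mem l⟩ : sphericalHarmonics 3 m)) := by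
    rw [Fintype.linearIndependent_iff]
    intro c hc l
    have h1 : ∑ k, c k • Y k = 0 := by
      have := congrArg Subtype.val hc
      simpa using this
    have h2 := hY.integral_sum c l
    rw [h1] at h2
    simpa using h2.symm
  obtain ⟨hfin, hle⟩ := finrank_sphericalHarmonics_le m
  exact hli.fintype_card_le_finrank.trans hle

/-- `∑_l Y_l(x) conj (Y_l(y))`. -/
noncomputable def harmonicKernel (Y : ι → S2 → ℂ) (x y : S2) : ℂ := ∑ l, Y l x * conj (Y l y)

theorem harmonicKernel_mem (hY : IsSphericalHarmonicBasis 3 m Y) (y : S2) :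
    (fun x => harmonicKernel Y x y) ∈ sphericalHarmonics 3 m := by
  have : (fun x => harmonicKernel Y x y) = ∑ l, conj (Y l y) • Y l := by
    ext x
    simp [harmonicKernel, Finset.sum_apply, mul_comm]
  rw [this]
  exact Submodule.sum_mem _ fun l _ => Submodule.smul_mem _ _ (hY.mem l)

/-- Pairing with the kernel reads off the coefficients of `f` in the orthonormal basis and
reassembles `f` at `y`. -/
theorem integral_mul_conj_harmonicKernel (hY : IsSphericalHarmonicBasis 3 m Y) {f : S2 → ℂ}
    (hf : f ∈ sphericalHarmonics 3 m) (y : S2) :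
    ∫ x, f x * conj (harmonicKernel Y x y) ∂(sphereMeasure 3) = f y := by
  have hfc := continuous_of_mem_sphericalHarmonics hf
  have h : ∀ x, f x * conj (harmonicKernel Y x y) = ∑ l, Y l y * (f x * conj (Y l x)) := by
    intro x
    simp only [harmonicKernel, map_sum, map_mul, Complex.conj_conj, Finset.mul_sum]
    exact Finset.sum_congr rfl fun l _ => by ring
  simp_rw [h]
  rw [integral_finsetSum]
  · simp_rw [integral_const_mul]
    rw [← hY.span_eq, Submodule.mem_span_range_iff_exists_fun] at hf
    obtain ⟨c, rfl⟩ := hf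
    simp_rw [hY.integral_sum]
    simp [Finset.sum_apply, mul_comm]
  · intro l _
    have := hY.continuous l
    exact integrable_of_continuous_sphere (by fun_prop)

theorem continuous_harmonicKernel_diag (hY : IsSphericalHarmonicBasis 3 m Y) :
    Continuous fun y => harmonicKernel Y y y := by
  have := hY.continuous
  unfold harmonicKernel
  fun_prop

theorem integral_harmonicKernel_diag (hY : IsSphericalHarmonicBasis 3 m Y) :
    ∫ y, harmonicKernel Y y y ∂(sphereMeasure 3) = Fintype.card ι := by
  unfold harmonicKernel
  rw [integral_finsetSum]
  · simp [hY.integral_self]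
  · intro l _
    have := hY.continuous l
    exact integrable_of_continuous_sphere (by fun_prop)

theorem integral_legendre_inner_mul (n k : ℕ) (y : S2) :
    ∫ x : S2, (legendre n).eval (inner ℝ (x : E3) (y : E3)) *
      (legendre k).eval (inner ℝ (x : E3) (y : E3)) ∂(sphereMeasure 3) =
      if n = k then 1 / (2 * n + 1 : ℝ) else 0 := by
  have h := integral_inner_poly y (legendre n * legendre k)
  simp only [Polynomial.eval_mul] at h
  rw [h, integral_uniformMeasure]
  split_ifs with hnk
  · subst hnk
    rw [integral_legendre_sq, smul_eq_mul]
    field_simp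
  · rw [integral_legendre_mul_legendre_of_ne hnk, smul_zero]

/-- The addition theorem for spherical harmonics. -/
theorem harmonicKernel_eq (hY : IsSphericalHarmonicBasis 3 m Y) (x y : S2) :
    harmonicKernel Y x y =
      (((2 * m + 1) * (legendre m).eval (inner ℝ (x : E3) (y : E3)) : ℝ) : ℂ) := by
  set W : S2 → S2 → ℂ := fun x y =>
    (((2 * m + 1) * (legendre m).eval (inner ℝ (x : E3) (y : E3)) : ℝ) : ℂ) with hW
  have hWmem : ∀ y, (fun x => W x y) ∈ sphericalHarmonics 3 m := by
    intro y
    have h := Submodule.smul_mem _ ((2 * m + 1 : ℝ) : ℂ) (legendre_inner_mem_sphericalHarmonics y m)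
    convert h using 1
    ext x
    simp [hW]
  -- Let `Z` be the harmonic kernel. The reproducing property gives `‖D(·,y)‖² = Z(y,y) - (2m+1)`.
  -- The right side is therefore nonnegative, while its mean over `y` is the number of basis
  -- elements minus `2m+1`, at most `0`. By continuity it vanishes at every `y`, and so does `D`.
  set D : S2 → S2 → ℂ := fun x y => W x y - harmonicKernel Y x y with hD
  have hDmem : ∀ y, (fun x => D x y) ∈ sphericalHarmonics 3 m := fun y =>
    Submodule.sub_mem _ (hWmem y) (harmonicKernel_mem hY y)
  have hWc : ∀ y, Continuous fun x => W x y := fun y =>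
    continuous_of_mem_sphericalHarmonics (hWmem y)
  have hZc : ∀ y, Continuous fun x => harmonicKernel Y x y := fun y =>
    continuous_of_mem_sphericalHarmonics (harmonicKernel_mem hY y)
  have hDc : ∀ y, Continuous fun x => D x y := fun y =>
    continuous_of_mem_sphericalHarmonics (hDmem y)
  have hWconj : ∀ x y, conj (W x y) = W x y := fun x y => Complex.conj_ofReal _
  have hWdiag : ∀ y, W y y = 2 * m + 1 := by
    intro y
    have : inner ℝ (y : E3) (y : E3) = 1 := by
      rw [real_inner_self_eq_norm_sq, mem_sphere_zero_iff_norm.mp y.2, one_pow]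
    simp only [hW, this, eval_one_legendre, mul_one]
    push_cast
    ring
  have hWW : ∀ y, ∫ x, W x y * conj (W x y) ∂(sphereMeasure 3) = 2 * m + 1 := by
    intro y
    have : ∀ x, W x y * conj (W x y) = (((2 * m + 1) ^ 2 *
        ((legendre m).eval (inner ℝ (x : E3) (y : E3)) *
        (legendre m).eval (inner ℝ (x : E3) (y : E3))) : ℝ) : ℂ) := by
      intro x
      rw [hWconj]
      simp only [hW]
      push_cast
      ring
    simp_rw [this]
    rw [integral_complex_ofReal, integral_const_mul, integral_legendre_inner_mul, if_pos rfl]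
    have h1 : (2 * m + 1 : ℝ) ≠ 0 := by positivity
    have : (2 * m + 1 : ℝ) ^ 2 * (1 / (2 * m + 1)) = 2 * m + 1 := by field_simp
    rw [this]
    push_cast
    ring
  have hZW : ∀ y, ∫ x, harmonicKernel Y x y * conj (W x y) ∂(sphereMeasure 3) = 2 * m + 1 := by
    intro y
    have h := integral_mul_conj_harmonicKernel hY (hWmem y) y
    have h2 := congrArg conj h
    rw [← integral_conj, hWdiag] at h2
    simp only [map_mul, Complex.conj_conj, map_add, map_one, map_natCast, map_ofNat] at h2
    rw [← h2]
    congr 1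
    ext x
    ring
  have hDD : ∀ y, ∫ x, ‖D x y‖ ^ 2 ∂(sphereMeasure 3) =
      (harmonicKernel Y y y).re - (2 * m + 1) := by
    intro y
    have e : ∀ x, ((‖D x y‖ ^ 2 : ℝ) : ℂ) = W x y * conj (W x y) -
        harmonicKernel Y x y * conj (W x y) - D x y * conj (harmonicKernel Y x y) := by
      intro x
      rw [Complex.ofReal_pow, ← Complex.mul_conj']
      simp only [hD, map_sub]
      ring
    have h1 : ((∫ x, ‖D x y‖ ^ 2 ∂(sphereMeasure 3) : ℝ) : ℂ) =
        harmonicKernel Y y y - (2 * m + 1) := by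
      rw [← integral_complex_ofReal]
      have h2 := hWc y
      have h3 := hZc y
      have h4 := hDc y
      simp_rw [e]
      rw [integral_sub, integral_sub, hWW, hZW, integral_mul_conj_harmonicKernel hY (hDmem y)]
      · simp only [hD, hWdiag]
        ring
      all_goals exact integrable_of_continuous_sphere (by fun_prop)
    have h2 := congrArg Complex.re h1
    simpa using h2
  have hdc := continuous_harmonicKernel_diag hY
  have hdiag : ∀ y, (harmonicKernel Y y y).re - (2 * m + 1) = 0 := by
    refine eq_zero_of_integral_nonpos (by fun_prop) (fun y => ?_) ?_
    · rw [← hDD y]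
      exact integral_nonneg fun x => by positivity
    · rw [integral_sub (integrable_of_continuous_sphere (by fun_prop)) (integrable_const _)]
      have h := congrArg Complex.re (integral_harmonicKernel_diag hY)
      have h' : ∫ y, (harmonicKernel Y y y).re ∂(sphereMeasure 3) = Fintype.card ι := by
        have h2 := integral_re (𝕜 := ℂ) (integrable_of_continuous_sphere hdc)
        simp only [RCLike.re_to_complex] at h2
        rw [h2, h]
        simp
      rw [h']
      have := hY.card_le
      have hc : (Fintype.card ι : ℝ) ≤ 2 * m + 1 := by exact_mod_cast this
      simpa using hc
  have h0 := eq_zero_of_integral_nonpos (f := fun x => ‖D x y‖ ^ 2)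
    (by have := hDc y; fun_prop) (fun x => by positivity) (by rw [hDD, hdiag]) x
  have : D x y = 0 := by simpa using h0
  simp only [hD] at this
  exact (sub_eq_zero.mp this).symm

end Addition

/-! ### Orthogonality between degrees; zonal functions with different axes -/

section Reproducing

variable {ι : ℕ → Type*} [∀ m, Fintype (ι m)] {Y : ∀ m, ι m → S2 → ℂ}

/-- Zonal functions of different degrees with the same axis `y` are orthogonal, by Archimedes and
the orthogonality of Legendre polynomials. Expanding them in the bases and integrating over `y` as
well yields `∑ |A l l'|² = 0` for the matrix of inner products. -/
theorem integral_mul_conj_of_ne (hY : ∀ m, IsSphericalHarmonicBasis 3 m (Y m)) {m k : ℕ}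
    (hmk : m ≠ k) (l : ι m) (l' : ι k) :
    ∫ x, Y m l x * conj (Y k l' x) ∂(sphereMeasure 3) = 0 := by
  have hcm := (hY m).continuous
  have hck := (hY k).continuous
  set A : ι m → ι k → ℂ := fun l l' => ∫ x, Y m l x * conj (Y k l' x) ∂(sphereMeasure 3) with hA
  have h1 : ∀ y, ∑ l, ∑ l', A l l' * (conj (Y m l y) * Y k l' y) = 0 := by
    intro y
    have hL : ∫ x, harmonicKernel (Y m) x y * conj (harmonicKernel (Y k) x y)
        ∂(sphereMeasure 3) = 0 := by
      have : ∀ x, harmonicKernel (Y m) x y * conj (harmonicKernel (Y k) x y) =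
          (((2 * m + 1) * (2 * k + 1) * ((legendre m).eval (inner ℝ (x : E3) (y : E3)) *
          (legendre k).eval (inner ℝ (x : E3) (y : E3))) : ℝ) : ℂ) := by
        intro x
        rw [harmonicKernel_eq (hY m), harmonicKernel_eq (hY k), Complex.conj_ofReal]
        push_cast
        ring
      simp_rw [this]
      rw [integral_complex_ofReal, integral_const_mul, integral_legendre_inner_mul, if_neg hmk]
      simp
    rw [← hL]
    have : ∀ x, harmonicKernel (Y m) x y * conj (harmonicKernel (Y k) x y) =
        ∑ l, ∑ l', (Y m l x * conj (Y k l' x)) * (conj (Y m l y) * Y k l' y) := by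
      intro x
      simp only [harmonicKernel, map_sum, map_mul, Complex.conj_conj, Finset.sum_mul_sum]
      exact Finset.sum_congr rfl fun l _ => Finset.sum_congr rfl fun l' _ => by ring
    simp_rw [this]
    rw [integral_finsetSum]
    · refine Finset.sum_congr rfl fun l _ => ?_
      rw [integral_finsetSum]
      · exact Finset.sum_congr rfl fun l' _ => by rw [integral_mul_const]
      · exact fun l' _ => integrable_of_continuous_sphere (by fun_prop)
    · exact fun l _ => integrable_of_continuous_sphere (by fun_prop)
  have h2 : ∑ l, ∑ l', A l l' * conj (A l l') = 0 := by
    have h3 : ∫ y, ∑ l, ∑ l', A l l' * (conj (Y m l y) * Y k l' y) ∂(sphereMeasure 3) = 0 := by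
      simp_rw [h1]; simp
    rw [← h3, integral_finsetSum]
    · refine Finset.sum_congr rfl fun l _ => ?_
      rw [integral_finsetSum]
      · refine Finset.sum_congr rfl fun l' _ => ?_
        rw [integral_const_mul]
        congr 1
        simp only [hA]
        rw [← integral_conj]
        simp
      · exact fun l' _ => integrable_of_continuous_sphere (by fun_prop)
    · exact fun l _ => integrable_of_continuous_sphere (by fun_prop)
  have h4 : ∑ l, ∑ l', ‖A l l'‖ ^ 2 = 0 := by
    simp_rw [Complex.mul_conj'] at h2
    exact_mod_cast h2
  have h5 := (Finset.sum_eq_zero_iff_of_nonneg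
    (fun l _ => Finset.sum_nonneg fun l' _ => by positivity)).mp h4 l (Finset.mem_univ _)
  have h6 := (Finset.sum_eq_zero_iff_of_nonneg (fun l' _ => by positivity)).mp h5 l'
    (Finset.mem_univ _)
  simpa using h6

theorem integral_legendre_mul_legendre_inner (hY : ∀ m, IsSphericalHarmonicBasis 3 m (Y m))
    (m k : ℕ) (x y : S2) :
    ∫ ω : S2, (legendre m).eval (inner ℝ (ω : E3) (x : E3)) *
      (legendre k).eval (inner ℝ (ω : E3) (y : E3)) ∂(sphereMeasure 3) =
      if m = k then (legendre m).eval (inner ℝ (x : E3) (y : E3)) / (2 * m + 1) else 0 := by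
  have hm0 : (2 * m + 1 : ℝ) ≠ 0 := by positivity
  have hk0 : (2 * k + 1 : ℝ) ≠ 0 := by positivity
  have h : ((2 * m + 1 : ℝ) * (2 * k + 1)) * ∫ ω : S2,
      (legendre m).eval (inner ℝ (ω : E3) (x : E3)) *
      (legendre k).eval (inner ℝ (ω : E3) (y : E3)) ∂(sphereMeasure 3) =
      if m = k then (2 * m + 1) * (legendre m).eval (inner ℝ (x : E3) (y : E3)) else 0 := by
    rw [← integral_const_mul]
    have key : ((∫ ω : S2, ((2 * m + 1 : ℝ) * (2 * k + 1)) *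
      ((legendre m).eval (inner ℝ (ω : E3) (x : E3)) *
      (legendre k).eval (inner ℝ (ω : E3) (y : E3))) ∂(sphereMeasure 3) : ℝ) : ℂ) =
      ∫ ω, harmonicKernel (Y m) ω x * conj (harmonicKernel (Y k) ω y) ∂(sphereMeasure 3) := by
      rw [← integral_complex_ofReal]
      congr 1
      ext ω
      rw [harmonicKernel_eq (hY m), harmonicKernel_eq (hY k), Complex.conj_ofReal]
      push_cast
      ring
    split_ifs with hmk
    · subst hmk
      rw [integral_mul_conj_harmonicKernel (hY m) (harmonicKernel_mem (hY m) x),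
        harmonicKernel_eq (hY m), real_inner_comm] at key
      exact_mod_cast key
    · have hcm := (hY m).continuous
      have hck := (hY k).continuous
      have h0 : ∫ ω, harmonicKernel (Y m) ω x * conj (harmonicKernel (Y k) ω y)
          ∂(sphereMeasure 3) = 0 := by
        have : ∀ ω, harmonicKernel (Y m) ω x * conj (harmonicKernel (Y k) ω y) =
            ∑ l, ∑ l', (Y m l ω * conj (Y k l' ω)) * (conj (Y m l x) * Y k l' y) := by
          intro ω
          simp only [harmonicKernel, map_sum, map_mul, Complex.conj_conj, Finset.sum_mul_sum]
          exact Finset.sum_congr rfl fun l _ => Finset.sum_congr rfl fun l' _ => by ring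
        simp_rw [this]
        rw [integral_finsetSum]
        · refine Finset.sum_eq_zero fun l _ => ?_
          rw [integral_finsetSum]
          · refine Finset.sum_eq_zero fun l' _ => ?_
            rw [integral_mul_const, integral_mul_conj_of_ne hY hmk, zero_mul]
          · exact fun l' _ => integrable_of_continuous_sphere (by fun_prop)
        · exact fun l _ => integrable_of_continuous_sphere (by fun_prop)
      rw [h0] at key
      exact_mod_cast key
  split_ifs at h ⊢ with hmk
  · subst hmk
    rw [eq_div_iff hm0]
    have h' : (2 * m + 1 : ℝ) * ((∫ ω : S2, (legendre m).eval (inner ℝ (ω : E3) (x : E3)) *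
      (legendre m).eval (inner ℝ (ω : E3) (y : E3)) ∂(sphereMeasure 3)) * (2 * m + 1)) =
      (2 * m + 1) * (legendre m).eval (inner ℝ (x : E3) (y : E3)) := by
      rw [← h]; ring
    exact mul_left_cancel₀ hm0 h'
  · exact (mul_eq_zero.mp h).resolve_left (mul_ne_zero hm0 hk0)

end Reproducing

/-! ### Legendre expansions and overlaps of spherical caps -/

section Completeness

open Set

theorem span_legendre : Submodule.span ℝ (range legendre) = ⊤ := by
  have hdeg : ∀ n, (legendre n).degree = n := fun n =>
    le_antisymm (Polynomial.natDegree_le_iff_degree_le.mp (natDegree_legendre_le n))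
      (Polynomial.le_degree_of_ne_zero (coeff_legendre_pos n).ne')
  refine Polynomial.Sequence.span ⟨legendre, hdeg⟩ fun i => ?_
  rw [isUnit_iff_ne_zero, Polynomial.leadingCoeff_ne_zero, ← Polynomial.degree_ne_bot]
  exact (hdeg i).trans_ne (by simp)

theorem memLp_eval (p : Polynomial ℝ) : MemLp (fun t => p.eval t) 2 uniformMeasure := by
  obtain ⟨C, hC⟩ := isCompact_Icc.exists_bound_of_continuousOn
    (p.continuous.continuousOn (s := Icc (-1 : ℝ) 1))
  exact MemLp.of_bound p.continuous.aestronglyMeasurable C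
    (ae_uniformMeasure_mem.mono fun t ht => hC t ht)

/-- A polynomial as an element of `L²([-1, 1])`. -/
noncomputable def polyL2 : Polynomial ℝ →ₗ[ℝ] Lp ℝ 2 uniformMeasure where
  toFun p := (memLp_eval p).toLp _
  map_add' p q := by
    rw [← MemLp.toLp_add]
    congr 1
    ext t
    simp
  map_smul' c p := by
    rw [RingHom.id_apply, ← MemLp.toLp_const_smul]
    congr 1
    ext t
    simp

theorem coeFn_polyL2 (p : Polynomial ℝ) : polyL2 p =ᵐ[uniformMeasure] fun t => p.eval t :=
  (memLp_eval p).coeFn_toLp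

theorem inner_polyL2 (p q : Polynomial ℝ) :
    inner ℝ (polyL2 p) (polyL2 q) = ∫ t, p.eval t * q.eval t ∂uniformMeasure := by
  rw [L2.inner_def]
  refine integral_congr_ae ?_
  filter_upwards [coeFn_polyL2 p, coeFn_polyL2 q] with t hp hq
  rw [hp, hq]
  simp [mul_comm]

/-- The normalized Legendre polynomials in `L²([-1, 1])`. -/
noncomputable def legendreL2 (n : ℕ) : Lp ℝ 2 uniformMeasure :=
  √(2 * n + 1) • polyL2 (legendre n)

theorem orthonormal_legendreL2 : Orthonormal ℝ legendreL2 := by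
  rw [orthonormal_iff_ite]
  intro n k
  rw [legendreL2, legendreL2, real_inner_smul_left, real_inner_smul_right, inner_polyL2,
    integral_uniformMeasure]
  split_ifs with h
  · subst h
    rw [integral_legendre_sq, ← mul_assoc, Real.mul_self_sqrt (by positivity), smul_eq_mul]
    field_simp
  · rw [integral_legendre_mul_legendre_of_ne h]
    simp

theorem polyL2_mem_span (p : Polynomial ℝ) :
    polyL2 p ∈ Submodule.span ℝ (range legendreL2) := by
  have hp : p ∈ Submodule.span ℝ (range legendre) := by rw [span_legendre]; trivial
  have := Submodule.mem_map_of_mem (f := polyL2) hp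
  rw [Submodule.map_span] at this
  refine Submodule.span_le.mpr ?_ this
  rintro _ ⟨_, ⟨n, rfl⟩, rfl⟩
  have h0 : √(2 * n + 1 : ℝ) ≠ 0 := by positivity
  have : polyL2 (legendre n) = (√(2 * n + 1 : ℝ))⁻¹ • legendreL2 n := by
    rw [legendreL2, smul_smul, inv_mul_cancel₀ h0, one_smul]
  rw [this]
  exact Submodule.smul_mem _ _ (Submodule.subset_span ⟨n, rfl⟩)

theorem topologicalClosure_span_legendreL2 :
    ⊤ ≤ (Submodule.span ℝ (range legendreL2)).topologicalClosure := by
  have hd := BoundedContinuousFunction.toLp_denseRange ℝ uniformMeasure (p := 2) ℝ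
    ENNReal.ofNat_ne_top
  intro g _
  refine closure_minimal ?_ (Submodule.isClosed_topologicalClosure _) (hd g)
  rintro _ ⟨f, rfl⟩
  refine Metric.mem_closure_iff.mpr fun ε hε => ?_
  -- Bounded continuous functions are dense in `L²`. On `[-1,1]` they are uniform limits of
  -- polynomials, which are finite combinations of Legendre polynomials.
  obtain ⟨p, hp⟩ := exists_polynomial_near_of_continuousOn (-1) 1 f f.continuous.continuousOn
    (ε / 2) (by positivity)
  refine ⟨polyL2 p, polyL2_mem_span p, ?_⟩
  rw [dist_eq_norm]
  have hb : ∀ᵐ t ∂uniformMeasure,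
      ‖(BoundedContinuousFunction.toLp 2 uniformMeasure ℝ f - polyL2 p :
        Lp ℝ 2 uniformMeasure) t‖ ≤ ε / 2 := by
    filter_upwards [Lp.coeFn_sub (BoundedContinuousFunction.toLp 2 uniformMeasure ℝ f) (polyL2 p),
      BoundedContinuousFunction.coeFn_toLp 2 uniformMeasure ℝ f, coeFn_polyL2 p,
      ae_uniformMeasure_mem] with t h1 h2 h3 h4
    rw [h1, Pi.sub_apply, h2, h3, Real.norm_eq_abs, abs_sub_comm]
    exact (hp t h4).le
  have h := Lp.norm_le_of_ae_bound (by positivity) hb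
  have hu : measureUnivNNReal uniformMeasure = 1 := by simp [measureUnivNNReal]
  rw [hu] at h
  simp at h
  linarith

/-- The normalized Legendre polynomials as a Hilbert basis of `L²([-1, 1])`. -/
noncomputable def legendreBasis : HilbertBasis ℕ ℝ (Lp ℝ 2 uniformMeasure) :=
  HilbertBasis.mk orthonormal_legendreL2 topologicalClosure_span_legendreL2

theorem legendreBasis_apply (n : ℕ) : legendreBasis n = legendreL2 n := by
  rw [legendreBasis, HilbertBasis.coe_mk]

/-- The isometry `g ↦ g(⟨·, x⟩)`. -/
noncomputable def zonal (x : S2) : Lp ℝ 2 uniformMeasure →ₗᵢ[ℝ] Lp ℝ 2 (sphereMeasure 3) :=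
  Lp.compMeasurePreservingₗᵢ ℝ _ (measurePreserving_inner x)

theorem coeFn_zonal (x : S2) (g : Lp ℝ 2 uniformMeasure) {f : ℝ → ℝ}
    (hg : g =ᵐ[uniformMeasure] f) :
    zonal x g =ᵐ[sphereMeasure 3] fun ω => f (inner ℝ (ω : E3) (x : E3)) :=
  (Lp.coeFn_compMeasurePreserving g (measurePreserving_inner x)).trans
    ((measurePreserving_inner x).quasiMeasurePreserving.ae_eq_comp hg)

theorem inner_zonal {x y : S2} {g h : Lp ℝ 2 uniformMeasure} {f k : ℝ → ℝ}
    (hg : g =ᵐ[uniformMeasure] f) (hh : h =ᵐ[uniformMeasure] k) :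
    inner ℝ (zonal x g) (zonal y h) = ∫ ω : S2, f (inner ℝ (ω : E3) (x : E3)) *
      k (inner ℝ (ω : E3) (y : E3)) ∂(sphereMeasure 3) := by
  rw [L2.inner_def]
  refine integral_congr_ae ?_
  filter_upwards [coeFn_zonal x g hg, coeFn_zonal y h hh] with ω h1 h2
  rw [h1, h2]
  simp [mul_comm]

variable {ι : ℕ → Type*} [∀ m, Fintype (ι m)] {Y : ∀ m, ι m → S2 → ℂ}

theorem inner_zonal_legendreL2 (hY : ∀ m, IsSphericalHarmonicBasis 3 m (Y m)) (x y : S2)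
    (m k : ℕ) : inner ℝ (zonal x (legendreL2 m)) (zonal y (legendreL2 k)) =
      if m = k then (legendre m).eval (inner ℝ (x : E3) (y : E3)) else 0 := by
  rw [legendreL2, legendreL2, map_smul, map_smul, real_inner_smul_left, real_inner_smul_right,
    inner_zonal (coeFn_polyL2 _) (coeFn_polyL2 _), integral_legendre_mul_legendre_inner hY]
  split_ifs with h
  · subst h
    rw [← mul_assoc, Real.mul_self_sqrt (by positivity)]
    field_simp
  · simp

/-- A Parseval identity for two axes: expand `g` against a single Legendre function with axis `y`,
where only one term survives, and then expand `h`. -/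
theorem hasSum_inner_zonal (hY : ∀ m, IsSphericalHarmonicBasis 3 m (Y m)) (x y : S2)
    (g h : Lp ℝ 2 uniformMeasure) :
    HasSum (fun m => (2 * m + 1) * (inner ℝ (polyL2 (legendre m)) g *
      inner ℝ (polyL2 (legendre m)) h) * (legendre m).eval (inner ℝ (x : E3) (y : E3)))
      (inner ℝ (zonal x g) (zonal y h)) := by
  have h1 : ∀ k, inner ℝ (zonal x g) (zonal y (legendreL2 k)) =
      inner ℝ (legendreL2 k) g * (legendre k).eval (inner ℝ (x : E3) (y : E3)) := by
    intro k
    have hs := legendreBasis.hasSum_repr g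
    have hs' := hs.mapL (((innerSL ℝ).flip (zonal y (legendreL2 k))).comp
      (zonal x).toContinuousLinearMap)
    have e : ∀ m, (((innerSL ℝ).flip (zonal y (legendreL2 k))).comp
        (zonal x).toContinuousLinearMap) (legendreBasis.repr g m • legendreBasis m) =
        if m = k then inner ℝ (legendreL2 k) g *
          (legendre k).eval (inner ℝ (x : E3) (y : E3)) else 0 := by
      intro m
      rw [map_smul, HilbertBasis.repr_apply_apply, legendreBasis_apply]
      have : (((innerSL ℝ).flip (zonal y (legendreL2 k))).comp
        (zonal x).toContinuousLinearMap) (legendreL2 m) =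
          inner ℝ (zonal x (legendreL2 m)) (zonal y (legendreL2 k)) := rfl
      rw [this, inner_zonal_legendreL2 hY]
      split_ifs with hmk
      · subst hmk; rfl
      · simp
    simp_rw [e] at hs'
    exact (hs'.unique (hasSum_ite_eq k _))
  have hs := (legendreBasis.hasSum_repr h).mapL
    ((innerSL ℝ (zonal x g)).comp (zonal y).toContinuousLinearMap)
  have e : ∀ m : ℕ, ((innerSL ℝ (zonal x g)).comp (zonal y).toContinuousLinearMap)
      (legendreBasis.repr h m • legendreBasis m) = (2 * m + 1) * (inner ℝ (polyL2 (legendre m)) g *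
      inner ℝ (polyL2 (legendre m)) h) * (legendre m).eval (inner ℝ (x : E3) (y : E3)) := by
    intro m
    rw [map_smul, HilbertBasis.repr_apply_apply, legendreBasis_apply]
    have : ((innerSL ℝ (zonal x g)).comp (zonal y).toContinuousLinearMap) (legendreL2 m) =
      inner ℝ (zonal x g) (zonal y (legendreL2 m)) := rfl
    rw [this, h1, legendreL2, real_inner_smul_left, real_inner_smul_left, smul_eq_mul]
    have hsq := Real.mul_self_sqrt (by positivity : (0 : ℝ) ≤ 2 * m + 1)
    linear_combination ((inner ℝ (polyL2 (legendre m)) g * inner ℝ (polyL2 (legendre m)) h *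
      (legendre m).eval (inner ℝ (x : E3) (y : E3)))) * hsq
  simp_rw [e] at hs
  exact hs

/-- Half the integral of `P_m` over `[c, 1]`. -/
noncomputable def capCoeff (m : ℕ) (c : ℝ) : ℝ :=
  2⁻¹ * ∫ t in (max (-1) (min 1 c))..1, (legendre m).eval t

/-- The normalized area of the intersection of two congruent spherical caps. -/
noncomputable def capOverlap (c : ℝ) (x y : S2) : ℝ :=
  (sphereMeasure 3).real {ω | c ≤ inner ℝ (ω : E3) (x : E3) ∧ c ≤ inner ℝ (ω : E3) (y : E3)}

theorem setIntegral_Ici_uniformMeasure (m : ℕ) (c : ℝ) :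
    ∫ t in Ici c, (legendre m).eval t ∂uniformMeasure = capCoeff m c := by
  -- Clamping keeps the formula valid for all heights: `c ≤ -1` gives the whole sphere, and `c ≥ 1`
  -- gives a null set.
  set d := max (-1) (min 1 c) with hd
  have hd1 : d ≤ 1 := by rw [hd]; exact max_le (by norm_num) (min_le_left _ _)
  rw [uniformMeasure, Measure.restrict_smul, integral_smul_measure, capCoeff,
    Measure.restrict_restrict measurableSet_Ici, ← hd, intervalIntegral.integral_of_le hd1,
    ← integral_Icc_eq_integral_Ioc]
  have hset : (Ici c ∩ Icc (-1) 1 : Set ℝ) =ᵐ[volume] Icc d 1 := by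
    rcases le_or_gt c 1 with hc | hc
    · have : Ici c ∩ Icc (-1) 1 = Icc d 1 := by
        ext t
        simp only [mem_inter_iff, mem_Ici, mem_Icc, hd, max_le_iff, min_eq_right hc]
        tauto
      rw [this]
      exact Filter.EventuallyEq.rfl
    · have e1 : Ici c ∩ Icc (-1) 1 = ∅ := by
        ext t
        simp only [mem_inter_iff, mem_Ici, mem_Icc, mem_empty_iff_false, iff_false]
        intro h; linarith [h.1, h.2.2]
      have e2 : d = 1 := by rw [hd, min_eq_left hc.le]; norm_num
      rw [e1, e2, Icc_self]
      exact (ae_eq_empty.mpr (by simp)).symm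
  rw [setIntegral_congr_set hset]
  simp

/-- A cap is the zonal function of the indicator of `[c, ∞)`, whose Legendre coefficients are the
cap coefficients. -/
theorem hasSum_capOverlap (hY : ∀ m, IsSphericalHarmonicBasis 3 m (Y m)) (c : ℝ) (x y : S2) :
    HasSum (fun m => (2 * m + 1) * capCoeff m c ^ 2 *
      (legendre m).eval (inner ℝ (x : E3) (y : E3))) (capOverlap c x y) := by
  set g : Lp ℝ 2 uniformMeasure :=
    indicatorConstLp 2 (measurableSet_Ici (a := c)) (measure_ne_top _ _) (1 : ℝ) with hg
  have hs := hasSum_inner_zonal hY x y g g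
  have h1 : ∀ m, inner ℝ (polyL2 (legendre m)) g = capCoeff m c := by
    intro m
    rw [real_inner_comm, hg, L2.inner_indicatorConstLp_one, ← setIntegral_Ici_uniformMeasure]
    exact integral_congr_ae (ae_restrict_of_ae (coeFn_polyL2 _))
  have h2 : inner ℝ (zonal x g) (zonal y g) = capOverlap c x y := by
    have hgi : g =ᵐ[uniformMeasure] (Ici c).indicator fun _ => (1 : ℝ) := indicatorConstLp_coeFn
    rw [inner_zonal hgi hgi, capOverlap]
    have hm : MeasurableSet {ω : S2 | c ≤ inner ℝ (ω : E3) (x : E3) ∧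
        c ≤ inner ℝ (ω : E3) (y : E3)} :=
      ((isClosed_le continuous_const (continuous_inner_sphere x)).inter
        (isClosed_le continuous_const (continuous_inner_sphere y))).measurableSet
    rw [← integral_indicator_one hm]
    congr 1
    ext ω
    by_cases hx : c ≤ inner ℝ (ω : E3) (x : E3) <;> by_cases hy : c ≤ inner ℝ (ω : E3) (y : E3) <;>
      simp [indicator, hx, hy]
  rw [h2] at hs
  simp_rw [h1, ← pow_two] at hs
  exact hs

theorem continuous_capCoeff (m : ℕ) : Continuous (capCoeff m) := by
  have h : Continuous fun d : ℝ => ∫ t in d..1, (legendre m).eval t := by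
    have := intervalIntegral.continuous_primitive
      (fun a b => intervalIntegrable_eval (legendre m) a b) 1
    have e : (fun d : ℝ => ∫ t in d..1, (legendre m).eval t) =
        fun d => -∫ t in (1 : ℝ)..d, (legendre m).eval t :=
      funext fun d => intervalIntegral.integral_symm _ _
    rw [e]
    exact this.neg
  exact continuous_const.mul (h.comp (by fun_prop))

theorem capCoeff_of_one_le (m : ℕ) {c : ℝ} (hc : 1 ≤ c) : capCoeff m c = 0 := by
  rw [capCoeff, min_eq_left hc]
  norm_num

theorem capCoeff_of_mem (m : ℕ) {c : ℝ} (hc : c ∈ Icc (-1 : ℝ) 1) :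
    capCoeff m c = 2⁻¹ * ∫ t in c..1, (legendre m).eval t := by
  rw [capCoeff, min_eq_right hc.2, max_eq_right hc.1]

theorem capCoeff_sq_le (m : ℕ) (c : ℝ) : capCoeff m c ^ 2 ≤ 2 / (m + 1 : ℝ) ^ 3 := by
  set d := max (-1) (min 1 c) with hd
  have hd1 : d ∈ Icc (-1 : ℝ) 1 :=
    ⟨le_max_left _ _, max_le (by norm_num) (min_le_left _ _)⟩
  have hc : capCoeff m c = 2⁻¹ * ∫ t in d..1, (legendre m).eval t := rfl
  rw [hc]
  rcases Nat.eq_zero_or_pos m with rfl | hm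
  · simp [legendre_zero]
    nlinarith [hd1.1, hd1.2]
  · rw [integral_legendre_eq hm]
    have h := one_sub_sq_mul_derivative_legendre_sq_le hm hd1
    have hm0 : (1 : ℝ) ≤ m := by exact_mod_cast hm
    rw [mul_pow, div_pow]
    calc (2⁻¹ : ℝ) ^ 2 * (((1 - d ^ 2) * (Polynomial.derivative (legendre m)).eval d) ^ 2 /
          (m * (m + 1)) ^ 2) ≤ 2⁻¹ ^ 2 * (m / (m * (m + 1)) ^ 2) := by gcongr
      _ ≤ 2 / (m + 1 : ℝ) ^ 3 := by
        have : (m : ℝ) / (m * (m + 1)) ^ 2 = 1 / (m * (m + 1) ^ 2) := by field_simp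
        rw [this, ← div_eq_mul_one_div, div_le_div_iff₀ (by positivity) (by positivity)]
        have : (m + 1 : ℝ) ≤ 2 * m := by linarith
        nlinarith [pow_pos (by linarith : (0 : ℝ) < m + 1) 2]

/-- A single cap coefficient can vanish at some heights; the average over heights cannot be small,
by the lower bound for `∫ ((1-s²)P_m')²`. -/
theorem exists_le_integral_capCoeff_sq {a : ℝ} (ha0 : 0 ≤ a) (ha1 : a < 1) :
    ∃ δ : ℝ, 0 < δ ∧ ∀ m : ℕ, δ / (m + 1 : ℝ) ^ 3 ≤ ∫ s in a..1, capCoeff m s ^ 2 := by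
  obtain ⟨δ, hδ, h⟩ := exists_le_integral_derivative_legendre_sq ha0 ha1
  have h1a : 0 < 1 - a := by linarith
  refine ⟨min (δ / 4) ((1 - a) ^ 3 / 12), lt_min (by positivity) (by positivity), fun m => ?_⟩
  rcases Nat.eq_zero_or_pos m with rfl | hm
  · have : ∫ s in a..1, capCoeff 0 s ^ 2 = (1 - a) ^ 3 / 12 := by
      have e : ∀ s ∈ uIcc a 1, capCoeff 0 s ^ 2 =
          (Polynomial.derivative (Polynomial.C (1 / 12 : ℝ) * (Polynomial.X - 1) ^ 3)).eval s := by
        intro s hs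
        rw [uIcc_of_le ha1.le] at hs
        rw [capCoeff_of_mem 0 ⟨by linarith [hs.1], hs.2⟩]
        simp [legendre_zero, Polynomial.derivative_pow]
        ring
      rw [intervalIntegral.integral_congr e, integral_derivative_eval]
      simp
      ring
    rw [this]
    simp
  · have hm0 : (0 : ℝ) < m := by exact_mod_cast hm
    have e : ∀ s ∈ uIcc a 1, capCoeff m s ^ 2 = (1 / (4 * (m * (m + 1)) ^ 2)) *
        ((1 - s ^ 2) * (Polynomial.derivative (legendre m)).eval s) ^ 2 := by
      intro s hs
      rw [uIcc_of_le ha1.le] at hs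
      rw [capCoeff_of_mem m ⟨by linarith [hs.1], hs.2⟩, integral_legendre_eq hm]
      field_simp
      ring
    rw [intervalIntegral.integral_congr e, intervalIntegral.integral_const_mul]
    calc min (δ / 4) ((1 - a) ^ 3 / 12) / (m + 1 : ℝ) ^ 3 ≤ (δ / 4) / (m + 1 : ℝ) ^ 3 := by
          gcongr; exact min_le_left _ _
      _ ≤ (1 / (4 * (m * (m + 1)) ^ 2)) * (δ * m) := by
          have : (1 / (4 * (m * (m + 1)) ^ 2)) * (δ * m) = (δ / 4) / (m * (m + 1 : ℝ) ^ 2) := by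
            field_simp
          rw [this]
          gcongr
          have : (m + 1 : ℝ) ^ 3 = (m + 1) * (m + 1) ^ 2 := by ring
          rw [this]
          gcongr
          linarith
      _ ≤ _ := by
          gcongr
          exact h m hm

end Completeness

/-! ### Zonal expansion of the ball kernel and the size of its coefficients -/

section KernelExpansion

open Set

/-- The ball of radius `R` around `ρω`, `ω ∈ S²`, meets the sphere in the cap
`⟨·, ω⟩ ≥ capHeight R ρ`. -/
noncomputable def capHeight (R ρ : ℝ) : ℝ := (1 + ρ ^ 2 - R ^ 2) / (2 * ρ)

theorem dist_smul_le_iff {R ρ : ℝ} (hR : 0 ≤ R) (hρ : 0 < ρ) (x ω : S2) :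
    dist (x : E3) (ρ • (ω : E3)) ≤ R ↔ capHeight R ρ ≤ inner ℝ (ω : E3) (x : E3) := by
  have hx : ‖(x : E3)‖ = 1 := mem_sphere_zero_iff_norm.mp x.2
  have hω : ‖(ω : E3)‖ = 1 := mem_sphere_zero_iff_norm.mp ω.2
  rw [dist_eq_norm, ← sq_le_sq₀ (norm_nonneg _) hR, norm_sub_sq_real, inner_smul_right, norm_smul,
    hx, hω, Real.norm_of_nonneg hρ.le, capHeight, div_le_iff₀ (by positivity), real_inner_comm]
  constructor <;> intro h <;> nlinarith

theorem dirac_real_closedBall (x z : E3) (R : ℝ) :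
    (Measure.dirac x).real (closedBall z R) = (closedBall x R).indicator (fun _ => (1 : ℝ)) z := by
  rw [measureReal_def, Measure.dirac_apply' _ measurableSet_closedBall]
  by_cases hw : dist x z ≤ R
  · have hw' : dist z x ≤ R := by rwa [dist_comm]
    simp [Set.indicator, mem_closedBall, hw, hw']
  · have hw' : ¬ dist z x ≤ R := by rwa [dist_comm]
    simp [Set.indicator, mem_closedBall, hw, hw']

/-- The factor relating `K_{3,r}` to integrals over the radius. -/
noncomputable def kernelConst (r : ℝ) : ℝ :=
  (volume.real (closedBall (0 : E3) (r / 2)))⁻¹ * sphereArea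

theorem kernelConst_pos {r : ℝ} (hr : 0 < r) : 0 < kernelConst r := by
  have : 0 < volume.real (closedBall (0 : E3) (r / 2)) :=
    ENNReal.toReal_pos (measure_closedBall_pos _ _ (by positivity)).ne' measure_closedBall_lt_top.ne
  have := sphereArea_pos
  unfold kernelConst
  positivity

theorem ballKernel_sphere {r : ℝ} (hr : 0 < r) (x y : S2) :
    ballKernel 3 r x y = kernelConst r *
      ∫ ρ in Ioi (0 : ℝ), ρ ^ 2 * capOverlap (capHeight (r / 2) ρ) x y := by
  rw [ballKernel, integral_polar (integrable_dirac_mul_dirac 3 (r / 2) x y), kernelConst,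
    smul_eq_mul, mul_assoc]
  congr 2
  refine setIntegral_congr_fun measurableSet_Ioi fun ρ hρ => ?_
  simp only [smul_eq_mul]
  congr 1
  rw [capOverlap]
  have hm : MeasurableSet {ω : S2 | capHeight (r / 2) ρ ≤ inner ℝ (ω : E3) (x : E3) ∧
      capHeight (r / 2) ρ ≤ inner ℝ (ω : E3) (y : E3)} :=
    ((isClosed_le continuous_const (continuous_inner_sphere x)).inter
      (isClosed_le continuous_const (continuous_inner_sphere y))).measurableSet
  rw [← integral_indicator_one hm]
  congr 1
  ext ω
  rw [dirac_real_closedBall, dirac_real_closedBall]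
  have hx := dist_smul_le_iff (R := r / 2) (by positivity) hρ x ω
  have hy := dist_smul_le_iff (R := r / 2) (by positivity) hρ y ω
  rw [dist_comm] at hx hy
  simp only [indicator, mem_closedBall, hx, hy, mem_ofPred_eq]
  split_ifs <;> simp_all

/-- Balls this far out miss the sphere, so all radial integrals are effectively over `(0, 1 + R]`.
-/
theorem one_le_capHeight {R ρ : ℝ} (hR : 0 ≤ R) (h : 1 + R < ρ) : 1 ≤ capHeight R ρ := by
  rw [capHeight, le_div_iff₀ (by linarith)]
  nlinarith

theorem sq_mul_capCoeff_sq_le {R ρ : ℝ} (hR : 0 ≤ R) (hρ : 0 < ρ) (m : ℕ) :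
    ρ ^ 2 * capCoeff m (capHeight R ρ) ^ 2 ≤
      (Ioc 0 (1 + R)).indicator (fun _ => (1 + R) ^ 2 * (2 / (m + 1 : ℝ) ^ 3)) ρ := by
  rcases le_or_gt ρ (1 + R) with h | h
  · rw [indicator_of_mem (show ρ ∈ Ioc 0 (1 + R) from ⟨hρ, h⟩)]
    have := capCoeff_sq_le m (capHeight R ρ)
    gcongr
  · rw [capCoeff_of_one_le m (one_le_capHeight hR h)]
    simp only [ne_eq, OfNat.ofNat_ne_zero, not_false_eq_true, zero_pow, mul_zero]
    exact indicator_nonneg (fun _ _ => by positivity) _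

theorem integrable_indicator_const (b C : ℝ) :
    Integrable ((Ioc 0 b).indicator (fun _ => C)) (volume : Measure ℝ) :=
  (integrable_indicator_iff measurableSet_Ioc).mpr (integrableOn_const (by simp))

theorem measurable_capHeight (R : ℝ) : Measurable (capHeight R) := by
  unfold capHeight
  fun_prop

theorem integrableOn_sq_mul_capCoeff_sq {R : ℝ} (hR : 0 ≤ R) (m : ℕ) :
    IntegrableOn (fun ρ => ρ ^ 2 * capCoeff m (capHeight R ρ) ^ 2) (Ioi 0) := by
  refine ((integrable_indicator_const (1 + R)
    ((1 + R) ^ 2 * (2 / (m + 1 : ℝ) ^ 3))).integrableOn).mono' ?_ ?_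
  · have := (continuous_capCoeff m).measurable.comp (measurable_capHeight R)
    exact ((measurable_id.pow_const 2).mul (this.pow_const 2)).aestronglyMeasurable
  · filter_upwards [ae_restrict_mem measurableSet_Ioi] with ρ hρ
    rw [Real.norm_of_nonneg (by positivity)]
    exact sq_mul_capCoeff_sq_le hR hρ m

theorem integral_sq_mul_capCoeff_sq_le {R : ℝ} (hR : 0 ≤ R) (m : ℕ) :
    ∫ ρ in Ioi 0, ρ ^ 2 * capCoeff m (capHeight R ρ) ^ 2 ≤
      (1 + R) ^ 3 * (2 / (m + 1 : ℝ) ^ 3) := by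
  have h1 : ∫ ρ in Ioi 0, ρ ^ 2 * capCoeff m (capHeight R ρ) ^ 2 ≤
      ∫ ρ in Ioi 0, (Ioc 0 (1 + R)).indicator
        (fun _ => (1 + R) ^ 2 * (2 / (m + 1 : ℝ) ^ 3)) ρ :=
    setIntegral_mono_on (integrableOn_sq_mul_capCoeff_sq hR m)
      (integrable_indicator_const (1 + R) _).integrableOn measurableSet_Ioi
      fun ρ hρ => sq_mul_capCoeff_sq_le hR hρ m
  refine h1.trans (le_of_eq ?_)
  rw [setIntegral_indicator measurableSet_Ioc,
    inter_eq_self_of_subset_right Ioc_subset_Ioi_self, setIntegral_const]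
  have : volume.real (Ioc 0 (1 + R)) = 1 + R := by
    rw [Real.volume_real_Ioc_of_le (by positivity)]; ring
  rw [this, smul_eq_mul]
  ring

/-- The coefficients of the expansion of `K_{3,r}` on the sphere in spherical harmonics. -/
noncomputable def kernelCoeff (r : ℝ) (m : ℕ) : ℝ :=
  kernelConst r * ∫ ρ in Ioi (0 : ℝ), ρ ^ 2 * capCoeff m (capHeight (r / 2) ρ) ^ 2

theorem summable_inv_add_one_sq : Summable fun m : ℕ => 1 / (m + 1 : ℝ) ^ 2 := by
  have := (summable_nat_add_iff 1).mpr (Real.summable_one_div_nat_pow (p := 2).mpr one_lt_two)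
  simpa using this

variable {ι : ℕ → Type*} [∀ m, Fintype (ι m)] {Y : ∀ m, ι m → S2 → ℂ}

/-- The cap expansion is integrated term by term; this is allowed since the `m`-th term has `L¹`
norm of order at most `(m+1)⁻³ (2m+1)`. -/
theorem hasSum_ballKernel_legendre (hY : ∀ m, IsSphericalHarmonicBasis 3 m (Y m)) {r : ℝ}
    (hr : 0 < r) (x y : S2) :
    HasSum (fun m => kernelCoeff r m *
      ((2 * m + 1) * (legendre m).eval (inner ℝ (x : E3) (y : E3)))) (ballKernel 3 r x y) := by
  set R := r / 2 with hR
  have hR0 : 0 ≤ R := by positivity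
  set w : ℕ → ℝ := fun m => (2 * m + 1) * (legendre m).eval (inner ℝ (x : E3) (y : E3)) with hw
  set F : ℕ → ℝ → ℝ := fun m ρ => (ρ ^ 2 * capCoeff m (capHeight R ρ) ^ 2) * w m with hF
  have hwb : ∀ m, |w m| ≤ 2 * (m + 1) := by
    intro m
    rw [hw]
    simp only [abs_mul]
    have h1 := abs_legendre_le_one m (inner_mem_Icc x y)
    rw [abs_of_nonneg (by positivity : (0 : ℝ) ≤ 2 * m + 1)]
    nlinarith [(Nat.cast_nonneg m : (0 : ℝ) ≤ m)]
  have hFi : ∀ m, Integrable (F m) (volume.restrict (Ioi 0)) := fun m =>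
    (integrableOn_sq_mul_capCoeff_sq hR0 m).mul_const _
  have hsum : Summable fun m => ∫ ρ, ‖F m ρ‖ ∂(volume.restrict (Ioi 0)) := by
    refine Summable.of_nonneg_of_le (fun m => integral_nonneg fun ρ => norm_nonneg _) (fun m => ?_)
      (summable_inv_add_one_sq.mul_left ((1 + R) ^ 3 * 4))
    have e : ∀ ρ, ‖F m ρ‖ = (ρ ^ 2 * capCoeff m (capHeight R ρ) ^ 2) * |w m| := by
      intro ρ
      rw [hF]
      simp only [norm_mul, Real.norm_eq_abs]
      rw [abs_of_nonneg (sq_nonneg ρ), abs_of_nonneg (sq_nonneg (capCoeff m (capHeight R ρ)))]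
    simp_rw [e]
    rw [integral_mul_const]
    calc (∫ ρ in Ioi 0, ρ ^ 2 * capCoeff m (capHeight R ρ) ^ 2) * |w m| ≤
        ((1 + R) ^ 3 * (2 / (m + 1 : ℝ) ^ 3)) * (2 * (m + 1)) := by
          gcongr
          · exact integral_sq_mul_capCoeff_sq_le hR0 m
          · exact hwb m
      _ = (1 + R) ^ 3 * 4 * (1 / (m + 1 : ℝ) ^ 2) := by field_simp; ring
  have h := (hasSum_integral_of_summable_integral_norm hFi hsum).mul_left (kernelConst r)
  have hval : kernelConst r * ∫ ρ in Ioi 0, ∑' m, F m ρ = ballKernel 3 r x y := by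
    rw [ballKernel_sphere hr]
    congr 2
    ext ρ
    have hs := (hasSum_capOverlap hY (capHeight R ρ) x y).mul_left (ρ ^ 2)
    rw [← hs.tsum_eq]
    congr 1
    ext m
    simp only [hF, hw]
    ring
  rw [hval] at h
  have e : ∀ m, kernelConst r * ∫ ρ in Ioi 0, F m ρ = kernelCoeff r m * w m := by
    intro m
    rw [kernelCoeff, mul_assoc, ← integral_mul_const]
  simp_rw [e] at h
  exact h

theorem kernelCoeff_le {r : ℝ} (hr : 0 < r) (m : ℕ) :
    kernelCoeff r m ≤ kernelConst r * (1 + r / 2) ^ 3 * 2 / (m + 1 : ℝ) ^ 3 := by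
  have h := integral_sq_mul_capCoeff_sq_le (R := r / 2) (by positivity) m
  have := kernelConst_pos hr
  rw [kernelCoeff]
  calc _ ≤ kernelConst r * ((1 + r / 2) ^ 3 * (2 / (m + 1 : ℝ) ^ 3)) := by gcongr
    _ = _ := by ring

theorem exists_le_kernelCoeff {r : ℝ} (hr : 0 < r) :
    ∃ δ : ℝ, 0 < δ ∧ ∀ m : ℕ, δ / (m + 1 : ℝ) ^ 3 ≤ kernelCoeff r m := by
  set R := r / 2 with hR
  have hR0 : 0 < R := by positivity
  -- On `[a, 1 + R]` the heights lie in `[0,1]`, using `ρ ≥ R`, and run up to `1`. Moreover `ρ ≥ 1`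
  -- and `ρ ≥ R` make the Jacobian `f'` of `ρ ↦ capHeight R ρ` at most the radial weight `ρ²`, so
  -- changing variables only loses mass.
  set a := max 1 R with ha
  have ha1 : 1 ≤ a := le_max_left _ _
  have haR : R ≤ a := le_max_right _ _
  have hab : a < 1 + R := max_lt (by linarith) (by linarith)
  have hs : ∀ ρ ∈ Icc a (1 + R), capHeight R ρ ∈ Icc (0 : ℝ) 1 := by
    intro ρ hρ
    have hρ0 : 0 < ρ := by linarith [hρ.1]
    rw [capHeight]
    refine ⟨div_nonneg ?_ (by positivity), ?_⟩
    · nlinarith [hρ.1]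
    · rw [div_le_one (by positivity)]
      nlinarith [hρ.1, hρ.2]
  have hsa : capHeight R a < 1 := by
    rw [capHeight, div_lt_one (by linarith)]
    nlinarith
  have hsb : capHeight R (1 + R) = 1 := by
    rw [capHeight]
    field_simp
    ring
  obtain ⟨δ, hδ, h⟩ := exists_le_integral_capCoeff_sq (hs a ⟨le_rfl, hab.le⟩).1 hsa
  refine ⟨kernelConst r * δ, mul_pos (kernelConst_pos hr) hδ, fun m => ?_⟩
  rw [kernelCoeff, mul_div_assoc]
  refine mul_le_mul_of_nonneg_left ((h m).trans ?_) (kernelConst_pos hr).le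
  set f' : ℝ → ℝ := fun ρ => (ρ ^ 2 - 1 + R ^ 2) / (2 * ρ ^ 2) with hf'
  have hd : ∀ ρ ∈ uIcc a (1 + R), HasDerivAt (capHeight R) (f' ρ) ρ := by
    intro ρ hρ
    rw [uIcc_of_le hab.le] at hρ
    have hρ0 : ρ ≠ 0 := by linarith [hρ.1]
    have h1 : HasDerivAt (fun ρ : ℝ => 1 + ρ ^ 2 - R ^ 2) (2 * ρ) ρ := by
      simpa using ((hasDerivAt_pow 2 ρ).const_add 1).sub_const (R ^ 2)
    have h2 : HasDerivAt (fun ρ : ℝ => 2 * ρ) 2 ρ := by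
      simpa using (hasDerivAt_id ρ).const_mul 2
    refine (h1.div h2 (by positivity)).congr_deriv ?_
    rw [hf']
    field_simp
    ring
  have hc : ContinuousOn f' (uIcc a (1 + R)) := by
    refine ContinuousOn.div (by fun_prop) (by fun_prop) fun ρ hρ => ?_
    rw [uIcc_of_le hab.le] at hρ
    have hρ0 : 0 < ρ := by linarith [hρ.1]
    positivity
  have hcc : Continuous fun s => capCoeff m s ^ 2 := (continuous_capCoeff m).pow 2
  have hsub := intervalIntegral.integral_comp_mul_deriv hd hc hcc
  rw [hsb] at hsub
  rw [← hsub, intervalIntegral.integral_of_le hab.le]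
  have hsubset : Ioc a (1 + R) ⊆ Ioi 0 := fun ρ hρ => by
    have := hρ.1
    exact lt_of_lt_of_le one_pos (ha1.trans this.le)
  calc ∫ ρ in Ioc a (1 + R), ((fun s => capCoeff m s ^ 2) ∘ capHeight R) ρ * f' ρ ≤
      ∫ ρ in Ioc a (1 + R), ρ ^ 2 * capCoeff m (capHeight R ρ) ^ 2 := by
        refine setIntegral_mono_on ?_
          ((integrableOn_sq_mul_capCoeff_sq hR0.le m).mono_set hsubset) measurableSet_Ioc ?_
        · have : ContinuousOn (fun ρ => ((fun s => capCoeff m s ^ 2) ∘ capHeight R) ρ * f' ρ)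
              (uIcc a (1 + R)) := by
            refine ContinuousOn.mul ?_ hc
            exact hcc.comp_continuousOn fun ρ hρ => (hd ρ hρ).continuousAt.continuousWithinAt
          rw [uIcc_of_le hab.le] at this
          exact this.integrableOn_Icc.mono_set Ioc_subset_Icc_self
        · intro ρ hρ
          have hρa : a < ρ := hρ.1
          have hρ1 : 1 ≤ ρ := by linarith
          have hle : f' ρ ≤ ρ ^ 2 := by
            rw [hf']
            simp only
            rw [div_le_iff₀ (by positivity)]
            have h1 : R ^ 2 ≤ ρ ^ 2 := by
              have : R ≤ ρ := by linarith
              gcongr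
            have h2 : 1 ≤ ρ ^ 2 := by nlinarith
            nlinarith
          rw [mul_comm]
          exact mul_le_mul_of_nonneg_right hle (sq_nonneg _)
    _ ≤ ∫ ρ in Ioi 0, ρ ^ 2 * capCoeff m (capHeight R ρ) ^ 2 := by
        refine setIntegral_mono_set (integrableOn_sq_mul_capCoeff_sq hR0.le m) ?_
          hsubset.eventuallyLE
        exact Filter.Eventually.of_forall fun ρ => by simp only [Pi.zero_apply]; positivity

end KernelExpansion

/-! ### Reproducing kernel Hilbert spaces and domination of kernels -/

section ReproducingKernels

variable {X : Type*} {H : Type*} [NormedAddCommGroup H] [InnerProductSpace ℂ H] [RKHS ℂ H X ℂ]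
  [CompleteSpace H]

variable (H) in
/-- The reproducing element at `x` of a reproducing kernel Hilbert space of scalar functions. -/
noncomputable def reproducer (x : X) : H := RKHS.kerFun H x 1

theorem inner_reproducer (x : X) (f : H) : inner ℂ (reproducer H x) f = f x := by
  simp [reproducer]

/-- A function orthogonal to all reproducing elements vanishes at every point. -/
theorem denseRange_linearCombination_reproducer :
    DenseRange (Finsupp.linearCombination ℂ (reproducer H)) := by
  have h := RKHS.kerFun_dense H
  rw [Submodule.topologicalClosure_eq_top_iff, Submodule.eq_bot_iff] at h
  have h2 : (LinearMap.range (Finsupp.linearCombination ℂ (reproducer H))).topologicalClosure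
      = ⊤ := by
    rw [Submodule.topologicalClosure_eq_top_iff, Submodule.eq_bot_iff]
    intro f hf
    refine RKHS.ext fun x => ?_
    rw [← inner_reproducer, RKHS.coe_zero, Pi.zero_apply]
    exact hf _ ⟨Finsupp.single x 1, by simp⟩
  intro f
  have : f ∈ (LinearMap.range (Finsupp.linearCombination ℂ (reproducer H))).topologicalClosure := by
    rw [h2]; trivial
  exact this

/-- A map from the reproducing elements extends to a bounded operator as soon as it is bounded on
finite linear combinations. -/
theorem exists_clm_of_norm_le {F : Type*} [NormedAddCommGroup F] [NormedSpace ℂ F]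
    [CompleteSpace F] (Φ : X → F) {C : ℝ}
    (h : ∀ w : X →₀ ℂ, ‖Finsupp.linearCombination ℂ Φ w‖ ≤
      C * ‖Finsupp.linearCombination ℂ (reproducer H) w‖) :
    ∃ V : H →L[ℂ] F, ∀ w : X →₀ ℂ, V (Finsupp.linearCombination ℂ (reproducer H) w) =
      Finsupp.linearCombination ℂ Φ w :=
  ⟨(Finsupp.linearCombination ℂ Φ).extendOfNorm (Finsupp.linearCombination ℂ (reproducer H)),
    fun w => LinearMap.extendOfNorm_eq denseRange_linearCombination_reproducer ⟨C, h⟩ w⟩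

/-- The quadratic form of a kernel. -/
def quadForm (k : X → X → ℂ) (w : X →₀ ℂ) : ℂ :=
  ∑ x ∈ w.support, ∑ y ∈ w.support, conj (w x) * w y * k x y

theorem norm_sq_linearCombination {F : Type*} [NormedAddCommGroup F] [InnerProductSpace ℂ F]
    (Φ : X → F) (w : X →₀ ℂ) :
    ((‖Finsupp.linearCombination ℂ Φ w‖ ^ 2 : ℝ) : ℂ) =
      quadForm (fun x y => inner ℂ (Φ x) (Φ y)) w := by
  have := inner_self_eq_norm_sq_to_K (𝕜 := ℂ) (Finsupp.linearCombination ℂ Φ w)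
  rw [Complex.ofReal_pow]
  refine this.symm.trans ?_
  rw [Finsupp.linearCombination_apply, Finsupp.sum, sum_inner, quadForm]
  refine Finset.sum_congr rfl fun x _ => ?_
  rw [inner_sum]
  refine Finset.sum_congr rfl fun y _ => ?_
  rw [inner_smul_left, inner_smul_right]
  ring

theorem inner_reproducer_reproducer {k : X → X → ℂ} (hk : RKHS.kernel H = kernelMatrix k)
    (x y : X) : inner ℂ (reproducer H x) (reproducer H y) = k x y := by
  rw [inner_reproducer, reproducer, RKHS.kerFun_apply, hk]
  simp [kernelMatrix]

theorem norm_sq_linearCombination_reproducer {k : X → X → ℂ}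
    (hk : RKHS.kernel H = kernelMatrix k) (w : X →₀ ℂ) :
    ‖Finsupp.linearCombination ℂ (reproducer H) w‖ ^ 2 = (quadForm k w).re := by
  have h := norm_sq_linearCombination (reproducer H) w
  simp_rw [inner_reproducer_reproducer hk] at h
  have := congrArg Complex.re h
  rwa [Complex.ofReal_re] at this

variable {H' : Type*} [NormedAddCommGroup H'] [InnerProductSpace ℂ H'] [RKHS ℂ H' X ℂ]
  [CompleteSpace H']

/-- Domination of kernels gives an inclusion of their reproducing kernel Hilbert spaces. -/
theorem exists_inclusion {k k' : X → X → ℂ} (hk : RKHS.kernel H = kernelMatrix k)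
    (hk' : RKHS.kernel H' = kernelMatrix k') {C : ℝ} (hC : 0 ≤ C)
    (h : ∀ w, (quadForm k w).re ≤ C * (quadForm k' w).re) :
    ∃ T : H →L[ℂ] H', ∀ f x, T f x = f x := by
  -- Domination bounds the map sending reproducing elements of `H'` to those of `H`. Its adjoint
  -- preserves point values, hence is the inclusion.
  obtain ⟨V, hV⟩ := exists_clm_of_norm_le (H := H') (reproducer H) (C := √C) (fun w => by
    rw [← sq_le_sq₀ (norm_nonneg _) (by positivity), mul_pow, Real.sq_sqrt hC,
      norm_sq_linearCombination_reproducer hk, norm_sq_linearCombination_reproducer hk']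
    exact h w)
  refine ⟨ContinuousLinearMap.adjoint V, fun f x => ?_⟩
  have hVx : V (reproducer H' x) = reproducer H x := by
    simpa using hV (Finsupp.single x 1)
  rw [← inner_reproducer, ContinuousLinearMap.adjoint_inner_right, hVx, inner_reproducer]

theorem exists_equiv {k k' : X → X → ℂ} (hk : RKHS.kernel H = kernelMatrix k)
    (hk' : RKHS.kernel H' = kernelMatrix k') {C C' : ℝ} (hC : 0 ≤ C) (hC' : 0 ≤ C')
    (h : ∀ w, (quadForm k w).re ≤ C * (quadForm k' w).re)
    (h' : ∀ w, (quadForm k' w).re ≤ C' * (quadForm k w).re) :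
    ∃ T : H ≃L[ℂ] H', ∀ f x, T f x = f x := by
  obtain ⟨T, hT⟩ := exists_inclusion hk hk' hC h
  obtain ⟨S, hS⟩ := exists_inclusion hk' hk hC' h'
  refine ⟨ContinuousLinearEquiv.equivOfInverse T S (fun f => ?_) (fun f => ?_), hT⟩
  · exact RKHS.ext fun x => by rw [hS, hT]
  · exact RKHS.ext fun x => by rw [hT, hS]

theorem posSemidef_kernelMatrix {k : X → X → ℂ} (hsymm : ∀ x y, conj (k y x) = k x y)
    (h : ∀ w, 0 ≤ (quadForm k w).re) : (kernelMatrix k).PosSemidef := by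
  have tfae := (RKHS.posSemidef_tfae (K := kernelMatrix k)).out 0 2
  refine tfae.mpr ⟨?_, fun w => ?_⟩
  · have hid : star (ContinuousLinearMap.id ℂ ℂ) = ContinuousLinearMap.id ℂ ℂ :=
      star_one (ℂ →L[ℂ] ℂ)
    ext x y
    simp [hid, kernelMatrix, Matrix.conjTranspose_apply, hsymm]
  · refine (h w).trans_eq ?_
    simp only [quadForm, Finsupp.sum, RCLike.re_to_complex]
    congr 1
    refine Finset.sum_congr rfl fun x _ => Finset.sum_congr rfl fun y _ => ?_
    simp [kernelMatrix, hsymm]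
    ring

end ReproducingKernels

/-! ### Comparison of the two kernels on the sphere -/

section SphereKernels

variable {ι : ℕ → Type*} [∀ m, Fintype (ι m)] {Y : ∀ m, ι m → S2 → ℂ}

theorem quadForm_harmonicKernel {κ : Type*} [Fintype κ] (Z : κ → S2 → ℂ) (w : S2 →₀ ℂ) :
    quadForm (harmonicKernel Z) w =
      ((∑ l, ‖∑ y ∈ w.support, w y * conj (Z l y)‖ ^ 2 : ℝ) : ℂ) := by
  push_cast
  simp_rw [← Complex.conj_mul', map_sum, Finset.sum_mul_sum, quadForm, harmonicKernel,
    Finset.mul_sum]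
  rw [Finset.sum_comm (s := Finset.univ)]
  refine Finset.sum_congr rfl fun x _ => ?_
  rw [Finset.sum_comm (s := Finset.univ)]
  refine Finset.sum_congr rfl fun y _ => Finset.sum_congr rfl fun l _ => ?_
  rw [map_mul, Complex.conj_conj]
  ring

theorem hasSum_quadForm {k : S2 → S2 → ℂ} {c : ℕ → ℝ}
    (hk : ∀ x y, HasSum (fun m => (c m : ℂ) * harmonicKernel (Y m) x y) (k x y)) (w : S2 →₀ ℂ) :
    HasSum (fun m => c m * ∑ l, ‖∑ y ∈ w.support, w y * conj (Y m l y)‖ ^ 2)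
      (quadForm k w).re := by
  have h : HasSum (fun m => ∑ x ∈ w.support, ∑ y ∈ w.support,
      conj (w x) * w y * ((c m : ℂ) * harmonicKernel (Y m) x y)) (quadForm k w) :=
    hasSum_sum fun x _ => hasSum_sum fun y _ => (hk x y).mul_left _
  have h' := Complex.hasSum_re h
  convert h' using 2 with m
  have e : ∑ x ∈ w.support, ∑ y ∈ w.support,
      conj (w x) * w y * ((c m : ℂ) * harmonicKernel (Y m) x y) =
      (c m : ℂ) * quadForm (harmonicKernel (Y m)) w := by
    simp only [quadForm, Finset.mul_sum]
    exact Finset.sum_congr rfl fun x _ => Finset.sum_congr rfl fun y _ => by ring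
  rw [e, quadForm_harmonicKernel, ← Complex.ofReal_mul, Complex.ofReal_re]

/-- The quadratic form of each harmonic kernel is a sum of squares, so an inequality between
coefficients passes to the quadratic forms. -/
theorem quadForm_le {k k' : S2 → S2 → ℂ} {c c' : ℕ → ℝ}
    (hk : ∀ x y, HasSum (fun m => (c m : ℂ) * harmonicKernel (Y m) x y) (k x y))
    (hk' : ∀ x y, HasSum (fun m => (c' m : ℂ) * harmonicKernel (Y m) x y) (k' x y))
    {C : ℝ} (hC : ∀ m, c m ≤ C * c' m) (w : S2 →₀ ℂ) :
    (quadForm k w).re ≤ C * (quadForm k' w).re := by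
  refine hasSum_le (fun m => ?_) (hasSum_quadForm hk w) ((hasSum_quadForm hk' w).mul_left C)
  rw [← mul_assoc]
  exact mul_le_mul_of_nonneg_right (hC m) (Finset.sum_nonneg fun l _ => by positivity)

/-- The factor `(1 + m(m+1))^{-3/2}` of the Sobolev kernel on the sphere. -/
noncomputable def sobolevCoeff (m : ℕ) : ℝ :=
  (1 + (m : ℝ) * ((m : ℝ) + ((3 : ℕ) : ℝ) - 2)) ^ (-(3 / 2) : ℝ)

theorem rpow_neg_three_halves {t : ℝ} (ht : 0 < t) : (t ^ 2) ^ (-(3 / 2) : ℝ) = 1 / t ^ 3 := by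
  rw [← Real.rpow_natCast t 2, ← Real.rpow_mul ht.le, one_div, ← Real.rpow_natCast t 3,
    ← Real.rpow_neg ht.le]
  norm_num

theorem le_sobolevCoeff (m : ℕ) : 1 / (m + 1 : ℝ) ^ 3 ≤ sobolevCoeff m := by
  rw [← rpow_neg_three_halves (by positivity), sobolevCoeff]
  have hm : (0 : ℝ) ≤ m := m.cast_nonneg
  refine Real.rpow_le_rpow_of_nonpos ?_ ?_ (by norm_num) <;> push_cast <;> nlinarith

/-- Since `1 + m(m+1) ≥ ((m+1)/2)²`, the power `-3/2` produces the factor `2³`. -/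
theorem sobolevCoeff_le (m : ℕ) : sobolevCoeff m ≤ 8 / (m + 1 : ℝ) ^ 3 := by
  have hm : (0 : ℝ) ≤ m := m.cast_nonneg
  have h : 8 / (m + 1 : ℝ) ^ 3 = 1 / ((m + 1 : ℝ) / 2) ^ 3 := by field_simp; norm_num
  rw [h, ← rpow_neg_three_halves (by positivity), sobolevCoeff]
  refine Real.rpow_le_rpow_of_nonpos (by positivity) ?_ (by norm_num)
  push_cast
  nlinarith

theorem sphereSobolevTerm_eq (x y : S2) (m : ℕ) :
    sphereSobolevTerm 3 (3 / 2) Y x y m = (sobolevCoeff m : ℂ) * harmonicKernel (Y m) x y := rfl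

theorem norm_harmonicKernel_le (hY : ∀ m, IsSphericalHarmonicBasis 3 m (Y m)) (m : ℕ) (x y : S2) :
    ‖harmonicKernel (Y m) x y‖ ≤ 2 * (m + 1) := by
  rw [harmonicKernel_eq (hY m), Complex.norm_real, Real.norm_eq_abs, abs_mul,
    abs_of_nonneg (by positivity : (0 : ℝ) ≤ 2 * m + 1)]
  have h1 := abs_legendre_le_one m (inner_mem_Icc x y)
  nlinarith [(Nat.cast_nonneg m : (0 : ℝ) ≤ m)]

theorem summable_sphereSobolevTerm (hY : ∀ m, IsSphericalHarmonicBasis 3 m (Y m)) (x y : S2) :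
    Summable (sphereSobolevTerm 3 (3 / 2) Y x y) := by
  refine Summable.of_norm_bounded (summable_inv_add_one_sq.mul_left 16) fun m => ?_
  have h0 : 0 ≤ sobolevCoeff m := le_trans (by positivity) (le_sobolevCoeff m)
  rw [sphereSobolevTerm_eq, norm_mul, Complex.norm_real, Real.norm_of_nonneg h0]
  calc sobolevCoeff m * ‖harmonicKernel (Y m) x y‖ ≤ (8 / (m + 1 : ℝ) ^ 3) * (2 * (m + 1)) :=
        mul_le_mul (sobolevCoeff_le m) (norm_harmonicKernel_le hY m x y) (norm_nonneg _)
          (by positivity)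
    _ = 16 * (1 / (m + 1 : ℝ) ^ 2) := by field_simp; norm_num

theorem conj_harmonicKernel {κ : Type*} [Fintype κ] (Z : κ → S2 → ℂ) (x y : S2) :
    conj (harmonicKernel Z y x) = harmonicKernel Z x y := by
  simp [harmonicKernel, mul_comm]

/-- The kernel of `H^{3/2}(S²)`. -/
noncomputable def sobolevKernel (Y : ∀ m, ι m → S2 → ℂ) (x y : S2) : ℂ :=
  ∑' m, sphereSobolevTerm 3 (3 / 2) Y x y m

theorem hasSum_sobolevKernel (hY : ∀ m, IsSphericalHarmonicBasis 3 m (Y m)) (x y : S2) :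
    HasSum (fun m => (sobolevCoeff m : ℂ) * harmonicKernel (Y m) x y) (sobolevKernel Y x y) :=
  (summable_sphereSobolevTerm hY x y).hasSum

theorem posSemidef_sphereSobolevMatrix (hY : ∀ m, IsSphericalHarmonicBasis 3 m (Y m)) :
    (sphereSobolevMatrix 3 (3 / 2) Y).PosSemidef := by
  refine posSemidef_kernelMatrix (fun x y => ?_) fun w => ?_
  · rw [Complex.conj_tsum]
    congr 1
    ext m
    rw [sphereSobolevTerm_eq, sphereSobolevTerm_eq, map_mul, Complex.conj_ofReal,
      conj_harmonicKernel]
  · refine (hasSum_quadForm (hasSum_sobolevKernel hY) w).nonneg fun m => ?_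
    have h0 : 0 ≤ sobolevCoeff m := le_trans (by positivity) (le_sobolevCoeff m)
    positivity

theorem hasSum_ballKernel (hY : ∀ m, IsSphericalHarmonicBasis 3 m (Y m)) {r : ℝ} (hr : 0 < r)
    (x y : S2) : HasSum (fun m => (kernelCoeff r m : ℂ) * harmonicKernel (Y m) x y)
      (ballKernel 3 r x y : ℂ) := by
  have h := Complex.hasSum_ofReal.mpr (hasSum_ballKernel_legendre hY hr x y)
  convert h using 2 with m
  rw [harmonicKernel_eq (hY m)]
  push_cast
  ring

/-- The restriction of `K_{3,r}` to the sphere reproduces `H^{3/2}(S²)` with an equivalent norm. -/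
theorem exists_equiv_sphere (hY : ∀ m, IsSphericalHarmonicBasis 3 m (Y m)) {r : ℝ} (hr : 0 < r)
    [hF : Fact (sphereSobolevMatrix 3 (3 / 2) Y).PosSemidef] :
    ∃ T : RKHS.OfKernel (ballMatrixSphere 3 r) ≃L[ℂ]
      RKHS.OfKernel (sphereSobolevMatrix 3 (3 / 2) Y), ∀ f x, T f x = f x := by
  obtain ⟨δ, hδ, hlow⟩ := exists_le_kernelCoeff hr
  have hc := kernelConst_pos hr
  refine exists_equiv (k := fun x y : S2 => (ballKernel 3 r x y : ℂ)) (k' := sobolevKernel Y)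
    (C := kernelConst r * (1 + r / 2) ^ 3 * 2) (C' := 8 / δ)
    RKHS.OfKernel.kernel_ofKernel RKHS.OfKernel.kernel_ofKernel (by positivity) (by positivity)
    (quadForm_le (hasSum_ballKernel hY hr) (hasSum_sobolevKernel hY) fun m => ?_)
    (quadForm_le (hasSum_sobolevKernel hY) (hasSum_ballKernel hY hr) fun m => ?_)
  · refine (kernelCoeff_le hr m).trans ?_
    rw [div_eq_mul_one_div]
    exact mul_le_mul_of_nonneg_left (le_sobolevCoeff m) (by positivity)
  · refine (sobolevCoeff_le m).trans ?_
    calc (8 / (m + 1 : ℝ) ^ 3) = 8 / δ * (δ / (m + 1 : ℝ) ^ 3) := by field_simp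
      _ ≤ _ := mul_le_mul_of_nonneg_left (hlow m) (by positivity)

end SphereKernels

/-! ### Fourier integrals and multipliers on `L²` -/

section SquareIntegrable

open FourierTransform
open scoped ENNReal ContDiff

variable {E : Type*} [NormedAddCommGroup E] [InnerProductSpace ℝ E] [FiniteDimensional ℝ E]
  [MeasurableSpace E] [BorelSpace E]

theorem continuous_fourier_of_integrable {h : E → ℂ} (h1 : Integrable h) : Continuous (𝓕 h) :=
  VectorFourier.fourierIntegral_continuous Real.continuous_fourierChar
    (innerSL ℝ).continuous₂ h1

theorem continuous_fourierInv_of_integrable {h : E → ℂ} (h1 : Integrable h) :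
    Continuous (𝓕⁻ h) :=
  VectorFourier.fourierIntegral_continuous Real.continuous_fourierChar
    (-innerSL ℝ).continuous₂ h1

/-- The Fourier transform of an integrable and square integrable function is given by the Fourier
integral. -/
theorem coeFn_fourier_toLp {h : E → ℂ} (h1 : Integrable h) (h2 : MemLp h 2) :
    (𝓕 (h2.toLp h) : Lp ℂ 2 (volume : Measure E)) =ᵐ[volume] 𝓕 h := by
  -- Smooth compactly supported test functions suffice. Against them the `L²` transform acts as the
  -- distributional one, and Fubini moves the Fourier integral from the test function onto `h`.
  refine ae_eq_of_integral_contDiff_smul_eq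
    ((Lp.memLp _).locallyIntegrable (by norm_num))
    (continuous_fourier_of_integrable h1).locallyIntegrable fun g hg hgc => ?_
  have hg₁ : HasCompactSupport (Complex.ofRealCLM ∘ g) := hgc.comp_left rfl
  have hg₂ : ContDiff ℝ ∞ (Complex.ofRealCLM ∘ g) := by fun_prop
  set φ : 𝓢(E, ℂ) := hg₁.toSchwartzMap hg₂ with hφ
  have hφg : ∀ x, φ x = g x := fun x => rfl
  have e1 : ∫ x, g x • (𝓕 (h2.toLp h) : Lp ℂ 2 (volume : Measure E)) x =
      ((𝓕 (h2.toLp h) : Lp ℂ 2 (volume : Measure E)) : 𝓢'(E, ℂ)) φ := by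
    rw [Lp.toTemperedDistribution_apply]
    simp [hφg]
  have e2 : ((h2.toLp h : Lp ℂ 2 (volume : Measure E)) : 𝓢'(E, ℂ)) (𝓕 φ) =
      ∫ x, 𝓕 (φ : E → ℂ) x • h x := by
    rw [Lp.toTemperedDistribution_apply]
    refine integral_congr_ae ?_
    filter_upwards [h2.coeFn_toLp] with x hx
    rw [hx, SchwartzMap.fourier_coe]
  rw [e1, ← Lp.fourier_toTemperedDistribution_eq, TemperedDistribution.fourier_apply, e2]
  refine (VectorFourier.integral_fourierIntegral_smul_eq_flip Real.continuous_fourierChar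
    (innerSL ℝ).continuous₂ φ.integrable h1 (L := innerₗ E)).trans ?_
  rw [flip_innerₗ]
  simp only [hφg, smul_eq_mul, Complex.real_smul]
  rfl

/-- The inverse Fourier transform of an integrable and square integrable function is given by the
inverse Fourier integral. -/
theorem coeFn_fourierInv_toLp {h : E → ℂ} (h1 : Integrable h) (h2 : MemLp h 2) :
    (𝓕⁻ (h2.toLp h) : Lp ℂ 2 (volume : Measure E)) =ᵐ[volume] 𝓕⁻ h := by
  refine ae_eq_of_integral_contDiff_smul_eq
    ((Lp.memLp _).locallyIntegrable (by norm_num))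
    (continuous_fourierInv_of_integrable h1).locallyIntegrable fun g hg hgc => ?_
  have hg₁ : HasCompactSupport (Complex.ofRealCLM ∘ g) := hgc.comp_left rfl
  have hg₂ : ContDiff ℝ ∞ (Complex.ofRealCLM ∘ g) := by fun_prop
  set φ : 𝓢(E, ℂ) := hg₁.toSchwartzMap hg₂ with hφ
  have hφg : ∀ x, φ x = g x := fun x => rfl
  have e1 : ∫ x, g x • (𝓕⁻ (h2.toLp h) : Lp ℂ 2 (volume : Measure E)) x =
      ((𝓕⁻ (h2.toLp h) : Lp ℂ 2 (volume : Measure E)) : 𝓢'(E, ℂ)) φ := by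
    rw [Lp.toTemperedDistribution_apply]
    simp [hφg]
  have e2 : ((h2.toLp h : Lp ℂ 2 (volume : Measure E)) : 𝓢'(E, ℂ)) (𝓕⁻ φ) =
      ∫ x, 𝓕⁻ (φ : E → ℂ) x • h x := by
    rw [Lp.toTemperedDistribution_apply]
    refine integral_congr_ae ?_
    filter_upwards [h2.coeFn_toLp] with x hx
    rw [hx, SchwartzMap.fourierInv_coe]
  rw [e1, ← Lp.fourierInv_toTemperedDistribution_eq, TemperedDistribution.fourierInv_apply, e2]
  have hflip : (-innerₗ E).flip = -innerₗ E := by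
    ext x y
    simp [real_inner_comm]
  refine (VectorFourier.integral_fourierIntegral_smul_eq_flip Real.continuous_fourierChar
    (-innerSL ℝ).continuous₂ φ.integrable h1 (L := -innerₗ E)).trans ?_
  rw [hflip]
  simp only [hφg, smul_eq_mul, Complex.real_smul]
  rfl

theorem memLp_top_of_forall_norm_le {m : E → ℂ} (hm : Continuous m) {C : ℝ}
    (hC : ∀ ξ, ‖m ξ‖ ≤ C) : MemLp m ∞ (volume : Measure E) :=
  memLp_top_of_bound hm.aestronglyMeasurable C (Filter.Eventually.of_forall hC)

/-- Multiplication of square integrable functions by a bounded function. -/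
noncomputable def mulL2 {m : E → ℂ} (hm : MemLp m ∞ (volume : Measure E)) :
    Lp ℂ 2 (volume : Measure E) →L[ℂ] Lp ℂ 2 (volume : Measure E) :=
  (ContinuousLinearMap.mul ℂ ℂ).holderL volume ∞ 2 2 (hm.toLp m)

theorem mulL2_apply {m : E → ℂ} (hm : MemLp m ∞ (volume : Measure E))
    (f : Lp ℂ 2 (volume : Measure E)) : mulL2 hm f = hm.toLp m • f := rfl

theorem coeFn_mulL2 {m : E → ℂ} (hm : MemLp m ∞ (volume : Measure E))
    (f : Lp ℂ 2 (volume : Measure E)) : mulL2 hm f =ᵐ[volume] fun ξ => m ξ * f ξ := by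
  rw [mulL2_apply]
  filter_upwards [Lp.coeFn_lpSMul (r := 2) (hm.toLp m) f, hm.coeFn_toLp] with x h1 h2
  rw [h1, Pi.smul_apply', h2, smul_eq_mul]

/-- The Fourier multiplier `v ↦ 𝓕⁻ (m 𝓕 v)` on square integrable functions. -/
noncomputable def fourierMultiplierL2 {m : E → ℂ} (hm : MemLp m ∞ (volume : Measure E)) :
    Lp ℂ 2 (volume : Measure E) →L[ℂ] Lp ℂ 2 (volume : Measure E) :=
  fourierInvCLM ℂ _ ∘L mulL2 hm ∘L fourierCLM ℂ _

theorem fourierMultiplierL2_apply {m : E → ℂ} (hm : MemLp m ∞ (volume : Measure E))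
    (f : Lp ℂ 2 (volume : Measure E)) :
    fourierMultiplierL2 hm f = 𝓕⁻ (mulL2 hm (𝓕 f)) := rfl

theorem toTemperedDistribution_fourierMultiplierL2 {m : E → ℂ}
    (hm : MemLp m ∞ (volume : Measure E)) (hm' : m.HasTemperateGrowth)
    (f : Lp ℂ 2 (volume : Measure E)) :
    (fourierMultiplierL2 hm f : 𝓢'(E, ℂ)) =
      TemperedDistribution.fourierMultiplierCLM ℂ m (f : 𝓢'(E, ℂ)) := by
  rw [fourierMultiplierL2_apply, ← Lp.fourierInv_toTemperedDistribution_eq, mulL2_apply,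
    Lp.toTemperedDistribution_smul_eq hm', ← Lp.fourier_toTemperedDistribution_eq,
    TemperedDistribution.fourierMultiplierCLM_apply]

end SquareIntegrable

/-! ### Inverting the Bessel potential -/

namespace SobolevSpace

open FourierTransform
open scoped ENNReal

variable {d : ℕ} {s : ℝ}

theorem memLp_top_besselSymbol (hs : 0 ≤ s) : MemLp
    (fun ξ : EuclideanSpace ℝ (Fin d) => (((1 + ‖ξ‖ ^ 2) ^ (-s / 2) : ℝ) : ℂ)) ∞ volume := by
  refine memLp_top_of_forall_norm_le (C := 1) ?_ fun ξ => ?_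
  · have : (fun ξ : EuclideanSpace ℝ (Fin d) => (1 + ‖ξ‖ ^ 2) ^ (-s / 2)).HasTemperateGrowth := by
      fun_prop
    exact Complex.continuous_ofReal.comp this.1.continuous
  · rw [Complex.norm_real, Real.norm_eq_abs, abs_eq_self.mpr (by positivity)]
    exact Real.rpow_le_one_of_one_le_of_nonpos (by simp) (by linarith)

/-- For `s ≥ 0` the inverse symbol is bounded by `1`, so it acts on `L²`; every square integrable
function is thus the Bessel potential of an element of `H^s`. -/
theorem besselPotential_fourierMultiplierL2 (hs : 0 ≤ s)
    (v : Lp ℂ 2 (volume : Measure (EuclideanSpace ℝ (Fin d)))) :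
    TemperedDistribution.besselPotential _ ℂ s
      (fourierMultiplierL2 (memLp_top_besselSymbol hs) v : 𝓢'(EuclideanSpace ℝ (Fin d), ℂ)) =
      v := by
  rw [toTemperedDistribution_fourierMultiplierL2 _ (by fun_prop),
    ← TemperedDistribution.besselPotential_neg_apply_eq_iff]
  rfl

/-- The function in `H^s(ℝ^d)` whose Bessel potential is a given square integrable function. -/
noncomputable def ofBessel (hs : 0 ≤ s) :
    Lp ℂ 2 (volume : Measure (EuclideanSpace ℝ (Fin d))) →ₗ[ℂ] SobolevSpace d s :=
  LinearMap.codRestrict (sobolevSubmodule d s)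
    (fourierMultiplierL2 (memLp_top_besselSymbol hs)).toLinearMap
    fun v => ⟨v, besselPotential_fourierMultiplierL2 hs v⟩

theorem toL2_ofBessel (hs : 0 ≤ s) (v : Lp ℂ 2 (volume : Measure (EuclideanSpace ℝ (Fin d)))) :
    toL2 (ofBessel hs v) = fourierMultiplierL2 (memLp_top_besselSymbol hs) v := rfl

theorem bessel_ofBessel (hs : 0 ≤ s) (v : Lp ℂ 2 (volume : Measure (EuclideanSpace ℝ (Fin d)))) :
    bessel (ofBessel hs v) = v := by
  apply toTemperedDistribution_injective
  have := bessel_spec (ofBessel hs v)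
  rw [toL2_ofBessel, besselPotential_fourierMultiplierL2 hs] at this
  exact this.symm

theorem norm_ofBessel (hs : 0 ≤ s) (v : Lp ℂ 2 (volume : Measure (EuclideanSpace ℝ (Fin d)))) :
    ‖ofBessel hs v‖ = ‖v‖ := by
  rw [norm_def, bessel_ofBessel]

theorem toL2_injective : Function.Injective (toL2 : SobolevSpace d s →ₗ[ℂ] _) :=
  Subtype.val_injective

end SobolevSpace

/-! ### The Fourier transform of a ball: formula, decay, a zero sphere -/

section BallTransform

open FourierTransform
open scoped Real ENNReal

/-- The indicator function of the ball with centre `x` and radius `R`. -/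
noncomputable def ballIndicator (R : ℝ) (x : E3) : E3 → ℂ :=
  (closedBall x R).indicator fun _ => 1

theorem memLp_ballIndicator (R : ℝ) (x : E3) (p : ℝ≥0∞) : MemLp (ballIndicator R x) p :=
  memLp_indicator_const p measurableSet_closedBall 1 (Or.inr measure_closedBall_lt_top.ne)

theorem integrable_ballIndicator (R : ℝ) (x : E3) : Integrable (ballIndicator R x) :=
  memLp_one_iff_integrable.mp (memLp_ballIndicator R x 1)

/-- The Fourier transform of the indicator function of the ball with centre `0`. -/
noncomputable def ballTransform (R : ℝ) : E3 → ℂ := 𝓕 (ballIndicator R 0)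

theorem continuous_ballTransform (R : ℝ) : Continuous (ballTransform R) :=
  continuous_fourier_of_integrable (integrable_ballIndicator R 0)

theorem memLp_ballTransform (R : ℝ) : MemLp (ballTransform R) 2 :=
  (memLp_congr_ae (coeFn_fourier_toLp (integrable_ballIndicator R 0)
    (memLp_ballIndicator R 0 2))).mp (Lp.memLp _)

theorem fourier_ballIndicator (R : ℝ) (x ξ : E3) :
    𝓕 (ballIndicator R x) ξ = Real.fourierChar (-inner ℝ x ξ) * ballTransform R ξ := by
  rw [ballTransform, Real.fourier_eq, Real.fourier_eq, ← integral_const_mul,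
    ← integral_add_right_eq_self _ x]
  refine integral_congr_ae (Filter.Eventually.of_forall fun v => ?_)
  have : ballIndicator R x (v + x) = ballIndicator R 0 v := by
    simp [ballIndicator, Set.indicator, mem_closedBall, dist_eq_norm]
  simp only [this, inner_add_left, neg_add, AddChar.map_add_eq_mul, Circle.smul_def,
    smul_eq_mul, Circle.coe_mul]
  ring

theorem norm_ballTransform_le (R : ℝ) (ξ : E3) :
    ‖ballTransform R ξ‖ ≤ volume.real (closedBall (0 : E3) R) := by
  rw [ballTransform, Real.fourier_eq]
  refine (norm_integral_le_integral_norm _).trans_eq ?_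
  simp_rw [Circle.norm_smul]
  have : (fun v => ‖ballIndicator R 0 v‖) = (closedBall (0 : E3) R).indicator fun _ => (1 : ℝ) := by
    ext v
    by_cases hv : v ∈ closedBall (0 : E3) R <;> simp [ballIndicator, hv]
  rw [this, integral_indicator measurableSet_closedBall]
  simp

/-- By Archimedes this is the mean of `e^{-ikt}` over `[-1,1]`. -/
theorem integral_exp_mul_sphere (y : S2) (k : ℝ) (hk : k ≠ 0) :
    ∫ ω : S2, Complex.exp ((-k * inner ℝ (ω : E3) (y : E3) : ℝ) * Complex.I) ∂(sphereMeasure 3) =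
      (Real.sin k / k : ℝ) := by
  have hm := measurePreserving_inner y
  have hc : Continuous fun t : ℝ => Complex.exp ((-k * t : ℝ) * Complex.I) := by fun_prop
  have h1 : ∫ ω : S2, Complex.exp ((-k * inner ℝ (ω : E3) (y : E3) : ℝ) * Complex.I)
      ∂(sphereMeasure 3) = ∫ t, Complex.exp ((-k * t : ℝ) * Complex.I) ∂uniformMeasure := by
    rw [← hm.map_eq, integral_map hm.measurable.aemeasurable hc.aestronglyMeasurable]
  rw [h1, integral_uniformMeasure]
  have hk' : (k : ℂ) ≠ 0 := by exact_mod_cast hk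
  have h2 : ∫ t in (-1 : ℝ)..1, Complex.exp ((-k * t : ℝ) * Complex.I) =
      ∫ t in (-1 : ℝ)..1, Complex.exp ((-k * Complex.I) * t) := by
    refine intervalIntegral.integral_congr fun t _ => ?_
    push_cast
    ring_nf
  rw [h2, integral_exp_mul_complex (by simp [hk])]
  have e1 : (-(k : ℂ) * Complex.I) * ((1 : ℝ) : ℂ) = (-k : ℂ) * Complex.I := by push_cast; ring
  have e2 : (-(k : ℂ) * Complex.I) * ((-1 : ℝ) : ℂ) = (k : ℂ) * Complex.I := by push_cast; ring
  rw [e1, e2, Complex.exp_mul_I, Complex.exp_mul_I, Complex.cos_neg, Complex.sin_neg]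
  push_cast
  rw [Complex.real_smul]
  push_cast
  field_simp
  ring

theorem integral_mul_sin (k R : ℝ) (hk : k ≠ 0) :
    ∫ ρ in (0 : ℝ)..R, ρ * Real.sin (k * ρ) / k =
      (Real.sin (k * R) - k * R * Real.cos (k * R)) / k ^ 3 := by
  have hd : ∀ ρ : ℝ, HasDerivAt
      (fun ρ => (Real.sin (k * ρ) - k * ρ * Real.cos (k * ρ)) / k ^ 3)
      (ρ * Real.sin (k * ρ) / k) ρ := by
    intro ρ
    have h1 : HasDerivAt (fun ρ : ℝ => k * ρ) k ρ := by
      simpa using (hasDerivAt_id ρ).const_mul k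
    have := ((h1.sin).sub (h1.mul h1.cos)).div_const (k ^ 3)
    convert! this using 1
    field_simp
    ring
  rw [intervalIntegral.integral_eq_sub_of_hasDerivAt (fun ρ _ => hd ρ)
    (Continuous.intervalIntegrable (by fun_prop) _ _)]
  simp

/-- In polar coordinates the spherical mean of the character at radius `ρ` is `sin(κρ)/(κρ)` with `κ
= 2π|ξ|`, which leaves an elementary integral over `[0,R]`. -/
theorem ballTransform_eq {R : ℝ} (hR : 0 ≤ R) {ξ : E3} (hξ : ξ ≠ 0) :
    ballTransform R ξ = (sphereArea *
      ((Real.sin (2 * π * ‖ξ‖ * R) - 2 * π * ‖ξ‖ * R * Real.cos (2 * π * ‖ξ‖ * R)) /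
        (2 * π * ‖ξ‖) ^ 3) : ℝ) := by
  have hn : 0 < ‖ξ‖ := norm_pos_iff.mpr hξ
  have hκ : 2 * π * ‖ξ‖ ≠ 0 := by positivity
  set κ := 2 * π * ‖ξ‖ with hκdef
  set y : S2 := ⟨‖ξ‖⁻¹ • ξ, by simp [norm_smul, hn.ne']⟩ with hy
  have hyξ : ∀ v : E3, inner ℝ v ξ = ‖ξ‖ * inner ℝ v (y : E3) := by
    intro v
    rw [hy, inner_smul_right]
    field_simp
  have hF : Integrable fun v : E3 =>
      Complex.exp ((-2 * π * inner ℝ v ξ : ℝ) * Complex.I) • ballIndicator R 0 v := by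
    have := (Real.fourierIntegral_convergent_iff ξ).mpr (integrable_ballIndicator R 0)
    refine this.congr (Filter.Eventually.of_forall fun v => ?_)
    simp only [Circle.smul_def, Real.fourierChar_apply]
    congr 4
    ring
  rw [ballTransform, Real.fourier_eq', integral_polar hF]
  have hin : ∀ ρ ∈ Set.Ioi (0 : ℝ), (ρ ^ 2 • ∫ ω : S2,
      Complex.exp ((-2 * π * inner ℝ (ρ • (ω : E3)) ξ : ℝ) * Complex.I) •
        ballIndicator R 0 (ρ • (ω : E3)) ∂(sphereMeasure 3)) =
      (Set.Iic R).indicator (fun ρ => ((ρ * Real.sin (κ * ρ) / κ : ℝ) : ℂ)) ρ := by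
    intro ρ hρ
    have hρ' : (0 : ℝ) < ρ := hρ
    have hball : ∀ ω : S2, ballIndicator R 0 (ρ • (ω : E3)) =
        (Set.Iic R).indicator (fun _ => 1) ρ := by
      intro ω
      have : ‖ρ • (ω : E3)‖ = ρ := by
        rw [norm_smul, mem_sphere_zero_iff_norm.mp ω.2, mul_one, Real.norm_of_nonneg hρ'.le]
      simp [ballIndicator, Set.indicator, this]
    have hexp : ∀ ω : S2, Complex.exp ((-2 * π * inner ℝ (ρ • (ω : E3)) ξ : ℝ) * Complex.I) =
        Complex.exp ((-(κ * ρ) * inner ℝ (ω : E3) (y : E3) : ℝ) * Complex.I) := by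
      intro ω
      rw [hyξ, real_inner_smul_left, hκdef]
      congr 3
      ring
    simp_rw [hball, hexp]
    by_cases hR' : ρ ∈ Set.Iic R
    · simp only [Set.indicator_of_mem hR', smul_eq_mul, mul_one]
      rw [integral_exp_mul_sphere y _ (mul_ne_zero hκ hρ'.ne'), Complex.real_smul,
        ← Complex.ofReal_mul]
      congr 1
      field_simp
    · simp [Set.indicator_of_notMem hR']
  rw [setIntegral_congr_fun measurableSet_Ioi hin, setIntegral_indicator measurableSet_Iic,
    Set.Ioi_inter_Iic, ← intervalIntegral.integral_of_le hR, intervalIntegral.integral_ofReal,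
    integral_mul_sin κ R hκ, Complex.real_smul, ← Complex.ofReal_mul]

/-- The Fourier transform of the indicator function of a ball decays quadratically. -/
theorem exists_ballTransform_bound {R : ℝ} (hR : 0 ≤ R) :
    ∃ C, ∀ ξ, (1 + ‖ξ‖ ^ 2) * ‖ballTransform R ξ‖ ≤ C := by
  have hA := sphereArea_pos
  refine ⟨2 * volume.real (closedBall (0 : E3) R) + 2 * (sphereArea * (1 + R)), fun ξ => ?_⟩
  have hV : 0 ≤ volume.real (closedBall (0 : E3) R) := measureReal_nonneg
  have hAR : 0 ≤ sphereArea * (1 + R) := by positivity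
  rcases le_or_gt ‖ξ‖ 1 with h | h
  · have h1 : 1 + ‖ξ‖ ^ 2 ≤ 2 := by nlinarith [norm_nonneg ξ]
    have := mul_le_mul h1 (norm_ballTransform_le R ξ) (norm_nonneg _) (by norm_num)
    linarith
  · have hξ : ξ ≠ 0 := by
      rintro rfl
      simp at h
      linarith
    rw [ballTransform_eq hR hξ, Complex.norm_real, Real.norm_eq_abs, abs_mul, abs_of_pos hA,
      abs_div]
    set κ := 2 * π * ‖ξ‖ with hκdef
    have hκ : ‖ξ‖ ≤ κ := by
      rw [hκdef]
      nlinarith [Real.pi_gt_three]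
    have hκ1 : 1 ≤ κ := h.le.trans hκ
    have hκ0 : 0 < κ := by linarith
    have hnum : |Real.sin (κ * R) - κ * R * Real.cos (κ * R)| ≤ (1 + R) * κ := by
      have h1 := Real.abs_sin_le_one (κ * R)
      have h2 := Real.abs_cos_le_one (κ * R)
      have h3 : |κ * R * Real.cos (κ * R)| ≤ κ * R := by
        rw [abs_mul, abs_of_nonneg (by positivity)]
        exact mul_le_of_le_one_right (by positivity) h2
      have h4 := abs_sub (Real.sin (κ * R)) (κ * R * Real.cos (κ * R))
      nlinarith
    rw [abs_of_pos (by positivity : 0 < κ ^ 3)]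
    have h5 : |Real.sin (κ * R) - κ * R * Real.cos (κ * R)| / κ ^ 3 ≤ (1 + R) / ‖ξ‖ ^ 2 := by
      rw [div_le_div_iff₀ (by positivity) (by positivity)]
      have h6 : ‖ξ‖ ^ 2 ≤ κ ^ 2 := by gcongr
      calc _ ≤ ((1 + R) * κ) * κ ^ 2 := by gcongr
        _ = _ := by ring
    have h7 : 1 + ‖ξ‖ ^ 2 ≤ 2 * ‖ξ‖ ^ 2 := by nlinarith
    calc _ ≤ (2 * ‖ξ‖ ^ 2) * (sphereArea * ((1 + R) / ‖ξ‖ ^ 2)) := by gcongr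
      _ = 2 * (sphereArea * (1 + R)) := by
        have : ‖ξ‖ ≠ 0 := by positivity
        field_simp
      _ ≤ _ := by linarith

/-- The function changes sign between `π`, with value `π`, and `2π`, with value `-2π`. -/
theorem exists_zero_sin_sub_mul_cos : ∃ t > 0, Real.sin t - t * Real.cos t = 0 := by
  have hc : ContinuousOn (fun t => Real.sin t - t * Real.cos t) (Set.Icc π (2 * π)) := by fun_prop
  have := intermediate_value_Icc' (by linarith [Real.pi_pos]) hc
  have h0 : (0 : ℝ) ∈ Set.Icc (Real.sin (2 * π) - 2 * π * Real.cos (2 * π))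
      (Real.sin π - π * Real.cos π) := by
    simp [Real.pi_pos.le]
  obtain ⟨t, ht, ht0⟩ := this h0
  exact ⟨t, Real.pi_pos.trans_le ht.1, ht0⟩

theorem abs_sin_sub_mul_cos_le {t₀ t : ℝ} (h0 : 0 ≤ t₀) (ht : t₀ ≤ t)
    (hz : Real.sin t₀ - t₀ * Real.cos t₀ = 0) :
    |Real.sin t - t * Real.cos t| ≤ t * (t - t₀) := by
  have hd : ∀ s ∈ Set.Icc t₀ t, HasDerivWithinAt (fun t => Real.sin t - t * Real.cos t)
      (s * Real.sin s) (Set.Icc t₀ t) s := by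
    intro s _
    have := (Real.hasDerivAt_sin s).sub ((hasDerivAt_id s).mul (Real.hasDerivAt_cos s))
    refine HasDerivAt.hasDerivWithinAt ?_
    convert! this using 1
    simp
  have hb : ∀ s ∈ Set.Icc t₀ t, ‖s * Real.sin s‖ ≤ t := by
    intro s hs
    rw [norm_mul, Real.norm_eq_abs, Real.norm_eq_abs, abs_of_nonneg (h0.trans hs.1)]
    exact (mul_le_of_le_one_right (h0.trans hs.1) (Real.abs_sin_le_one s)).trans hs.2
  have := Convex.norm_image_sub_le_of_norm_hasDerivWithin_le hd hb (convex_Icc t₀ t)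
    (Set.left_mem_Icc.mpr ht) (Set.right_mem_Icc.mpr ht)
  rwa [hz, sub_zero, Real.norm_eq_abs, Real.norm_eq_abs, abs_of_nonneg (sub_nonneg.mpr ht)] at this

/-- The Fourier transform of the indicator function of a ball vanishes on a sphere. -/
theorem exists_ballTransform_zero {R : ℝ} (hR : 0 < R) :
    ∃ ρ₀ > 0, ∃ M > 0, ∀ ξ : E3, ρ₀ ≤ ‖ξ‖ → ‖ξ‖ ≤ 2 * ρ₀ →
      (1 + ‖ξ‖ ^ 2) * ‖ballTransform R ξ‖ ≤ M * (‖ξ‖ - ρ₀) := by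
  obtain ⟨t, ht, hz⟩ := exists_zero_sin_sub_mul_cos
  have hA := sphereArea_pos
  have hpi := Real.pi_pos
  -- At `|ξ| = ρ₀` the argument `2π|ξ|R` equals the zero `t`; for `|ξ| ≤ 2ρ₀` it stays below `2t`,
  -- which gives the constant in the linear bound.
  set ρ₀ := t / (2 * π * R) with hρ₀
  have hρ : 0 < ρ₀ := by positivity
  have htρ : t = 2 * π * ρ₀ * R := by rw [hρ₀]; field_simp
  refine ⟨ρ₀, hρ, (1 + (2 * ρ₀) ^ 2) * (sphereArea * ((2 * t) * (2 * π * R) / (2 * π * ρ₀) ^ 3)),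
    by positivity, fun ξ h1 h2 => ?_⟩
  have hξ : ξ ≠ 0 := norm_pos_iff.mp (hρ.trans_le h1)
  have hsub : 0 ≤ ‖ξ‖ - ρ₀ := sub_nonneg.mpr h1
  rw [ballTransform_eq hR.le hξ, Complex.norm_real, Real.norm_eq_abs, abs_mul, abs_of_pos hA,
    abs_div, abs_of_pos (by positivity : 0 < (2 * π * ‖ξ‖) ^ 3)]
  have hle : t ≤ 2 * π * ‖ξ‖ * R := by rw [htρ]; gcongr
  have hle2 : 2 * π * ‖ξ‖ * R ≤ 2 * t := by
    calc _ ≤ 2 * π * (2 * ρ₀) * R := by gcongr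
      _ = 2 * t := by rw [htρ]; ring
  have hk := abs_sin_sub_mul_cos_le ht.le hle hz
  have hk2 : 2 * π * ‖ξ‖ * R * (2 * π * ‖ξ‖ * R - t) ≤ (2 * t) * ((2 * π * R) * (‖ξ‖ - ρ₀)) := by
    have : 2 * π * ‖ξ‖ * R - t = (2 * π * R) * (‖ξ‖ - ρ₀) := by rw [htρ]; ring
    rw [this]
    gcongr
  calc _ ≤ (1 + (2 * ρ₀) ^ 2) * (sphereArea *
        (((2 * t) * ((2 * π * R) * (‖ξ‖ - ρ₀))) / (2 * π * ρ₀) ^ 3)) := by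
        gcongr
        exact hk.trans hk2
    _ = _ := by ring

end BallTransform

/-- A feature map of a kernel represents the elements of its reproducing kernel Hilbert space. -/
theorem exists_feature_representation {X H F : Type*} [NormedAddCommGroup H]
    [InnerProductSpace ℂ H] [RKHS ℂ H X ℂ] [CompleteSpace H] [NormedAddCommGroup F]
    [InnerProductSpace ℂ F] [CompleteSpace F] {k : X → X → ℂ}
    (hk : RKHS.kernel H = kernelMatrix k) (Φ : X → F) (hΦ : ∀ x y, inner ℂ (Φ x) (Φ y) = k x y) :
    ∃ V : H →L[ℂ] F, ∀ f x, f x = inner ℂ (Φ x) (V f) := by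
  -- Reproducing elements and features have the same Gram matrix, so mapping one family to the other
  -- preserves norms of finite combinations and extends to `H`.
  obtain ⟨V, hV⟩ := exists_clm_of_norm_le (H := H) Φ (C := 1) (fun w => by
    rw [one_mul, ← sq_le_sq₀ (norm_nonneg _) (norm_nonneg _)]
    have h1 := congrArg Complex.re (norm_sq_linearCombination Φ w)
    rw [Complex.ofReal_re] at h1
    simp_rw [hΦ] at h1
    rw [norm_sq_linearCombination_reproducer hk, h1])
  refine ⟨V, fun f x => ?_⟩
  rw [← inner_reproducer]
  refine congrFun ((denseRange_linearCombination_reproducer (H := H)).equalizer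
    (g := fun f : H => inner ℂ (reproducer H x) f) (h := fun f : H => inner ℂ (Φ x) (V f))
    (by fun_prop) (by fun_prop) (funext fun w => ?_)) f
  simp only [Function.comp_apply, hV]
  simp only [Finsupp.linearCombination_apply, Finsupp.sum, inner_sum, inner_smul_right,
    inner_reproducer_reproducer hk, hΦ]

/-! ### The embedding into `H²(ℝ³)` -/

section Embedding

open FourierTransform
open scoped ENNReal

/-- The normalization `vol(B_R)^{-1/2}`. -/
noncomputable def ballWeight (R : ℝ) : ℝ := √(volume.real (closedBall (0 : E3) R))⁻¹

theorem ballWeight_nonneg (R : ℝ) : 0 ≤ ballWeight R := Real.sqrt_nonneg _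

theorem ballWeight_pos {R : ℝ} (hR : 0 < R) : 0 < ballWeight R :=
  Real.sqrt_pos.mpr (inv_pos.mpr (ENNReal.toReal_pos (measure_closedBall_pos _ _ hR).ne'
    measure_closedBall_lt_top.ne))

/-- The feature map of the kernel `K_{3,2R}`. -/
noncomputable def ballFeature (R : ℝ) (x : E3) : Lp ℂ 2 (volume : Measure E3) :=
  (ballWeight R : ℂ) • (memLp_ballIndicator R x 2).toLp _

theorem inner_ballFeature (r : ℝ) (x y : E3) :
    inner ℂ (ballFeature (r / 2) x) (ballFeature (r / 2) y) = (ballKernel 3 r x y : ℂ) := by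
  have h := L2.inner_indicatorConstLp_one_indicatorConstLp_one (𝕜 := ℂ) (μ := volume)
    (measurableSet_closedBall (x := x) (ε := r / 2))
    (measurableSet_closedBall (x := y) (ε := r / 2))
    measure_closedBall_lt_top.ne measure_closedBall_lt_top.ne
  have hk : ballKernel 3 r x y = (volume.real (closedBall (0 : E3) (r / 2)))⁻¹ *
      volume.real (closedBall x (r / 2) ∩ closedBall y (r / 2)) := by
    rw [ballKernel]
    congr 1
    simp_rw [dirac_real_closedBall]
    have : (fun z => (closedBall x (r / 2)).indicator (fun _ => (1 : ℝ)) z *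
        (closedBall y (r / 2)).indicator (fun _ => (1 : ℝ)) z) =
        (closedBall x (r / 2) ∩ closedBall y (r / 2)).indicator fun _ => (1 : ℝ) := by
      ext z
      by_cases h1 : z ∈ closedBall x (r / 2) <;> by_cases h2 : z ∈ closedBall y (r / 2) <;>
        simp [Set.indicator, h1, h2]
    rw [this, integral_indicator (measurableSet_closedBall.inter measurableSet_closedBall)]
    simp
  have hw : (ballWeight (r / 2) : ℂ) * ballWeight (r / 2) =
      ((volume.real (closedBall (0 : E3) (r / 2)))⁻¹ : ℝ) := by
    rw [← Complex.ofReal_mul, ballWeight, Real.mul_self_sqrt (by positivity)]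
  have h' : inner ℂ ((memLp_ballIndicator (r / 2) x 2).toLp _)
      ((memLp_ballIndicator (r / 2) y 2).toLp _) =
      (volume.real (closedBall x (r / 2) ∩ closedBall y (r / 2)) : ℂ) := h
  rw [ballFeature, ballFeature, inner_smul_left, inner_smul_right, h', Complex.conj_ofReal,
    ← mul_assoc, hw, hk, Complex.ofReal_mul]

theorem coeFn_fourier_ballFeature (R : ℝ) (x : E3) :
    (𝓕 (ballFeature R x) : Lp ℂ 2 (volume : Measure E3)) =ᵐ[volume]
      fun ξ => ballWeight R * (Real.fourierChar (-inner ℝ x ξ) * ballTransform R ξ) := by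
  rw [ballFeature, fourier_smul]
  filter_upwards [Lp.coeFn_smul (ballWeight R : ℂ)
    (𝓕 ((memLp_ballIndicator R x 2).toLp _) : Lp ℂ 2 (volume : Measure E3)),
    coeFn_fourier_toLp (integrable_ballIndicator R x) (memLp_ballIndicator R x 2)] with ξ h1 h2
  rw [h1, Pi.smul_apply, h2, fourier_ballIndicator, smul_eq_mul]

/-- The elements of the reproducing kernel Hilbert space of `K_{3,r}` are images of square
integrable functions. -/
theorem exists_ballFeature_representation (r : ℝ) :
    ∃ V : RKHS.OfKernel (ballMatrix 3 r) →L[ℂ] Lp ℂ 2 (volume : Measure E3),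
      ∀ f x, f x = inner ℂ (ballFeature (r / 2) x) (V f) :=
  exists_feature_representation (RKHS.OfKernel.kernel_ofKernel (K := ballMatrix 3 r)) _
    (inner_ballFeature r)

/-- The symbol `vol(B_R)^{-1/2} (1 + |ξ|²) conj (𝓕 1_{B_R} (ξ))`. -/
noncomputable def ballSymbol (R : ℝ) (ξ : E3) : ℂ :=
  ballWeight R * ((1 + ‖ξ‖ ^ 2 : ℝ) * conj (ballTransform R ξ))

theorem norm_ballSymbol (R : ℝ) (ξ : E3) :
    ‖ballSymbol R ξ‖ = ballWeight R * ((1 + ‖ξ‖ ^ 2) * ‖ballTransform R ξ‖) := by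
  rw [ballSymbol, norm_mul, norm_mul, RCLike.norm_conj, Complex.norm_real, Complex.norm_real,
    Real.norm_of_nonneg (ballWeight_nonneg R), Real.norm_of_nonneg (by positivity)]

theorem memLp_ballSymbol {R : ℝ} (hR : 0 ≤ R) : MemLp (ballSymbol R) ∞ := by
  obtain ⟨C, hC⟩ := exists_ballTransform_bound hR
  refine memLp_top_of_forall_norm_le (C := ballWeight R * C) ?_ fun ξ => ?_
  · have := continuous_ballTransform R
    unfold ballSymbol
    fun_prop
  · rw [norm_ballSymbol]
    exact mul_le_mul_of_nonneg_left (hC ξ) (ballWeight_nonneg R)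

/-- The density of the Fourier representation of `x ↦ ⟪ballFeature R x, g⟫`. -/
noncomputable def ballDensity (R : ℝ) (g : Lp ℂ 2 (volume : Measure E3)) (ξ : E3) : ℂ :=
  ballWeight R * (conj (ballTransform R ξ) * (𝓕 g : Lp ℂ 2 (volume : Measure E3)) ξ)

theorem integrable_ballDensity (R : ℝ) (g : Lp ℂ 2 (volume : Measure E3)) :
    Integrable (ballDensity R g) :=
  ((memLp_ballTransform R).star.integrable_mul (Lp.memLp _)).const_mul _

theorem inner_ballFeature_eq_fourierInv (R : ℝ) (g : Lp ℂ 2 (volume : Measure E3)) (x : E3) :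
    inner ℂ (ballFeature R x) g = 𝓕⁻ (ballDensity R g) x := by
  rw [← Lp.inner_fourier_eq, L2.inner_def, Real.fourierInv_eq]
  refine integral_congr_ae ?_
  filter_upwards [coeFn_fourier_ballFeature R x] with ξ h
  rw [h, RCLike.inner_apply, ballDensity, Circle.smul_def, smul_eq_mul]
  simp only [map_mul, Complex.conj_ofReal]
  rw [← Circle.coe_inv_eq_conj, ← AddChar.map_neg_eq_inv, neg_neg, real_inner_comm]
  ring

/-- The Bessel factor `(1+|ξ|²)⁻¹` cancels the weight that was put into the symbol, so the Sobolev
function built from `g` has the same Fourier density as `x ↦ ⟪ballFeature R x, g⟫`. -/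
theorem coeFn_mulL2_ballSymbol {R : ℝ} (hR : 0 ≤ R) (g : Lp ℂ 2 (volume : Measure E3)) :
    mulL2 (SobolevSpace.memLp_top_besselSymbol (d := 3) (s := 2) zero_le_two)
      (mulL2 (memLp_ballSymbol hR) (𝓕 g)) =ᵐ[volume] ballDensity R g := by
  filter_upwards [coeFn_mulL2 (SobolevSpace.memLp_top_besselSymbol (d := 3) (s := 2) zero_le_two)
    (mulL2 (memLp_ballSymbol hR) (𝓕 g)), coeFn_mulL2 (memLp_ballSymbol hR) (𝓕 g)] with ξ h1 h2
  have h3 : (1 + ‖ξ‖ ^ 2 : ℝ) ^ (-2 / 2 : ℝ) = (1 + ‖ξ‖ ^ 2)⁻¹ := by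
    rw [show (-2 / 2 : ℝ) = -1 by norm_num, Real.rpow_neg_one]
  have h4 : ((1 + ‖ξ‖ ^ 2 : ℝ) : ℂ) ≠ 0 := by
    rw [Complex.ofReal_ne_zero]
    positivity
  rw [h1, h2, h3, ballSymbol, ballDensity, Complex.ofReal_inv]
  field_simp

/-- The embedding into `H^2(ℝ^3)`, in terms of the representing square integrable functions. -/
noncomputable def ballEmbedding {R : ℝ} (hR : 0 ≤ R) (g : Lp ℂ 2 (volume : Measure E3)) :
    SobolevSpace 3 2 :=
  SobolevSpace.ofBessel zero_le_two (fourierMultiplierL2 (memLp_ballSymbol hR) g)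

theorem coeFn_toL2_ballEmbedding {R : ℝ} (hR : 0 ≤ R) (g : Lp ℂ 2 (volume : Measure E3)) :
    (ballEmbedding hR g).toL2 =ᵐ[volume] fun x => inner ℂ (ballFeature R x) g := by
  have hd := coeFn_mulL2_ballSymbol hR g
  have hm : MemLp (ballDensity R g) 2 := (memLp_congr_ae hd).mp (Lp.memLp _)
  have h1 : (ballEmbedding hR g).toL2 = 𝓕⁻ (hm.toLp _) := by
    rw [ballEmbedding, SobolevSpace.toL2_ofBessel, fourierMultiplierL2_apply,
      fourierMultiplierL2_apply, fourier_fourierInv_eq]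
    congr 1
    exact Lp.ext (hd.trans hm.coeFn_toLp.symm)
  rw [h1]
  simp_rw [inner_ballFeature_eq_fourierInv]
  exact coeFn_fourierInv_toLp (integrable_ballDensity R g) hm

theorem continuous_inner_ballFeature (R : ℝ) (g : Lp ℂ 2 (volume : Measure E3)) :
    Continuous fun x => inner ℂ (ballFeature R x) g := by
  simp_rw [inner_ballFeature_eq_fourierInv]
  exact continuous_fourierInv_of_integrable (integrable_ballDensity R g)

theorem exists_embedding {r : ℝ} (hr : 0 ≤ r) :
    ∃ J : RKHS.OfKernel (ballMatrix 3 r) →L[ℂ] SobolevSpace 3 2,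
      Function.Injective J ∧ ∀ f, (J f).toL2 =ᵐ[volume] (f : E3 → ℂ) := by
  obtain ⟨V, hV⟩ := exists_ballFeature_representation r
  have hR : 0 ≤ r / 2 := by positivity
  set B := fourierMultiplierL2 (memLp_ballSymbol hR) ∘L V with hB
  set J : RKHS.OfKernel (ballMatrix 3 r) →L[ℂ] SobolevSpace 3 2 :=
    (SobolevSpace.ofBessel zero_le_two ∘ₗ B.toLinearMap).mkContinuous ‖B‖ fun f => by
      rw [LinearMap.comp_apply, SobolevSpace.norm_ofBessel]
      exact B.le_opNorm f with hJ
  have hJf : ∀ f, J f = ballEmbedding hR (V f) := fun f => rfl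
  have hae : ∀ f, (J f).toL2 =ᵐ[volume] (f : E3 → ℂ) := by
    intro f
    rw [hJf, funext (hV f)]
    exact coeFn_toL2_ballEmbedding hR (V f)
  have hc : ∀ f : RKHS.OfKernel (ballMatrix 3 r), Continuous (f : E3 → ℂ) := by
    intro f
    rw [funext (hV f)]
    exact continuous_inner_ballFeature _ _
  refine ⟨J, fun f f' h => ?_, hae⟩
  have h1 := hae f
  rw [h] at h1
  exact RKHS.ext fun x => congrFun
    ((Continuous.ae_eq_iff_eq volume (hc f) (hc f')).mp (h1.symm.trans (hae f'))) x

end Embedding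

/-! ### An element of `H²(ℝ³)` outside the RKHS -/

section Counterexample

open FourierTransform
open scoped ENNReal

theorem le_volume_real_shell {ρ ε : ℝ} (hρ : 0 ≤ ρ) (hε : 0 ≤ ε) :
    3 * ρ ^ 2 * ε * volume.real (ball (0 : E3) 1) ≤
      volume.real (closedBall (0 : E3) (ρ + ε) \ closedBall 0 ρ) := by
  rw [measureReal_sdiff (closedBall_subset_closedBall (by linarith)) measurableSet_closedBall
      measure_closedBall_lt_top.ne,
    Measure.addHaar_real_closedBall _ _ (by positivity), Measure.addHaar_real_closedBall _ _ hρ,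
    ← sub_mul]
  have : Module.finrank ℝ E3 = 3 := by simp
  rw [this]
  gcongr
  nlinarith [pow_nonneg hε 3, mul_nonneg hρ (sq_nonneg ε)]

/-- A function which grows like the inverse distance to a sphere is not square integrable. -/
theorem not_forall_one_le_mul_norm (h : Lp ℂ 2 (volume : Measure E3)) {ρ M : ℝ} (hρ : 0 < ρ)
    (hM : 0 < M) :
    ¬ ∀ᵐ ξ : E3, ρ ≤ ‖ξ‖ → ‖ξ‖ ≤ 2 * ρ → 1 ≤ M * (‖ξ‖ - ρ) * ‖h ξ‖ := by
  intro hh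
  have hsq : Integrable fun ξ => ‖h ξ‖ ^ 2 :=
    (memLp_two_iff_integrable_sq_norm (Lp.aestronglyMeasurable h)).mp (Lp.memLp h)
  set I := ∫ ξ, ‖h ξ‖ ^ 2 with hI
  set v := volume.real (ball (0 : E3) 1) with hv
  have hvpos : 0 < v := ENNReal.toReal_pos (measure_ball_pos _ _ one_pos).ne' measure_ball_lt_top.ne
  -- On the shell of thickness `ε` the hypothesis gives `1 ≤ (Mε)²|h|²`. The volume of the shell is
  -- at least of order `ε`, while the integral of the right side is of order `ε²`; a small `ε` is
  -- contradictory.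
  have key : ∀ ε, 0 < ε → ε ≤ ρ → 3 * ρ ^ 2 * ε * v ≤ (M * ε) ^ 2 * I := by
    intro ε hε hερ
    set S := closedBall (0 : E3) (ρ + ε) \ closedBall 0 ρ with hS
    have hSm : MeasurableSet S := measurableSet_closedBall.diff measurableSet_closedBall
    have hSf : volume S ≠ ∞ :=
      ((measure_mono Set.sdiff_subset).trans_lt measure_closedBall_lt_top).ne
    calc 3 * ρ ^ 2 * ε * v ≤ volume.real S := le_volume_real_shell hρ.le hε.le
      _ = ∫ ξ in S, (1 : ℝ) := by simp
      _ ≤ ∫ ξ in S, (M * ε) ^ 2 * ‖h ξ‖ ^ 2 := by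
        refine setIntegral_mono_on_ae (integrableOn_const hSf)
          (hsq.const_mul _).integrableOn hSm ?_
        filter_upwards [hh] with ξ hξ hξS
        have h1 : ‖ξ‖ ≤ ρ + ε := by simpa using hξS.1
        have h2 : ρ < ‖ξ‖ := by simpa using hξS.2
        have h3 := hξ h2.le (by linarith)
        have h4 : 1 ≤ M * ε * ‖h ξ‖ := h3.trans (by gcongr; linarith)
        rw [← mul_pow]
        exact one_le_pow₀ h4
      _ ≤ ∫ ξ, (M * ε) ^ 2 * ‖h ξ‖ ^ 2 :=
        setIntegral_le_integral (hsq.const_mul _)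
          (Filter.Eventually.of_forall fun ξ => by positivity)
      _ = (M * ε) ^ 2 * I := integral_const_mul _ _
  have hI0 : 0 ≤ I := integral_nonneg fun ξ => by positivity
  set a := 3 * ρ ^ 2 * v with ha
  have hapos : 0 < a := by positivity
  set ε := min ρ (a / (2 * (M ^ 2 * I + 1))) with hε
  have hεpos : 0 < ε := lt_min hρ (by positivity)
  have hε2 : ε * (2 * (M ^ 2 * I + 1)) ≤ a := by
    rw [← le_div_iff₀ (by positivity)]
    exact min_le_right _ _
  have h1 := key ε hεpos (min_le_left _ _)
  have h2 : a ≤ ε * (M ^ 2 * I) := by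
    refine le_of_mul_le_mul_left ?_ hεpos
    calc ε * a = 3 * ρ ^ 2 * ε * v := by rw [ha]; ring
      _ ≤ _ := h1
      _ = _ := by ring
  nlinarith [mul_nonneg hεpos.le (mul_nonneg (sq_nonneg M) hI0)]

theorem exists_sobolev_ne {r : ℝ} (hr : 0 < r) :
    ∃ u : SobolevSpace 3 2, ∀ f : RKHS.OfKernel (ballMatrix 3 r),
      ¬ u.toL2 =ᵐ[volume] (f : E3 → ℂ) := by
  obtain ⟨V, hV⟩ := exists_ballFeature_representation r
  have hR : 0 < r / 2 := by positivity
  obtain ⟨ρ₀, hρ₀, M, hM, hb⟩ := exists_ballTransform_zero hR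
  -- The indicator `a` serves as `(1+|ξ|²) û`. It equals `1` on the whole shell `ρ₀ ≤ |ξ| ≤ 2ρ₀`,
  -- where the symbol is small near the inner sphere, so the transform of any representing function
  -- must blow up there.
  set a : Lp ℂ 2 (volume : Measure E3) := (memLp_ballIndicator (2 * ρ₀) 0 2).toLp _ with ha
  refine ⟨SobolevSpace.ofBessel zero_le_two (𝓕⁻ a), fun f hf => ?_⟩
  have h1 : SobolevSpace.ofBessel zero_le_two (𝓕⁻ a) = ballEmbedding hR.le (V f) := by
    apply SobolevSpace.toL2_injective
    refine Lp.ext (hf.trans ?_)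
    rw [funext (hV f)]
    exact (coeFn_toL2_ballEmbedding hR.le (V f)).symm
  have h2 := congrArg SobolevSpace.bessel h1
  rw [ballEmbedding, SobolevSpace.bessel_ofBessel, SobolevSpace.bessel_ofBessel,
    fourierMultiplierL2_apply] at h2
  have h3 : a = mulL2 (memLp_ballSymbol hR.le) (𝓕 (V f)) := by
    have := congrArg (fun v : Lp ℂ 2 (volume : Measure E3) => 𝓕 v) h2
    simpa only [fourier_fourierInv_eq] using this
  refine not_forall_one_le_mul_norm (𝓕 (V f)) hρ₀
    (mul_pos (ballWeight_pos hR) hM) ?_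
  filter_upwards [(memLp_ballIndicator (2 * ρ₀) 0 2).coeFn_toLp,
    coeFn_mulL2 (memLp_ballSymbol hR.le) (𝓕 (V f))] with ξ h4 h5 h6 h7
  have h8 : ballIndicator (2 * ρ₀) 0 ξ = 1 := by simp [ballIndicator, h7]
  rw [← h3, ha, h4, h8] at h5
  have h9 := congrArg norm h5
  rw [norm_one, norm_mul, norm_ballSymbol] at h9
  rw [h9, mul_assoc (ballWeight (r / 2)) M]
  exact mul_le_mul_of_nonneg_right
    (mul_le_mul_of_nonneg_left (hb ξ h6 h7) (ballWeight_nonneg _)) (norm_nonneg _)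


end Counterexample

end BallDiscrepancy

theorem mainTheorem10 (r : ℝ) (hr : 1 ≤ r) :
    (∃ J : RKHS.OfKernel (BallDiscrepancy.ballMatrix 3 r) →L[ℂ] BallDiscrepancy.SobolevSpace 3 2,
      Function.Injective J ∧
        ∀ f, (J f).toL2 =ᵐ[MeasureTheory.volume] (f : EuclideanSpace ℝ (Fin 3) → ℂ)) ∧
    (∃ u : BallDiscrepancy.SobolevSpace 3 2,
      ∀ f : RKHS.OfKernel (BallDiscrepancy.ballMatrix 3 r),
        ¬ u.toL2 =ᵐ[MeasureTheory.volume] (f : EuclideanSpace ℝ (Fin 3) → ℂ)) ∧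
    (∀ (ι : ℕ → Type) [∀ m, Fintype (ι m)]
      (Y : ∀ m, ι m → Metric.sphere (0 : EuclideanSpace ℝ (Fin 3)) 1 → ℂ),
      (∀ m, BallDiscrepancy.IsSphericalHarmonicBasis 3 m (Y m)) →
      (∀ x y, Summable (BallDiscrepancy.sphereSobolevTerm 3 (3 / 2) Y x y)) ∧
      ∃ _ : Fact (BallDiscrepancy.sphereSobolevMatrix 3 (3 / 2) Y).PosSemidef,
        ∃ T : RKHS.OfKernel (BallDiscrepancy.ballMatrixSphere 3 r) ≃L[ℂ]
            RKHS.OfKernel (BallDiscrepancy.sphereSobolevMatrix 3 (3 / 2) Y),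
          ∀ f x, T f x = f x) := by
  have hr0 : 0 < r := by linarith
  refine ⟨BallDiscrepancy.exists_embedding hr0.le, BallDiscrepancy.exists_sobolev_ne hr0, ?_⟩
  intro ι _ Y hY
  have hfact : Fact (BallDiscrepancy.sphereSobolevMatrix 3 (3 / 2) Y).PosSemidef :=
    ⟨BallDiscrepancy.posSemidef_sphereSobolevMatrix hY⟩
  exact ⟨BallDiscrepancy.summable_sphereSobolevTerm hY, hfact,
    BallDiscrepancy.exists_equiv_sphere hY hr0⟩
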